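/- **Theorem.** Let $K$ be a field of characteristic $0$ and let $(A,\mu_k,\alpha)$ be an $HA_\infty$-algebra over $K$: $A=\bigoplus_{i\in\mathbb Z}A_i$ is a graded vector space, $\mu_k:A^{\otimes k}\to A$ $(k\ge 1)$ is linear of degree $k-2$, $\alpha:A\to A$ is linear of degree $0$ with $\alpha\circ\mu_k=\mu_k\circ\alpha^{\otimes k}$, and for all $n\ge 1$ and homogeneous $a_1,\dots,a_n$ $$\sum_{i+j=n+1}\ \sum_{\lambda=1}^{j}(-1)^{\lambda(i+1)+i(|a_1|+\dots+|a_{\lambda-1}|)}\,\mu_j\big(\alpha^{i-1}a_1,\dots,\alpha^{i-1}a_{\lambda-1},\mu_i(a_\lambda,\dots,a_{\lambda+i-1}),\alpha^{i-1}a_{\lambda+i},\dots,\alpha^{i-1}a_n\big)=0 .$$ *Notation.* Let $V=sA$, $V_i=A_{i-1}$, and $TV=\bigoplus_{n\ge0}V^{\otimes n}$. A map $\varrho:V^{\otimes n}\to V$ of degree $d$ commuting with $\alpha$ lifts to $\widetilde\varrho:TV\to TV$, $$\widetilde\varrho(v_1\otimes\dots\otimes v_k)=\sum_{i=0}^{k-n}(-1)^{d(|v_1|+\dots+|v_i|)}\alpha^{n-1}v_1\otimes\dots\otimes\alpha^{n-1}v_i\otimes\varrho(v_{i+1},\dots,v_{i+n})\otimes\alpha^{n-1}v_{i+n+1}\otimes\dots\otimes\alpha^{n-1}v_k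 ,$$ and $\mathrm{Coder}^d_\alpha(TV)$ is the space of all $\sum_{n\ge1}\widetilde{\varrho_n}$ with all $\varrho_n:V^{\otimes n}\to V$ of degree $d$ and commuting with $\alpha$. Put $C^p=C^p_\alpha(A,A)=\mathrm{Coder}_\alpha^{-(p-1)}(TV)$ for $p\in\mathbb Z$. Let $D$ be the coderivation with components $s\circ\mu_k\circ(s^{-1})^{\otimes k}$ (Koszul sign convention), i.e. $(v_1,\dots,v_k)\mapsto(-1)^{\sum_j(k-j)|v_j|}\,s\mu_k(s^{-1}v_1,\dots,s^{-1}v_k)$. The $\alpha$-twisted brace $\{f\}\{x_1,\dots,x_k\}$ of coderivations is the coderivation whose component of arity $N$ is the sum of all terms $$\pm f_{N-T}\big(\alpha^{T}v_1,\dots,\alpha^{T-(m_1-1)}(x_1)_{m_1}(v_{i_1},\dots,v_{i_1+m_1-1}),\dots,\alpha^{T-(m_k-1)}(x_k)_{m_k}(v_{i_k},\dots,v_{i_k+m_k-1}),\dots,\alpha^{T}v_N\big),$$ over all arities $m_j\ge1$ and all positions of $k$ disjoint consecutive blocks in this order, where $T=\sum_j(m_j-1)$, the arguments outside of the blocks are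 twisted by $\alpha^T$, and the sign is the product of the $(-1)^{|x_j|(|v_1|+\dots+|v_{i_j-1}|)}$, with $|x_j|$ the degree of the coderivation $x_j$. For $x\in C^p$, $y\in C^q$ put $[x,y]=\{x\}\{y\}-(-1)^{(p-1)(q-1)}\{y\}\{x\}$ and $\delta_\alpha(x)=[D,x]$. *Claim.* 1. $D\in\mathrm{Coder}^{-1}_\alpha(TV)$ and $D\circ D=0$. 2. For $x\in C^p$, $y\in C^q$ one has $[x,y]\in C^{p+q-1}$, and $[x,y]$ is the graded commutator $x\circ y-(-1)^{(p-1)(q-1)}y\circ x$ of endomorphisms of $TV$. 3. $(C^\bullet,\delta_\alpha)$ is a cochain complex: $\delta_\alpha(C^p)\subseteq C^{p+1}$ and $\delta_\alpha^2=0$. Its cohomology is denoted by $H^\bullet_\alpha(A,A)$. 4. The operations $\psi_1=\delta_\alpha$ and $\psi_k(x_1,\dots,x_k)=\{D\}\{x_1,\dots,x_k\}$, $k\ge2$, define an $A_\infty$-algebra structure on the cochains: $\bigoplus_pC^p$, with $C^p$ in degree $-p$, is an $HA_\infty$-algebra with structure map $\mathrm{id}$ and operations $(x_1,\dots,x_k)\mapsto(-1)^{\sum_j(k-j)(p_j-1)}\psi_k(x_1,\dots,x_k)\in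 C^{p_1+\dots+p_k+2-k}$ for $x_j\in C^{p_j}$. 5. $H^\bullet_\alpha(A,A)$ is a Gerstenhaber algebra, with product and bracket induced by the binary operation $x\cup y=(-1)^{p+1}\{D\}\{x,y\}$ of (4) and by the bracket $[x,y]$ on the cochains. That is: for cocycles $x,y$ of degrees $p,q$, $x\cup y$ and $[x,y]$ are cocycles of degrees $p+q$ and $p+q-1$; their classes depend only on those of $x$ and $y$; the product on $H^\bullet_\alpha(A,A)$ is associative and graded commutative, $x\cup y=(-1)^{pq}y\cup x$; the bracket is a graded Lie bracket of degree $-1$, i.e. $[x,y]=-(-1)^{(p-1)(q-1)}[y,x]$ and $[x,[y,z]]=[[x,y],z]+(-1)^{(p-1)(q-1)}[y,[x,z]]$; and $[x,y\cup z]=[x,y]\cup z+(-1)^{(p-1)q}y\cup[x,z]$. -/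

import Mathlib

open scoped DirectSum TensorProduct

noncomputable section

namespace HomAInf

/-! ### Families of multilinear maps as functions on words

A family of maps `f_n : V × ⋯ × V → W`, one for every arity `n`, is the same thing as a function
`f : List V → W`, with `f [v₁, …, v_n] = f_n (v₁, …, v_n)`. -/

/-- Every arity component of `f` is a `K`-multilinear map. -/
def IsMultilinear (K : Type*) [Field K] {V W : Type*} [AddCommGroup V] [Module K V]
    [AddCommGroup W] [Module K W] (f : List V → W) : Prop :=
  ∀ n : ℕ, ∃ F : MultilinearMap K (fun _ : Fin n => V) W, ∀ v : Fin n → V, F v = f (List.ofFn v)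

section Multilinear

variable {K : Type*} [Field K] {V W : Type*} [AddCommGroup V] [Module K V]
  [AddCommGroup W] [Module K W]

lemma ofFn_update_eq (a c : List V) (y : V) (x : V) :
    List.ofFn (Function.update (fun j : Fin (a ++ y :: c).length => (a ++ y :: c).get j)
      ⟨a.length, by simp⟩ x) = a ++ x :: c := by
  apply List.ext_getElem
  · simp only [List.length_ofFn, List.length_append, List.length_cons]
  · intro n h1 h2
    rw [List.getElem_ofFn]
    by_cases hn : n = a.length
    · subst hn; simp
    · rw [Function.update_of_ne (by simpa [Fin.ext_iff] using hn)]
      simp only [List.get_eq_getElem, List.getElem_append]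
      split_ifs with h
      · rfl
      · rcases Nat.exists_eq_succ_of_ne_zero (show n - a.length ≠ 0 by omega) with ⟨k, hk⟩
        simp [hk]

lemma IsMultilinear.map_add {f : List V → W} (hf : IsMultilinear K f) (a c : List V) (x y : V) :
    f (a ++ (x + y) :: c) = f (a ++ x :: c) + f (a ++ y :: c) := by
  obtain ⟨F, hF⟩ := hf (a ++ (0 : V) :: c).length
  have h := F.map_update_add (fun j => (a ++ (0 : V) :: c).get j) ⟨a.length, by simp⟩ x y
  simpa only [hF, ofFn_update_eq] using h

lemma IsMultilinear.map_smul {f : List V → W} (hf : IsMultilinear K f) (a c : List V) (r : K)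
    (x : V) : f (a ++ (r • x) :: c) = r • f (a ++ x :: c) := by
  obtain ⟨F, hF⟩ := hf (a ++ (0 : V) :: c).length
  have h := F.map_update_smul (fun j => (a ++ (0 : V) :: c).get j) ⟨a.length, by simp⟩ r x
  simpa only [hF, ofFn_update_eq] using h

lemma ofFn_update {n : ℕ} [DecidableEq (Fin n)] (v : Fin n → V) (j : Fin n) (x : V) :
    List.ofFn (Function.update v j x) =
      (List.ofFn v).take j ++ x :: (List.ofFn v).drop (j + 1) := by
  apply List.ext_getElem
  · have := j.2
    simp only [List.length_ofFn, List.length_append, List.length_cons, List.length_take,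
      List.length_drop]
    omega
  · intro k h1 h2
    have hk : k < n := by simpa using h1
    rw [List.getElem_ofFn]
    by_cases hkj : k = j
    · subst hkj
      simp
    · rw [Function.update_of_ne (by simpa [Fin.ext_iff] using hkj)]
      simp only [List.getElem_append, List.length_take, List.length_ofFn]
      split_ifs with h
      · simp
      · have h3 : k - min (j : ℕ) n = (k - j - 1) + 1 := by have := j.2; omega
        simp only [h3, List.getElem_cons_succ, List.getElem_drop, List.getElem_ofFn]
        congr 1
        ext
        simp only
        have := j.2
        omega

lemma IsMultilinear.of_list {f : List V → W}
    (hadd : ∀ (a c : List V) (x y : V), f (a ++ (x + y) :: c) = f (a ++ x :: c) + f (a ++ y :: c))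
    (hsmul : ∀ (a c : List V) (r : K) (x : V), f (a ++ (r • x) :: c) = r • f (a ++ x :: c)) :
    IsMultilinear K f := fun n =>
  ⟨{ toFun := fun v => f (List.ofFn v)
     map_update_add' := fun v j x y => by simp only [ofFn_update, hadd]
     map_update_smul' := fun v j r x => by simp only [ofFn_update, hsmul] }, fun _ => rfl⟩

lemma IsMultilinear.comp_map {f : List V → W} (hf : IsMultilinear K f) (g : V →ₗ[K] V) :
    IsMultilinear K (fun v => f (v.map g)) := by
  refine .of_list (fun a c x y => ?_) (fun a c r x => ?_)
  · simp [hf.map_add]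
  · simp [hf.map_smul]

lemma IsMultilinear.sum {ι : Type*} (s : Finset ι) {f : ι → List V → W}
    (hf : ∀ i ∈ s, IsMultilinear K (f i)) : IsMultilinear K (fun v => ∑ i ∈ s, f i v) := by
  refine .of_list (fun a c x y => ?_) (fun a c r x => ?_)
  · rw [← Finset.sum_add_distrib]
    exact Finset.sum_congr rfl fun i hi => (hf i hi).map_add a c x y
  · rw [Finset.smul_sum]
    exact Finset.sum_congr rfl fun i hi => (hf i hi).map_smul a c r x

end Multilinear

/-- `f` is of degree `d`: it maps `V_{e₁} × ⋯ × V_{e_n}` to `V_{e₁ + ⋯ + e_n + d}`. -/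
def HasDegree {K : Type*} [Field K] {V : Type*} [AddCommGroup V] [Module K V]
    (𝒱 : ℤ → Submodule K V) (d : ℤ) (f : List V → V) : Prop :=
  ∀ (n : ℕ) (e : Fin n → ℤ) (v : Fin n → V), (∀ j, v j ∈ 𝒱 (e j)) →
    f (List.ofFn v) ∈ 𝒱 (∑ j, e j + d)

/-! ### `HA_∞`-algebras -/

/-- An `HA_∞`-algebra structure on a graded vector space `A = ⊕ 𝒜 i`. In `relation` the elements
`a 1, …, a n` are homogeneous, of degrees `e 1, …, e n` (the other values of the sequences `a` and
`e` play no role). There is no operation of arity `0`. -/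
structure HAInfAlgebra (K : Type*) [Field K] (A : Type*) [AddCommGroup A] [Module K A]
    (𝒜 : ℤ → Submodule K A) where
  μ : (k : ℕ) → MultilinearMap K (fun _ : Fin k => A) A
  μ_zero : μ 0 = 0
  α : A →ₗ[K] A
  μ_degree : ∀ (k : ℕ) (e : Fin k → ℤ) (a : Fin k → A), (∀ j, a j ∈ 𝒜 (e j)) →
    μ k a ∈ 𝒜 (∑ j, e j + (k - 2))
  α_degree : ∀ (i : ℤ) (a : A), a ∈ 𝒜 i → α a ∈ 𝒜 i
  α_μ : ∀ (k : ℕ) (a : Fin k → A), α (μ k a) = μ k (fun j => α (a j))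
  relation : ∀ n : ℕ, 1 ≤ n → ∀ (e : ℕ → ℤ) (a : ℕ → A), (∀ l, a l ∈ 𝒜 (e l)) →
    ∑ i ∈ Finset.Icc 1 n, ∑ l ∈ Finset.Icc 1 (n + 1 - i),
      ((l : ℤ) * (i + 1) + i * ∑ t ∈ Finset.Ico 1 l, e t).negOnePow •
        μ (n + 1 - i) (fun t : Fin (n + 1 - i) =>
          if (t : ℕ) + 1 < l then (α ^ (i - 1)) (a (t + 1))
          else if (t : ℕ) + 1 = l then μ i (fun s : Fin i => a (l + s))
          else (α ^ (i - 1)) (a (t + i))) = 0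

/-! ### Graded vector spaces -/

/-- The suspension `V = sA`, with `V_i = A_{i-1}`; the map `s` is the identity of the underlying
vector space. -/
def susp {K : Type*} [Field K] {A : Type*} [AddCommGroup A] [Module K A]
    (𝒜 : ℤ → Submodule K A) : ℤ → Submodule K A := fun i => 𝒜 (i - 1)

instance suspDecomposition {K : Type*} [Field K] {A : Type*} [AddCommGroup A] [Module K A]
    (𝒜 : ℤ → Submodule K A) [DirectSum.Decomposition 𝒜] : DirectSum.Decomposition (susp 𝒜) :=
  DirectSum.IsInternal.chooseDecomposition (susp 𝒜) (by
    have h := DirectSum.Decomposition.isInternal 𝒜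
    rw [DirectSum.isInternal_submodule_iff_iSupIndep_and_iSup_eq_top] at h ⊢
    refine ⟨h.1.comp (sub_left_injective (b := (1 : ℤ))), ?_⟩
    rw [← h.2]
    exact (Equiv.subRight (1 : ℤ)).iSup_comp (g := 𝒜))

/-- The Koszul sign operator: the linear map that multiplies `V_i` by `(-1)^{d i}`, the sign of
moving a symbol of degree `d` past an element of degree `i`. -/
def sgn {K : Type*} [Field K] {V : Type*} [AddCommGroup V] [Module K V]
    (𝒱 : ℤ → Submodule K V) [DirectSum.Decomposition 𝒱] (d : ℤ) : V →ₗ[K] V :=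
  DirectSum.toModule K ℤ V (fun i => (d * i).negOnePow • (𝒱 i).subtype) ∘ₗ
    (DirectSum.decomposeLinearEquiv 𝒱).toLinearMap

lemma sgn_of_mem {K : Type*} [Field K] {V : Type*} [AddCommGroup V] [Module K V]
    (𝒱 : ℤ → Submodule K V) [DirectSum.Decomposition 𝒱] (d i : ℤ) {v : V} (hv : v ∈ 𝒱 i) :
    sgn 𝒱 d v = (d * i).negOnePow • v := by
  lift v to 𝒱 i using hv
  simp only [sgn, LinearMap.comp_apply, LinearEquiv.coe_coe,
    DirectSum.decomposeLinearEquiv_apply, DirectSum.decompose_coe]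
  rw [← DirectSum.lof_eq_of K, DirectSum.toModule_lof]
  rfl

/-! ### Coderivations of `TV` -/

/-- `Coder^d_α(TV)`. A coderivation `D = ∑_{n ≥ 1} ϱ̃_n` is recorded by its components
`ϱ_n : V^{⊗n} → V`, `n ≥ 1`, all of degree `d` and commuting with `α`; the endomorphism of `TV`
itself is `coderLift` below. -/
def Coder {K : Type*} [Field K] {V : Type*} [AddCommGroup V] [Module K V]
    (𝒱 : ℤ → Submodule K V) (α : V →ₗ[K] V) (d : ℤ) : Submodule K (List V → V) where
  carrier := {f | f [] = 0 ∧ IsMultilinear K f ∧ HasDegree 𝒱 d f ∧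
    ∀ v : List V, f (v.map α) = α (f v)}
  zero_mem' := ⟨rfl, fun _ => ⟨0, fun _ => rfl⟩, fun _ _ _ _ => Submodule.zero_mem _,
    fun _ => (map_zero α).symm⟩
  add_mem' := by
    rintro f g ⟨hf0, hf, hfd, hfα⟩ ⟨hg0, hg, hgd, hgα⟩
    refine ⟨by simp [hf0, hg0], fun n => ?_, fun n e v hv => ?_, fun v => ?_⟩
    · obtain ⟨F, hF⟩ := hf n
      obtain ⟨G, hG⟩ := hg n
      exact ⟨F + G, fun v => by simp [hF, hG]⟩
    · exact Submodule.add_mem _ (hfd n e v hv) (hgd n e v hv)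
    · simp [hfα, hgα]
  smul_mem' := by
    rintro r f ⟨hf0, hf, hfd, hfα⟩
    refine ⟨by simp [hf0], fun n => ?_, fun n e v hv => ?_, fun v => ?_⟩
    · obtain ⟨F, hF⟩ := hf n
      exact ⟨r • F, fun v => by simp [hF]⟩
    · exact Submodule.smul_mem _ _ (hfd n e v hv)
    · simp [hfα]

/-- The tensor coalgebra `TV = ⊕_{n ≥ 0} V^{⊗n}` (as a vector space). -/
abbrev TV (K : Type*) [Field K] (V : Type*) [AddCommGroup V] [Module K V] : Type _ :=
  ⨁ n : ℕ, ⨂[K]^n V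

/-- The element `v₁ ⊗ ⋯ ⊗ v_n` of `TV`. -/
def word (K : Type*) [Field K] {V : Type*} [AddCommGroup V] [Module K V] (v : List V) : TV K V :=
  DirectSum.lof K ℕ (fun n => ⨂[K]^n V) v.length (PiTensorProduct.tprod K v.get)

/-- The linear map `TV → W` with `v₁ ⊗ ⋯ ⊗ v_n ↦ f [v₁, …, v_n]` (see `linearize_word`), for a
multilinear `f`. -/
def linearize {K : Type*} [Field K] {V W : Type*} [AddCommGroup V] [Module K V]
    [AddCommGroup W] [Module K W] (f : List V → W) (hf : IsMultilinear K f) : TV K V →ₗ[K] W :=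
  DirectSum.toModule K ℕ W (fun n => PiTensorProduct.lift (hf n).choose)

lemma linearize_word {K : Type*} [Field K] {V W : Type*} [AddCommGroup V] [Module K V]
    [AddCommGroup W] [Module K W] (f : List V → W) (hf : IsMultilinear K f) (v : List V) :
    linearize f hf (word K v) = f v := by
  rw [linearize, word, DirectSum.toModule_lof, PiTensorProduct.lift.tprod, (hf _).choose_spec,
    List.ofFn_get]

lemma word_ofFn {K : Type*} [Field K] {V : Type*} [AddCommGroup V] [Module K V] {n : ℕ}
    (v : Fin n → V) : word K (List.ofFn v) =
      DirectSum.lof K ℕ (fun n => ⨂[K]^n V) n (PiTensorProduct.tprod K v) := by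
  have key : ∀ (w : List V) (n : ℕ) (h : w.length = n), word K w =
      DirectSum.lof K ℕ (fun n => ⨂[K]^n V) n
        (PiTensorProduct.tprod K fun j : Fin n => w.get (j.cast h.symm)) := by
    rintro w n rfl
    rfl
  rw [key _ n (List.length_ofFn)]
  congr 2
  funext j
  simp

lemma isMultilinear_word (K : Type*) [Field K] {V : Type*} [AddCommGroup V] [Module K V] :
    IsMultilinear K (word K (V := V)) := fun n =>
  ⟨(DirectSum.lof K ℕ (fun n => ⨂[K]^n V) n).compMultilinearMap (PiTensorProduct.tprod K),
    fun v => (word_ofFn v).symm⟩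

/-- One summand of `f̃ (v₁ ⊗ ⋯ ⊗ v_k)`, the one where `f` is applied to the block of length `m`
that starts after the first `i` letters:
`± α^{m-1} v₁ ⊗ ⋯ ⊗ α^{m-1} v_i ⊗ f (v_{i+1}, …, v_{i+m}) ⊗ α^{m-1} v_{i+m+1} ⊗ ⋯ ⊗ α^{m-1} v_k`,
with the sign `(-1)^{d (|v₁| + ⋯ + |v_i|)}`. -/
def coderTerm {K : Type*} [Field K] {V : Type*} [AddCommGroup V] [Module K V]
    (𝒱 : ℤ → Submodule K V) [DirectSum.Decomposition 𝒱] (α : V →ₗ[K] V) (d : ℤ)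
    (f : List V → V) (i m : ℕ) (v : List V) : List V :=
  (v.take i).map (fun a => (α ^ (m - 1)) (sgn 𝒱 d a)) ++
    f ((v.drop i).take m) :: (v.drop (i + m)).map (α ^ (m - 1))

/-- `f̃ (v₁ ⊗ ⋯ ⊗ v_k)`, for the coderivation `f̃` of degree `d` with components `f`. -/
def coderWord {K : Type*} [Field K] {V : Type*} [AddCommGroup V] [Module K V]
    (𝒱 : ℤ → Submodule K V) [DirectSum.Decomposition 𝒱] (α : V →ₗ[K] V) (d : ℤ)
    (f : List V → V) (v : List V) : TV K V :=
  ∑ i ∈ Finset.range v.length, ∑ m ∈ Finset.Icc 1 (v.length - i), word K (coderTerm 𝒱 α d f i m v)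

lemma isMultilinear_coderWord {K : Type*} [Field K] {V : Type*} [AddCommGroup V] [Module K V]
    (𝒱 : ℤ → Submodule K V) [DirectSum.Decomposition 𝒱] (α : V →ₗ[K] V) (d : ℤ)
    {f : List V → V} (hf : IsMultilinear K f) : IsMultilinear K (coderWord 𝒱 α d f) := by
  have hw := isMultilinear_word K (V := V)
  have h : ∀ i m : ℕ, IsMultilinear K (fun v => word K (coderTerm 𝒱 α d f i m v)) := by
    intro i m
    -- a letter of the word enters exactly one letter of the term, and does so linearly
    have key : ∀ a c : List V, ∃ (p q : List V) (g : V →ₗ[K] V),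
        ∀ z : V, coderTerm 𝒱 α d f i m (a ++ z :: c) = p ++ g z :: q := by
      intro a c
      unfold coderTerm
      rcases lt_or_ge a.length i with hi | hi
      · obtain ⟨k, rfl⟩ : ∃ k, i = a.length + (k + 1) := ⟨i - a.length - 1, by omega⟩
        refine ⟨a.map (fun b => (α ^ (m - 1)) (sgn 𝒱 d b)), (c.take k).map
          (fun b => (α ^ (m - 1)) (sgn 𝒱 d b)) ++ f ((c.drop k).take m) ::
            (c.drop (k + m)).map (α ^ (m - 1)), (α ^ (m - 1)) ∘ₗ sgn 𝒱 d, fun z => ?_⟩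
        rw [show a.length + (k + 1) + m = a.length + (k + m + 1) by ring]
        simp [List.take_length_add_append, List.drop_length_add_append]
      · rcases lt_or_ge a.length (i + m) with him | him
        · obtain ⟨k, hk⟩ : ∃ k, i + m = a.length + (k + 1) := ⟨i + m - a.length - 1, by omega⟩
          have hm : m = (a.drop i).length + (k + 1) := by rw [List.length_drop]; omega
          have hblock : ∀ z : V, ((a ++ z :: c).drop i).take m = a.drop i ++ z :: c.take k := by
            intro z
            rw [List.drop_append_of_le_length hi, hm, List.take_length_add_append]
            simp
          let g : V →ₗ[K] V :=
            { toFun := fun z => f (a.drop i ++ z :: c.take k)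
              map_add' := hf.map_add _ _
              map_smul' := hf.map_smul _ _ }
          refine ⟨(a.take i).map (fun b => (α ^ (m - 1)) (sgn 𝒱 d b)),
            (c.drop k).map (α ^ (m - 1)), g, fun z => ?_⟩
          rw [hblock, hk, List.take_append_of_le_length hi, List.drop_length_add_append]
          simp [g]
        · have h1 : ∀ z : V, ((a ++ z :: c).drop i).take m = (a.drop i).take m := by
            intro z
            rw [List.drop_append_of_le_length hi, List.take_append_of_le_length]
            rw [List.length_drop]
            omega
          refine ⟨(a.take i).map (fun b => (α ^ (m - 1)) (sgn 𝒱 d b)) ++ f ((a.drop i).take m) ::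
            (a.drop (i + m)).map (α ^ (m - 1)), c.map (α ^ (m - 1)), α ^ (m - 1), fun z => ?_⟩
          rw [h1, List.take_append_of_le_length hi, List.drop_append_of_le_length him]
          simp
    refine .of_list (fun a c x y => ?_) (fun a c r x => ?_)
    · obtain ⟨p, q, g, hg⟩ := key a c
      simp only [hg, hw.map_add, LinearMap.map_add]
    · obtain ⟨p, q, g, hg⟩ := key a c
      simp only [hg, hw.map_smul, LinearMap.map_smul]
  refine .of_list (fun a c x y => ?_) (fun a c r x => ?_)
  · simp only [coderWord, List.length_append, List.length_cons, (h _ _).map_add,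
      Finset.sum_add_distrib]
  · simp only [coderWord, List.length_append, List.length_cons, (h _ _).map_smul,
      Finset.smul_sum]

/-- The coderivation `f̃ : TV → TV` of degree `d` with components `f`. -/
def coderLift {K : Type*} [Field K] {V : Type*} [AddCommGroup V] [Module K V]
    (𝒱 : ℤ → Submodule K V) [DirectSum.Decomposition 𝒱] (α : V →ₗ[K] V) (d : ℤ)
    (f : Coder 𝒱 α d) : Module.End K (TV K V) :=
  linearize (coderWord 𝒱 α d f.1) (isMultilinear_coderWord 𝒱 α d f.2.2.1)

/-! ### Braces, the bracket and the cup product -/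

/-- Auxiliary function for `brace`: the sum, over all ways of choosing consecutive disjoint
nonempty blocks of the word `v`, one for each of `x₁, …, x_k`, of the value of `F` at the word that
arises from `v` when `x_j` is applied to the `j`-th block. The list `xs` contains the pairs
`(d_j, x_j)`, with `d_j` the degree of `x_j`. Letters outside of the blocks are twisted by `α ^ T`
and the value of `x_j`, of arity `m`, by `α ^ (T - (m - 1))`. Moving every `x_j` past all letters
of `v` in front of its block gives the signs. -/
def insertSum {K : Type*} [Field K] {V : Type*} [AddCommGroup V] [Module K V]
    (𝒱 : ℤ → Submodule K V) [DirectSum.Decomposition 𝒱] (α : V →ₗ[K] V) (T : ℕ) :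
    List (ℤ × (List V → V)) → (List V → V) → List V → V
  | [], F, v => F (v.map (α ^ T))
  | x :: xs, F, v =>
      ∑ i ∈ Finset.range v.length, ∑ m ∈ Finset.Icc 1 (v.length - i),
        insertSum 𝒱 α T xs
          (fun w => F ((v.take i).map
              (fun a => (α ^ T) (sgn 𝒱 (x.1 + (xs.map Prod.fst).sum) a)) ++
            (α ^ (T + 1 - m)) (x.2 (((v.drop i).take m).map (sgn 𝒱 (xs.map Prod.fst).sum))) :: w))
          (v.drop (i + m))

/-- The `α`-twisted brace `{f}{x₁, …, x_k}`, where `xs` is the list of the pairs `(d_j, x_j)` with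
`d_j` the degree of `x_j`. Its value at `(v₁, …, v_N)` is the sum of all
`± f (α^T v₁, …, α^{T-(m₁-1)} x₁ (…), …, α^T v_l, …, α^{T-(m_k-1)} x_k (…), …, α^T v_N)`, where
`m_j` is the arity of `x_j` and `T = ∑ (m_j - 1)`; equivalently, `N - T` is the number of
arguments of `f`. -/
def brace {K : Type*} [Field K] {V : Type*} [AddCommGroup V] [Module K V]
    (𝒱 : ℤ → Submodule K V) [DirectSum.Decomposition 𝒱] (α : V →ₗ[K] V)
    (f : List V → V) (xs : List (ℤ × (List V → V))) : List V → V := fun v =>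
  ∑ T ∈ Finset.range (v.length + 1),
    insertSum 𝒱 α T xs (fun w => if w.length + T = v.length then f w else 0) v

/-- The bracket `[f, g] = f ∘ g - (-1)^{d e} g ∘ f` of coderivations of degrees `d` and `e`, where
`f ∘ g = {f}{g}`. -/
def bracket {K : Type*} [Field K] {V : Type*} [AddCommGroup V] [Module K V]
    (𝒱 : ℤ → Submodule K V) [DirectSum.Decomposition 𝒱] (α : V →ₗ[K] V)
    (d : ℤ) (f : List V → V) (e : ℤ) (g : List V → V) : List V → V :=
  brace 𝒱 α f [(e, g)] - (d * e).negOnePow • brace 𝒱 α g [(d, f)]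

section BraceLinear

variable {K : Type*} [Field K] {V : Type*} [AddCommGroup V] [Module K V]
  (𝒱 : ℤ → Submodule K V) [DirectSum.Decomposition 𝒱] (α : V →ₗ[K] V)

lemma insertSum_add (T : ℕ) (xs : List (ℤ × (List V → V))) (F G : List V → V) (v : List V) :
    insertSum 𝒱 α T xs (fun w => F w + G w) v =
      insertSum 𝒱 α T xs F v + insertSum 𝒱 α T xs G v := by
  induction xs generalizing F G v with
  | nil => rfl
  | cons x xs ih => simp only [insertSum, ih, Finset.sum_add_distrib]

lemma insertSum_smul (T : ℕ) (xs : List (ℤ × (List V → V))) (r : K) (F : List V → V)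
    (v : List V) : insertSum 𝒱 α T xs (fun w => r • F w) v = r • insertSum 𝒱 α T xs F v := by
  induction xs generalizing F v with
  | nil => rfl
  | cons x xs ih => simp only [insertSum, ih, Finset.smul_sum]

lemma brace_add_left (f g : List V → V) (xs : List (ℤ × (List V → V))) :
    brace 𝒱 α (f + g) xs = brace 𝒱 α f xs + brace 𝒱 α g xs := by
  funext v
  simp only [brace, Pi.add_apply, ← Finset.sum_add_distrib, ← insertSum_add]
  refine Finset.sum_congr rfl fun T _ => ?_
  congr 1
  funext w
  split_ifs <;> simp

lemma brace_smul_left (r : K) (f : List V → V) (xs : List (ℤ × (List V → V))) :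
    brace 𝒱 α (r • f) xs = r • brace 𝒱 α f xs := by
  funext v
  simp only [brace, Pi.smul_apply, Finset.smul_sum, ← insertSum_smul]
  refine Finset.sum_congr rfl fun T _ => ?_
  congr 1
  funext w
  split_ifs <;> simp

lemma brace_add_right {f : List V → V} (hf : IsMultilinear K f) (d : ℤ) (x y : List V → V) :
    brace 𝒱 α f [(d, x + y)] = brace 𝒱 α f [(d, x)] + brace 𝒱 α f [(d, y)] := by
  funext v
  simp only [brace, insertSum, Pi.add_apply, ← Finset.sum_add_distrib]
  refine Finset.sum_congr rfl fun T _ => Finset.sum_congr rfl fun i _ =>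
    Finset.sum_congr rfl fun m _ => ?_
  simp only [List.length_append, List.length_cons]
  split_ifs <;> simp [hf.map_add]

lemma brace_smul_right {f : List V → V} (hf : IsMultilinear K f) (d : ℤ) (r : K)
    (x : List V → V) : brace 𝒱 α f [(d, r • x)] = r • brace 𝒱 α f [(d, x)] := by
  funext v
  simp only [brace, insertSum, Pi.smul_apply, Finset.smul_sum]
  refine Finset.sum_congr rfl fun T _ => Finset.sum_congr rfl fun i _ =>
    Finset.sum_congr rfl fun m _ => ?_
  simp only [List.length_append, List.length_cons]
  split_ifs <;> simp [hf.map_smul]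

end BraceLinear

/-! ### Hochschild cohomology of an `HA_∞`-algebra -/

section Hochschild

variable {K : Type*} [Field K] {A : Type*} [AddCommGroup A] [Module K A]
  {𝒜 : ℤ → Submodule K A} [DirectSum.Decomposition 𝒜]

/-- The coderivation `D` of degree `-1` on `TV`, `V = sA`, that corresponds to the
`HA_∞`-structure. Its components are `s ∘ μ_k ∘ (s⁻¹)^{⊗k}`, that is
`(v₁, …, v_k) ↦ (-1)^{∑_j (k - j) |v_j|} s μ_k (s⁻¹ v₁, …, s⁻¹ v_k)`. -/
def HAInfAlgebra.D (S : HAInfAlgebra K A 𝒜) : List A → A := fun v =>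
  S.μ v.length (fun j => sgn (susp 𝒜) ((v.length : ℤ) - 1 - (j : ℕ)) (v.get j))

lemma HAInfAlgebra.isMultilinear_D (S : HAInfAlgebra K A 𝒜) : IsMultilinear K S.D := by
  have key : ∀ (w : List A) (n : ℕ) (h : w.length = n), S.D w =
      S.μ n (fun j => sgn (susp 𝒜) ((n : ℤ) - 1 - (j : ℕ)) (w.get (j.cast h.symm))) := by
    rintro w n rfl
    rfl
  refine fun n => ⟨(S.μ n).compLinearMap
    (fun j => sgn (susp 𝒜) ((n : ℤ) - 1 - (j : ℕ))), fun v => ?_⟩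
  rw [key _ n (List.length_ofFn), MultilinearMap.compLinearMap_apply]
  congr 1
  funext j
  simp

/-- The Hochschild cochains `C^p_α(A, A) = Coder^{-(p-1)}_α(TV)`, `V = sA`. -/
def HAInfAlgebra.C (S : HAInfAlgebra K A 𝒜) (p : ℤ) : Submodule K (List A → A) :=
  Coder (susp 𝒜) S.α (-(p - 1))

/-- The Hochschild coboundary `δ_α(f) = [D, f]` on `C^p_α(A, A)`. -/
def HAInfAlgebra.δ (S : HAInfAlgebra K A 𝒜) (p : ℤ) : S.C p →ₗ[K] (List A → A) where
  toFun f := bracket (susp 𝒜) S.α (-1) S.D (-(p - 1)) f.1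
  map_add' f g := by
    simp only [bracket, Submodule.coe_add, brace_add_left,
      brace_add_right _ _ S.isMultilinear_D, smul_add]
    abel
  map_smul' r f := by
    simp only [bracket, Submodule.coe_smul, brace_smul_left,
      brace_smul_right _ _ S.isMultilinear_D, smul_sub, RingHom.id_apply]
    rw [smul_comm]

/-- The cocycles `Z^p ⊆ C^p_α(A, A)`. -/
def HAInfAlgebra.Z (S : HAInfAlgebra K A 𝒜) (p : ℤ) : Submodule K (List A → A) :=
  (LinearMap.ker (S.δ p)).map (S.C p).subtype

/-- The coboundaries `B^p`. -/
def HAInfAlgebra.B (S : HAInfAlgebra K A 𝒜) (p : ℤ) : Submodule K (List A → A) :=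
  LinearMap.range (S.δ (p - 1))

/-- The Hochschild cohomology `H^p_α(A, A) = Z^p / B^p`. -/
abbrev HAInfAlgebra.H (S : HAInfAlgebra K A 𝒜) (p : ℤ) : Type _ :=
  S.Z p ⧸ (S.B p).submoduleOf (S.Z p)

/-- The class in `H^•_α(A, A) = ⊕_p H^p_α(A, A)` of a cocycle of degree `p`. -/
def HAInfAlgebra.cls (S : HAInfAlgebra K A 𝒜) (p : ℤ) (z : S.Z p) : ⨁ p, S.H p :=
  DirectSum.lof K ℤ S.H p (Submodule.Quotient.mk z)

/-- The bracket `[x, y]` of Hochschild cochains `x ∈ C^p`, `y ∈ C^q`; it lies in `C^{p+q-1}`. -/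
def HAInfAlgebra.cochainBracket (S : HAInfAlgebra K A 𝒜) (p q : ℤ) (x y : List A → A) :
    List A → A :=
  bracket (susp 𝒜) S.α (-(p - 1)) x (-(q - 1)) y

/-- The product `x ∪ y = (-1)^{p+1} {D}{x, y}` of Hochschild cochains `x ∈ C^p`, `y ∈ C^q`; it lies
in `C^{p+q}`. The sign is the one by which `{D}{x, y}`, an operation on the suspended degrees
`-(p-1)`, `-(q-1)`, becomes an operation of degree `0` on the degrees `p`, `q`. -/
def HAInfAlgebra.cup (S : HAInfAlgebra K A 𝒜) (p q : ℤ) (x y : List A → A) : List A → A :=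
  (p + 1).negOnePow • brace (susp 𝒜) S.α S.D [(-(p - 1), x), (-(q - 1), y)]

/-- The operations `ψ_k` on the Hochschild cochains: `ψ_1 = δ_α` and
`ψ_k(x₁, …, x_k) = {D}{x₁, …, x_k}` for `k ≥ 2`, for `x_j` of degree `p j`. -/
def HAInfAlgebra.ψ (S : HAInfAlgebra K A 𝒜) :
    (k : ℕ) → (p : Fin k → ℤ) → ((j : Fin k) → S.C (p j)) → List A → A
  | 0, _, _ => 0
  | 1, p, x => S.δ (p 0) (x 0)
  | _ + 2, p, x =>
      brace (susp 𝒜) S.α S.D (List.ofFn fun j => (-(p j - 1), (x j : List A → A)))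

/-- The homological grading of `C^•_α(A, A) = ⊕_p C^p_α(A, A)`: degree `i` is `C^{-i}`. -/
def HAInfAlgebra.cochainGrading (S : HAInfAlgebra K A 𝒜) (i : ℤ) :
    Submodule K (⨁ p, S.C p) :=
  LinearMap.range (DirectSum.lof K ℤ (fun p => S.C p) (-i))

end Hochschild

/-! ### Gerstenhaber algebras -/

/-- A Gerstenhaber algebra structure on the graded vector space `⊕_p H p`: a graded commutative,
associative product of degree `0` and a graded Lie bracket of degree `-1` that satisfy the graded
Leibniz rule. -/
structure GerstenhaberAlgebra (K : Type*) [Field K] (H : ℤ → Type*)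
    [∀ p, AddCommGroup (H p)] [∀ p, Module K (H p)] where
  mul : (⨁ p, H p) →ₗ[K] (⨁ p, H p) →ₗ[K] (⨁ p, H p)
  bracket : (⨁ p, H p) →ₗ[K] (⨁ p, H p) →ₗ[K] (⨁ p, H p)
  mul_degree : ∀ (p q : ℤ) (x : H p) (y : H q),
    mul (DirectSum.lof K ℤ H p x) (DirectSum.lof K ℤ H q y) ∈
      LinearMap.range (DirectSum.lof K ℤ H (p + q))
  bracket_degree : ∀ (p q : ℤ) (x : H p) (y : H q),
    bracket (DirectSum.lof K ℤ H p x) (DirectSum.lof K ℤ H q y) ∈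
      LinearMap.range (DirectSum.lof K ℤ H (p + q - 1))
  mul_assoc : ∀ x y z : ⨁ p, H p, mul (mul x y) z = mul x (mul y z)
  mul_comm : ∀ (p q : ℤ) (x : H p) (y : H q),
    mul (DirectSum.lof K ℤ H p x) (DirectSum.lof K ℤ H q y) =
      (p * q).negOnePow • mul (DirectSum.lof K ℤ H q y) (DirectSum.lof K ℤ H p x)
  bracket_skew : ∀ (p q : ℤ) (x : H p) (y : H q),
    bracket (DirectSum.lof K ℤ H p x) (DirectSum.lof K ℤ H q y) =
      -(((p - 1) * (q - 1)).negOnePow •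
        bracket (DirectSum.lof K ℤ H q y) (DirectSum.lof K ℤ H p x))
  jacobi : ∀ (p q : ℤ) (x : H p) (y : H q) (z : ⨁ r, H r),
    bracket (DirectSum.lof K ℤ H p x) (bracket (DirectSum.lof K ℤ H q y) z) =
      bracket (bracket (DirectSum.lof K ℤ H p x) (DirectSum.lof K ℤ H q y)) z +
        ((p - 1) * (q - 1)).negOnePow •
          bracket (DirectSum.lof K ℤ H q y) (bracket (DirectSum.lof K ℤ H p x) z)
  leibniz : ∀ (p q : ℤ) (x : H p) (y : H q) (z : ⨁ r, H r),
    bracket (DirectSum.lof K ℤ H p x) (mul (DirectSum.lof K ℤ H q y) z) =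
      mul (bracket (DirectSum.lof K ℤ H p x) (DirectSum.lof K ℤ H q y)) z +
        ((p - 1) * q).negOnePow •
          mul (DirectSum.lof K ℤ H q y) (bracket (DirectSum.lof K ℤ H p x) z)

end HomAInf

set_option linter.unusedSectionVars false

/-! Everything rests on one construction: inserting a list of cochains, in order, into disjoint
blocks of a word. `act` does this with an arbitrary functional `F` of the resulting word. For `F =
f` it is the brace `{f}{x₁, …, x_k}` (`brace_eq_act`), for `F = word K` and one cochain it is the
coderivation of `TV` itself (`coderWord_eq_act`). A block of length `m` contributes excess `m - 1`,
the power of `α` by which everything outside of it is twisted. Excess is additive under iterated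
insertion, and `α` commutes with the cochains and with the Koszul signs. Hence the twisted braces
obey the same relations as the braces on an ordinary tensor coalgebra.

Two composition laws are needed, and both come from the compatibility of insertion with
deconcatenation (`act_split`). In `{{f}{y}}{X}` the operation `y` swallows a consecutive part `X₂`
of `X = X₁ X₂ X₃` (`act_act_singleton`). In `{{f}{X}}{y}` the cochain `y` lands either between the
blocks of `X` or inside one of them (`act_singleton_act`). The first law gives the pre-Lie relation,
hence the Jacobi identity. Applied to `word K`, it shows that the composite of two coderivations is
the coderivation of `{f}{g}` plus terms with two disjoint blocks, which cancel in the graded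
commutator.

`{D}{D} = 0` is the `HA_∞`-relation on homogeneous words, term by term. The only content is the
comparison of signs between `A` and `sA`, isolated in `koszul_sign`.

The `A_∞`-relations for the cochains are `psi_relation`. The identity `{{D}{D}}{X} = 0` is such a
relation, except that it contains insertions of `D` with no argument and has `{D}{x}` in place of
`[D, x]`. The expansion of `{{D}{X}}{D}` by the second law accounts exactly for both discrepancies.
`koszul_sign`, now read in the other direction, removes the suspension.

On cohomology, the relation with two inputs makes the product well defined and the relation with
three inputs makes it associative. `{x}{y}` is a homotopy for commutativity (`bracket_brace`),
`{x}{y, z}` is a homotopy for the Leibniz rule (`bracket_brace_pair`), and the Jacobi identity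
already holds on cochains. -/

namespace HomAInf

/-! ### Sums over the decompositions of a word -/

section Split

variable {X Y M N : Type*} [AddCommMonoid M] [AddCommMonoid N]

/-- The sum of `Φ u w` over all decompositions `v = u ++ w`. -/
def split (Φ : List X → List X → M) (v : List X) : M :=
  ∑ i ∈ Finset.range (v.length + 1), Φ (v.take i) (v.drop i)

lemma split_nil (Φ : List X → List X → M) : split Φ [] = Φ [] [] := by simp [split]

lemma split_cons (Φ : List X → List X → M) (a : X) (v : List X) :
    split Φ (a :: v) = Φ [] (a :: v) + split (fun u w => Φ (a :: u) w) v := by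
  rw [split, List.length_cons, Finset.sum_range_succ', add_comm]
  simp [split]

lemma split_congr {Φ Ψ : List X → List X → M} {v : List X}
    (h : ∀ u w, u ++ w = v → Φ u w = Ψ u w) : split Φ v = split Ψ v :=
  Finset.sum_congr rfl fun _ _ => h _ _ (List.take_append_drop _ _)

lemma split_add (Φ Ψ : List X → List X → M) (v : List X) :
    split (fun u w => Φ u w + Ψ u w) v = split Φ v + split Ψ v := Finset.sum_add_distrib

lemma split_zero (v : List X) : split (fun _ _ => (0 : M)) v = 0 := Finset.sum_const_zero

lemma map_split {G : Type*} [FunLike G M N] [AddMonoidHomClass G M N] (g : G)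
    (Φ : List X → List X → M) (v : List X) :
    g (split Φ v) = split (fun u w => g (Φ u w)) v := map_sum _ _ _

lemma smul_split {R : Type*} [DistribSMul R M] (r : R) (Φ : List X → List X → M) (v : List X) :
    r • split Φ v = split (fun u w => r • Φ u w) v := Finset.smul_sum

lemma split_map (g : X → Y) (Φ : List Y → List Y → M) (v : List X) :
    split Φ (v.map g) = split (fun u w => Φ (u.map g) (w.map g)) v := by
  simp [split]

lemma split_comm (Φ : List X → List X → List Y → List Y → M) (v : List X) (w : List Y) :
    split (fun a b => split (fun c d => Φ a b c d) w) v =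
      split (fun c d => split (fun a b => Φ a b c d) v) w := Finset.sum_comm

/-- Coassociativity of deconcatenation: both iterated sums run over `v = a ++ b ++ w`. -/
lemma split_assoc (Φ : List X → List X → List X → M) (v : List X) :
    split (fun u w => split (fun a b => Φ a b w) u) v =
      split (fun a r => split (fun b w => Φ a b w) r) v := by
  induction v generalizing Φ with
  | nil => simp [split_nil]
  | cons x v ih => simp only [split_cons, split_nil, split_add, ih, add_assoc]

/-- The marked letter `z` lies on one side of the cut. This is used to follow one letter through a
sum, either for linearity in that letter or to cut a word around an inserted value. -/
lemma split_append_cons (Φ : List X → List X → M) (a : List X) (z : X) (c : List X) :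
    split Φ (a ++ z :: c) =
      split (fun u r => Φ u (r ++ z :: c)) a + split (fun u w => Φ (a ++ z :: u) w) c := by
  induction a generalizing Φ with
  | nil => simp [split_cons, split_nil]
  | cons x a ih => simp [split_cons, ih, add_assoc]

lemma split_mem {S : Type*} [SetLike S M] [AddSubmonoidClass S M] (s : S)
    {Φ : List X → List X → M} {v : List X} (h : ∀ u w, u ++ w = v → Φ u w ∈ s) :
    split Φ v ∈ s := sum_mem fun _ _ => h _ _ (List.take_append_drop _ _)

/-- Blocks must be nonempty. The guard `b.length = 0` expresses this inside `split`, and here it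
becomes the range `1 ≤ m` of the definitions. -/
lemma split_ite_length (Φ : List X → List X → M) (v : List X) :
    split (fun b w => if b.length = 0 then 0 else Φ b w) v =
      ∑ m ∈ Finset.Icc 1 v.length, Φ (v.take m) (v.drop m) := by
  rw [split, Finset.range_eq_Ico, Finset.sum_eq_sum_Ico_succ_bot (by simp)]
  simp only [List.take_zero, List.length_nil, if_true, zero_add]
  rw [show Finset.Ico 1 (v.length + 1) = Finset.Icc 1 v.length from rfl]
  refine Finset.sum_congr rfl fun m hm => if_neg ?_
  rw [Finset.mem_Icc] at hm
  rw [List.length_take]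
  omega

lemma ite_split (p : Prop) [Decidable p] (Φ : List X → List X → M) (v : List X) :
    (if p then 0 else split Φ v) = split (fun a b => if p then 0 else Φ a b) v := by
  split_ifs
  · exact (split_zero v).symm
  · rfl

lemma ite_zero_add (p : Prop) [Decidable p] (a b : M) :
    (if p then 0 else a + b) = (if p then 0 else a) + if p then 0 else b := by
  split_ifs <;> simp

end Split

/-! ### The word operators `α^n ∘ (-1)^{d|·|}` -/

section Twist

variable {K : Type*} [Field K] {V : Type*} [AddCommGroup V] [Module K V]
  (𝒱 : ℤ → Submodule K V) [DirectSum.Decomposition 𝒱] (α : V →ₗ[K] V)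

@[elab_as_elim]
lemma homogeneous_induction {f : V → Prop} (v : V) (h0 : ∀ i, ∀ v ∈ 𝒱 i, f v)
    (hadd : ∀ v w, f v → f w → f (v + w)) : f v := by
  refine DirectSum.Decomposition.inductionOn 𝒱 ?_ ?_ ?_ v
  · exact h0 0 0 (Submodule.zero_mem _)
  · exact fun m => h0 _ m m.2
  · exact hadd

lemma sgn_zero (v : V) : sgn 𝒱 0 v = v := by
  refine homogeneous_induction 𝒱 v (fun i v hv => ?_) (fun v w hv hw => ?_)
  · simp [sgn_of_mem 𝒱 _ _ hv]
  · simp only [map_add, hv, hw]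

lemma sgn_sgn (d e : ℤ) (v : V) : sgn 𝒱 d (sgn 𝒱 e v) = sgn 𝒱 (d + e) v := by
  refine homogeneous_induction 𝒱 v (fun i v hv => ?_) (fun v w hv hw => ?_)
  · rw [sgn_of_mem 𝒱 e _ hv, sgn_of_mem 𝒱 (d + e) _ hv,
      sgn_of_mem 𝒱 d i ((𝒱 i).smul_of_tower_mem _ hv), smul_smul, add_mul, Int.negOnePow_add]
  · simp only [map_add, hv, hw]

lemma sgn_mem (d i : ℤ) {v : V} (hv : v ∈ 𝒱 i) : sgn 𝒱 d v ∈ 𝒱 i := by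
  rw [sgn_of_mem 𝒱 d i hv]
  exact (𝒱 i).smul_of_tower_mem _ hv

variable {α}

lemma map_sgn (hα : ∀ i, ∀ a ∈ 𝒱 i, α a ∈ 𝒱 i) (d : ℤ) (v : V) :
    α (sgn 𝒱 d v) = sgn 𝒱 d (α v) := by
  refine homogeneous_induction 𝒱 v (fun i v hv => ?_) (fun v w hv hw => ?_)
  · rw [sgn_of_mem 𝒱 d _ hv, sgn_of_mem 𝒱 d _ (hα _ _ hv)]
    simp [Units.smul_def]
  · simp only [map_add, hv, hw]

lemma pow_map_sgn (hα : ∀ i, ∀ a ∈ 𝒱 i, α a ∈ 𝒱 i) (n : ℕ) (d : ℤ) (v : V) :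
    (α ^ n) (sgn 𝒱 d v) = sgn 𝒱 d ((α ^ n) v) := by
  induction n with
  | zero => simp
  | succ n ih => rw [pow_succ', Module.End.mul_apply, ih, map_sgn 𝒱 hα, Module.End.mul_apply]

lemma pow_map_mem (hα : ∀ i, ∀ a ∈ 𝒱 i, α a ∈ 𝒱 i) (n : ℕ) (i : ℤ) {a : V} (ha : a ∈ 𝒱 i) :
    (α ^ n) a ∈ 𝒱 i := by
  induction n with
  | zero => simpa
  | succ n ih => rw [pow_succ', Module.End.mul_apply]; exact hα _ _ ih

variable (α)

/-- The letter operator `α^n ∘ (-1)^{d|·|}`. -/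
def twl (n : ℕ) (d : ℤ) : V →ₗ[K] V := (α ^ n) ∘ₗ sgn 𝒱 d

/-- The word operator that applies `α^n ∘ (-1)^{d|·|}` to every letter. -/
def tw (n : ℕ) (d : ℤ) (v : List V) : List V := v.map (twl 𝒱 α n d)

@[simp] lemma tw_nil (n : ℕ) (d : ℤ) : tw 𝒱 α n d [] = [] := rfl

@[simp] lemma tw_cons (n : ℕ) (d : ℤ) (a : V) (v : List V) :
    tw 𝒱 α n d (a :: v) = twl 𝒱 α n d a :: tw 𝒱 α n d v := rfl

@[simp] lemma tw_append (n : ℕ) (d : ℤ) (u v : List V) :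
    tw 𝒱 α n d (u ++ v) = tw 𝒱 α n d u ++ tw 𝒱 α n d v := List.map_append

@[simp] lemma length_tw (n : ℕ) (d : ℤ) (v : List V) : (tw 𝒱 α n d v).length = v.length :=
  List.length_map _

@[simp] lemma twl_zero (a : V) : twl 𝒱 α 0 0 a = a := by simp [twl, sgn_zero]

@[simp] lemma tw_zero (v : List V) : tw 𝒱 α 0 0 v = v := by
  induction v with
  | nil => rfl
  | cons a v ih => rw [tw_cons, ih, twl_zero]

lemma twl_apply (n : ℕ) (d : ℤ) (a : V) : twl 𝒱 α n d a = (α ^ n) (sgn 𝒱 d a) := rfl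

lemma twl_zero_right (n : ℕ) : twl 𝒱 α n 0 = α ^ n := by
  ext a; simp [twl, sgn_zero]

lemma twl_zero_left (d : ℤ) : twl 𝒱 α 0 d = sgn 𝒱 d := by
  ext a; simp [twl]

variable {α}

/-- Since `α` preserves degrees it commutes with the sign operators, so the two exponents add
independently. All matching of twists and signs below reduces to this rule. -/
lemma twl_twl (hα : ∀ i, ∀ a ∈ 𝒱 i, α a ∈ 𝒱 i) (n m : ℕ) (d e : ℤ) (a : V) :
    twl 𝒱 α n d (twl 𝒱 α m e a) = twl 𝒱 α (n + m) (d + e) a := by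
  simp only [twl, LinearMap.comp_apply, ← pow_map_sgn 𝒱 hα, sgn_sgn]
  rw [pow_add, Module.End.mul_apply]

lemma tw_tw (hα : ∀ i, ∀ a ∈ 𝒱 i, α a ∈ 𝒱 i) (n m : ℕ) (d e : ℤ) (v : List V) :
    tw 𝒱 α n d (tw 𝒱 α m e v) = tw 𝒱 α (n + m) (d + e) v := by
  simp [tw, twl_twl 𝒱 hα]

lemma twl_mem (hα : ∀ i, ∀ a ∈ 𝒱 i, α a ∈ 𝒱 i) (n : ℕ) (d i : ℤ) {a : V} (ha : a ∈ 𝒱 i) :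
    twl 𝒱 α n d a ∈ 𝒱 i := pow_map_mem 𝒱 hα n i (sgn_mem 𝒱 d i ha)

end Twist

/-! ### Insertion of a list of cochains into a word -/

section Deg

variable {V : Type*}

/-- The total degree of a list of cochains. -/
def deg (X : List (ℤ × (List V → V))) : ℤ := (X.map Prod.fst).sum

@[simp] lemma deg_nil : deg ([] : List (ℤ × (List V → V))) = 0 := rfl

@[simp] lemma deg_cons (x : ℤ × (List V → V)) (X : List (ℤ × (List V → V))) :
    deg (x :: X) = x.1 + deg X := rfl

@[simp] lemma deg_append (X Y : List (ℤ × (List V → V))) : deg (X ++ Y) = deg X + deg Y := by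
  simp [deg]

end Deg

section Act

variable {K : Type*} [Field K] {V : Type*} [AddCommGroup V] [Module K V]
  (𝒱 : ℤ → Submodule K V) [DirectSum.Decomposition 𝒱] (α : V →ₗ[K] V)

/-- The sum over all ways of inserting the cochains `x₁, …, x_k`, in this order, into disjoint
consecutive nonempty blocks of `v`, with Koszul signs and twists by powers of `α`. The functional
`F` receives the excess `T = ∑ (m_j - 1)` together with the resulting word. -/
def act {M : Type*} [AddCommMonoid M] :
    List (ℤ × (List V → V)) → (ℕ → List V → M) → List V → M
  | [], F, v => F 0 v
  -- Twists are applied in instalments. The excess `T` of the later cochains is known only inside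
  -- the functional; the value of `x` gets `T` alone, the prefix `u` gets `T + (m - 1)`, and the
  -- rest `w'`, already twisted within itself, gets the remaining `m - 1`.
  | x :: X, F, v => split (fun u r => split (fun b w => if b.length = 0 then 0 else
      act X (fun T w' => F (T + (b.length - 1))
        (tw 𝒱 α (T + (b.length - 1)) (x.1 + deg X) u ++
          (α ^ T) (x.2 (tw 𝒱 α 0 (deg X) b)) :: tw 𝒱 α (b.length - 1) 0 w')) w) r) v

variable {M N : Type*} [AddCommMonoid M] [AddCommMonoid N]

@[simp] lemma act_nil (F : ℕ → List V → M) (v : List V) : act 𝒱 α [] F v = F 0 v := rfl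

lemma act_cons (x : ℤ × (List V → V)) (X : List (ℤ × (List V → V))) (F : ℕ → List V → M)
    (v : List V) : act 𝒱 α (x :: X) F v =
      split (fun u r => split (fun b w => if b.length = 0 then 0 else
      act 𝒱 α X (fun T w' => F (T + (b.length - 1))
        (tw 𝒱 α (T + (b.length - 1)) (x.1 + deg X) u ++
          (α ^ T) (x.2 (tw 𝒱 α 0 (deg X) b)) :: tw 𝒱 α (b.length - 1) 0 w')) w) r) v := rfl

/-- Each insertion replaces `m ≥ 1` letters by one. So length plus excess is conserved and nonempty
words stay nonempty, and `F` is only evaluated at such pairs. -/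
lemma act_congr {X : List (ℤ × (List V → V))} {F G : ℕ → List V → M} {v : List V}
    (h : ∀ T w, w.length + T = v.length → (w.length = 0 ↔ v.length = 0) → F T w = G T w) :
    act 𝒱 α X F v = act 𝒱 α X G v := by
  induction X generalizing F G v with
  | nil => exact h 0 v rfl Iff.rfl
  | cons x X ih =>
    refine split_congr fun u r hv => split_congr fun b w hr => ?_
    subst hr hv
    split_ifs with hb
    · rfl
    · refine ih fun T w' hw _ => h _ _ ?_ ?_ <;>
        simp only [List.length_append, length_tw, List.length_cons] <;> omega

lemma act_add (X : List (ℤ × (List V → V))) (F G : ℕ → List V → M) (v : List V) :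
    act 𝒱 α X (fun T w => F T w + G T w) v = act 𝒱 α X F v + act 𝒱 α X G v := by
  induction X generalizing F G v with
  | nil => rfl
  | cons x X ih =>
    simp only [act_cons, ← split_add, ih]
    refine split_congr fun u r hv => split_congr fun b w hr => ?_
    split_ifs <;> simp

lemma map_act {G : Type*} [FunLike G M N] [AddMonoidHomClass G M N] (g : G)
    (X : List (ℤ × (List V → V))) (F : ℕ → List V → M) (v : List V) :
    g (act 𝒱 α X F v) = act 𝒱 α X (fun T w => g (F T w)) v := by
  induction X generalizing F v with
  | nil => rfl
  | cons x X ih =>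
    simp only [act_cons, map_split, ← ih]
    refine split_congr fun u r hv => split_congr fun b w hr => ?_
    split_ifs <;> simp

lemma act_zero (X : List (ℤ × (List V → V))) (v : List V) :
    act 𝒱 α X (fun _ _ => (0 : M)) v = 0 :=
  (map_act 𝒱 α (0 : M →+ M) X (fun _ _ => 0) v).symm

lemma act_sum {ι : Type*} (s : Finset ι) (X : List (ℤ × (List V → V)))
    (F : ι → ℕ → List V → M) (v : List V) :
    act 𝒱 α X (fun T w => ∑ i ∈ s, F i T w) v = ∑ i ∈ s, act 𝒱 α X (F i) v := by
  classical
  induction s using Finset.induction_on with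
  | empty => simp [act_zero]
  | insert i s hi ih => simp only [Finset.sum_insert hi, act_add, ih]

lemma act_split_const {Y : Type*} (X : List (ℤ × (List V → V)))
    (Φ : ℕ → List V → List Y → List Y → M) (l : List Y) (v : List V) :
    act 𝒱 α X (fun T w => split (Φ T w) l) v =
      split (fun a b => act 𝒱 α X (fun T w => Φ T w a b) v) l := act_sum _ _ _ _ _ _

lemma act_smul {R : Type*} [DistribSMul R M] (r : R) (X : List (ℤ × (List V → V)))
    (F : ℕ → List V → M) (v : List V) :
    act 𝒱 α X (fun T w => r • F T w) v = r • act 𝒱 α X F v :=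
  (map_act 𝒱 α (DistribSMul.toAddMonoidHom M r) X F v).symm

lemma act_ite_const (p : Prop) [Decidable p] (X : List (ℤ × (List V → V)))
    (F : ℕ → List V → M) (v : List V) :
    act 𝒱 α X (fun T w => if p then 0 else F T w) v = if p then 0 else act 𝒱 α X F v := by
  split_ifs
  · exact act_zero _ _ _ _
  · rfl

variable {𝒱 α}

lemma split_tw (n : ℕ) (d : ℤ) (Φ : List V → List V → M) (v : List V) :
    split Φ (tw 𝒱 α n d v) = split (fun u w => Φ (tw 𝒱 α n d u) (tw 𝒱 α n d w)) v :=
  split_map _ _ _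

/-- The insertion of cochains is compatible with the deconcatenation of words. -/
lemma act_split (hα : ∀ i, ∀ a ∈ 𝒱 i, α a ∈ 𝒱 i) (X : List (ℤ × (List V → V)))
    (Φ : ℕ → List V → List V → M) (v : List V) :
    act 𝒱 α X (fun T => split (Φ T)) v =
      split (fun X₁ X₂ => split (fun v₁ v₂ => act 𝒱 α X₂ (fun T₂ w₂ => act 𝒱 α X₁ (fun T₁ w₁ =>
        Φ (T₁ + T₂) (tw 𝒱 α T₂ 0 w₁) (tw 𝒱 α T₁ 0 w₂)) (tw 𝒱 α 0 (deg X₂) v₁)) v₂) v) X := by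
  induction X generalizing Φ v with
  | nil => simp [split_nil]
  | cons x X ih =>
    rw [split_cons]
    simp only [act_cons, act_nil, split_append_cons, split_tw, act_add, act_split_const,
      tw_tw 𝒱 hα, ite_zero_add, split_add, ite_split, add_zero, zero_add, tw_zero, deg_cons]
    congr 1
    -- The cut falls in front of the value of `x`, so every cochain acts on the right factor.
    · exact (split_congr fun u r _ => split_comm _ _ _).trans
        (split_assoc (fun p q r => split _ r) v)
    -- The cut falls after the value of `x`; the induction hypothesis cuts the remaining word.
    · simp only [ih, act_ite_const, ite_split]
      simp only [← split_assoc]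
      simp only [split_assoc]
      rw [split_comm]
      refine split_congr fun u r _ => ?_
      rw [split_comm]
      refine split_congr fun X₁ X₂ hX => split_congr fun b s _ => split_congr fun w₁ w₂ _ => ?_
      subst hX
      simp only [length_tw, deg_append, tw_append, tw_cons, tw_tw 𝒱 hα, twl_zero_right,
        ← Module.End.mul_apply, ← pow_add, add_zero, zero_add]
      simp only [add_comm, add_assoc]

/-- Once the block of `z` is fixed, `X₁` and `X₃` are inserted independently to its left and right,
and each part of the result is twisted by the excess of the others. The letters `v₁` receive the
signs of `z` and `X₃` before `X₁` is inserted. -/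
lemma act_append_cons (hα : ∀ i, ∀ a ∈ 𝒱 i, α a ∈ 𝒱 i) (X₁ : List (ℤ × (List V → V)))
    (z : ℤ × (List V → V)) (X₃ : List (ℤ × (List V → V))) (F : ℕ → List V → M) (v : List V) :
    act 𝒱 α (X₁ ++ z :: X₃) F v =
      split (fun v₁ r => split (fun b v₃ => if b.length = 0 then 0 else
        act 𝒱 α X₃ (fun T₃ w => act 𝒱 α X₁ (fun T₁ u => F (T₁ + T₃ + (b.length - 1))
          (tw 𝒱 α (T₃ + (b.length - 1)) 0 u ++ (α ^ (T₁ + T₃)) (z.2 (tw 𝒱 α 0 (deg X₃) b)) ::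
            tw 𝒱 α (T₁ + (b.length - 1)) 0 w)) (tw 𝒱 α 0 (z.1 + deg X₃) v₁)) v₃) r) v := by
  induction X₁ generalizing F v with
  | nil => simp [act_cons, tw_tw 𝒱 hα]
  | cons x X₁ ih =>
    rw [List.cons_append, act_cons]
    simp only [ih]
    simp only [act_cons, split_tw, act_split_const, ite_split, act_ite_const]
    -- Two bracketings of `v = u ++ b ++ v₁ ++ b' ++ v₃`: from the left, as in `act`, and around the
    -- block `b'` of `z`.
    have h : ∀ (G : List V → List V → List V → List V → List V → M),
        split (fun u s => split (fun b t => split (fun v₁ r => split (fun b' v₃ =>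
          G u b v₁ b' v₃) r) t) s) v =
        split (fun l r => split (fun b' v₃ => split (fun u s => split (fun b v₁ =>
          G u b v₁ b' v₃) s) l) r) v := by
      intro G
      simp only [← split_assoc (fun b v₁ r => split (fun b' v₃ => G _ b v₁ b' v₃) r)]
      rw [← split_assoc (fun u s r => split (fun b v₁ => split (fun b' v₃ => G u b v₁ b' v₃) r) s)]
      refine split_congr fun l r _ => ?_
      rw [split_comm (fun b' v₃ u s => split (fun b v₁ => G u b v₁ b' v₃) s)]
      refine split_congr fun u s _ => ?_
      rw [split_comm]
    rw [h]
    refine split_congr fun l r _ => split_congr fun b' v₃ _ => split_congr fun u s _ =>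
      split_congr fun b v₁ _ => ?_
    rw [length_tw]
    by_cases hb : b.length = 0 <;> by_cases hb' : b'.length = 0 <;>
      simp only [hb, hb', if_true, if_false]
    simp only [deg_append, deg_cons, tw_append, tw_cons, tw_tw 𝒱 hα, twl_zero_right,
        ← Module.End.mul_apply, ← pow_add, add_zero, zero_add, List.append_assoc, List.cons_append,
        add_comm, add_left_comm, add_assoc]

end Act

/-! ### Multilinear functions on words and reduction to homogeneous letters. -/

section MultilinearActions

variable {K : Type*} [Field K] {V W : Type*} [AddCommGroup V] [Module K V]
  [AddCommGroup W] [Module K W]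

lemma IsMultilinear.map_units {f : List V → W} (hf : IsMultilinear K f) (a c : List V) (s : ℤˣ)
    (x : V) : f (a ++ (s • x) :: c) = s • f (a ++ x :: c) := by
  rcases Int.units_eq_one_or s with rfl | rfl
  · simp
  · simpa [Units.smul_def] using hf.map_smul a c (-1) x

/-- Multilinearity is tested one arity at a time, so a function may depend on the length of the word
in any way, for instance through a twist exponent. -/
lemma IsMultilinear.of_length {f : ℕ → List V → W} (hf : ∀ n, IsMultilinear K (f n)) :
    IsMultilinear K (fun v => f v.length v) := fun n => by
  obtain ⟨F, hF⟩ := hf n n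
  exact ⟨F, fun v => by simp [hF]⟩

lemma isMultilinear_zero : IsMultilinear K (fun _ : List V => (0 : W)) := fun _ => ⟨0, fun _ => rfl⟩

lemma IsMultilinear.append_left {f : List V → W} (hf : IsMultilinear K f) (p : List V) :
    IsMultilinear K (fun w => f (p ++ w)) :=
  .of_list (fun a c x y => by simpa using hf.map_add (p ++ a) c x y)
    fun a c r x => by simpa using hf.map_smul (p ++ a) c r x

lemma IsMultilinear.append_right {f : List V → W} (hf : IsMultilinear K f) (p : List V) :
    IsMultilinear K (fun w => f (w ++ p)) :=
  .of_list (fun a c x y => by simpa using hf.map_add a (c ++ p) x y)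
    fun a c r x => by simpa using hf.map_smul a (c ++ p) r x

lemma IsMultilinear.insert {f : List V → W} (hf : IsMultilinear K f) {g : List V → V}
    (hg : IsMultilinear K g) (p q : List V) : IsMultilinear K (fun w => f (p ++ g w :: q)) :=
  .of_list (fun a c x y => by rw [hg.map_add, hf.map_add])
    fun a c r x => by rw [hg.map_smul, hf.map_smul]

lemma IsMultilinear.linear_comp {U : Type*} [AddCommGroup U] [Module K U] (g : W →ₗ[K] U)
    {f : List V → W} (hf : IsMultilinear K f) : IsMultilinear K (fun w => g (f w)) :=
  .of_list (fun a c x y => by rw [hf.map_add, LinearMap.map_add])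
    fun a c r x => by rw [hf.map_smul, LinearMap.map_smul]

lemma IsMultilinear.split {Φ : List V → List V → W} (h₁ : ∀ w, IsMultilinear K (fun u => Φ u w))
    (h₂ : ∀ u, IsMultilinear K (Φ u)) : IsMultilinear K (split Φ) := by
  refine .of_list (fun a c x y => ?_) (fun a c r x => ?_)
  · simp only [split_append_cons, (h₁ _).map_add, (h₂ _).map_add, split_add]
    abel
  · simp only [split_append_cons, (h₁ _).map_smul, (h₂ _).map_smul, ← smul_split, smul_add]

lemma units_smul_split {X : Type*} (s : ℤˣ) (Φ : List X → List X → W) (v : List X) :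
    s • HomAInf.split Φ v = HomAInf.split (fun u w => s • Φ u w) v := Finset.smul_sum

variable (𝒱 : ℤ → Submodule K V) [DirectSum.Decomposition 𝒱] {α : V →ₗ[K] V}

lemma IsMultilinear.comp_tw {f : List V → W} (hf : IsMultilinear K f) (n : ℕ) (d : ℤ) :
    IsMultilinear K (fun w => f (tw 𝒱 α n d w)) := hf.comp_map _

/-- A multilinear function that vanishes on the words in homogeneous letters is zero. -/
lemma IsMultilinear.eq_zero {f : List V → W} (hf : IsMultilinear K f)
    (h : ∀ v : List V, (∀ a ∈ v, ∃ i, a ∈ 𝒱 i) → f v = 0) (v : List V) : f v = 0 := by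
  have key : ∀ (c a : List V), (∀ x ∈ a, ∃ i, x ∈ 𝒱 i) → f (a ++ c) = 0 := by
    intro c
    induction c with
    | nil => intro a ha; simpa using h a ha
    | cons z c ih =>
      intro a ha
      induction z using homogeneous_induction 𝒱 with
      | h0 i z hz =>
        have := ih (a ++ [z]) (by
          intro x hx
          rcases List.mem_append.1 hx with hx | hx
          · exact ha x hx
          · rw [List.mem_singleton.1 hx]; exact ⟨i, hz⟩)
        simpa using this
      | hadd z w hz hw => rw [hf.map_add, hz, hw, add_zero]
  simpa using key v [] (by simp)

/-- Homogeneous elements span `V`. Sign identities may therefore be checked on homogeneous letters,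
where the operators `sgn` become scalars. -/
lemma IsMultilinear.ext {f g : List V → W} (hf : IsMultilinear K f) (hg : IsMultilinear K g)
    (h : ∀ v : List V, (∀ a ∈ v, ∃ i, a ∈ 𝒱 i) → f v = g v) : f = g := by
  funext v
  rw [← sub_eq_zero]
  refine IsMultilinear.eq_zero (f := fun v => f v - g v) 𝒱 ?_ (fun v hv => ?_) v
  · refine .of_list (fun a c x y => ?_) (fun a c r x => ?_)
    · rw [hf.map_add, hg.map_add]; abel
    · rw [hf.map_smul, hg.map_smul, smul_sub]
  · rw [h v hv, sub_self]

lemma exists_degrees {v : List V} (hv : ∀ a ∈ v, ∃ i, a ∈ 𝒱 i) :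
    ∃ e : List ℤ, List.Forall₂ (fun a i => a ∈ 𝒱 i) v e := by
  induction v with
  | nil => exact ⟨[], .nil⟩
  | cons a v ih =>
    obtain ⟨i, hi⟩ := hv a (by simp)
    obtain ⟨e, he⟩ := ih fun b hb => hv b (by simp [hb])
    exact ⟨i :: e, .cons hi he⟩

lemma HasDegree.mem {f : List V → V} {d : ℤ} (hf : HasDegree 𝒱 d f) {v : List V} {e : List ℤ}
    (h : List.Forall₂ (fun a i => a ∈ 𝒱 i) v e) : f v ∈ 𝒱 (e.sum + d) := by
  have hl := h.length_eq
  have := hf v.length (fun j => e.get (j.cast hl)) v.get fun j => h.get j.2 (hl ▸ j.2)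
  rw [List.ofFn_get] at this
  convert this using 2
  rw [← List.sum_ofFn]
  congr 2
  refine List.ext_getElem (by simp [hl]) fun i h1 h2 => by simp

lemma HasDegree.of_list {f : List V → V} {d : ℤ} (h : ∀ (v : List V) (e : List ℤ),
    List.Forall₂ (fun a i => a ∈ 𝒱 i) v e → f v ∈ 𝒱 (e.sum + d)) : HasDegree 𝒱 d f := by
  intro n e v hv
  rw [← List.sum_ofFn]
  refine h _ _ ?_
  rw [List.forall₂_iff_get]
  refine ⟨by simp, fun i h1 h2 => by simpa using hv _⟩

lemma IsMultilinear.map_tw_sgn {f : List V → W} (hf : IsMultilinear K f) (d : ℤ) {v : List V}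
    {e : List ℤ} (h : List.Forall₂ (fun a i => a ∈ 𝒱 i) v e) :
    f (tw 𝒱 α 0 d v) = (d * e.sum).negOnePow • f v := by
  suffices H : ∀ a, f (a ++ tw 𝒱 α 0 d v) = (d * e.sum).negOnePow • f (a ++ v) by simpa using H []
  induction h with
  | nil => simp
  | @cons x i v e hx _ ih =>
    intro a
    rw [tw_cons, twl_zero_left, sgn_of_mem 𝒱 d i hx, hf.map_units]
    have := ih (a ++ [x])
    simp only [List.append_assoc, List.singleton_append] at this
    rw [this, smul_smul, ← Int.negOnePow_add, List.sum_cons, mul_add]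

variable {𝒱}

lemma tw_eq_tw_tw (n : ℕ) (d : ℤ) (v : List V) :
    tw 𝒱 α n d v = (tw 𝒱 α 0 d v).map (α ^ n) := by
  simp [tw, twl]

lemma coder_map_pow {d : ℤ} {x : List V → V} (hx : x ∈ Coder 𝒱 α d) (n : ℕ) (v : List V) :
    x (v.map (α ^ n)) = (α ^ n) (x v) := by
  induction n with
  | zero => exact congrArg x (List.map_id v)
  | succ n ih =>
    rw [pow_succ', Module.End.mul_apply, ← ih, ← hx.2.2.2, List.map_map]
    rfl

/-- On homogeneous letters of total degree `s`, the arguments produce `(-1)^{es}` and the value, of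
degree `s + d`, produces `(-1)^{e(s+d)}`; the discrepancy is the Koszul sign `(-1)^{de}`. -/
lemma coder_tw {d : ℤ} {x : List V → V} (hx : x ∈ Coder 𝒱 α d) (n : ℕ) (e : ℤ) (v : List V) :
    x (tw 𝒱 α n e v) = (d * e).negOnePow • twl 𝒱 α n e (x v) := by
  have h : (fun v => x (tw 𝒱 α 0 e v)) =
      fun v => (((d * e).negOnePow : ℤˣ) : K) • sgn 𝒱 e (x v) := by
    refine IsMultilinear.ext 𝒱 (hx.2.1.comp_tw 𝒱 0 e)
      ((hx.2.1.linear_comp (sgn 𝒱 e)).linear_comp (LinearMap.lsmul K V _)) fun v hv => ?_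
    obtain ⟨es, hes⟩ := exists_degrees 𝒱 hv
    simp only [hx.2.1.map_tw_sgn 𝒱 e hes, sgn_of_mem 𝒱 e _ (hx.2.2.1.mem 𝒱 hes)]
    rw [show ∀ w : V, (((d * e).negOnePow : ℤˣ) : K) • w = (d * e).negOnePow • w by
      intro w; rw [Units.smul_def, Int.cast_smul_eq_zsmul], smul_smul, ← Int.negOnePow_add]
    congr 1
    rw [Int.negOnePow_eq_iff]
    exact ⟨-(e*d), by ring⟩
  rw [tw_eq_tw_tw, coder_map_pow hx, congrFun h v, twl_apply, map_smul, Units.smul_def,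
    Int.cast_smul_eq_zsmul]

end MultilinearActions

/-! ### Composition laws for insertions. -/

section BraceRelations

variable {K : Type*} [Field K] {V : Type*} [AddCommGroup V] [Module K V]
  {𝒱 : ℤ → Submodule K V} [DirectSum.Decomposition 𝒱] {α : V →ₗ[K] V}
  {M : Type*} [AddCommGroup M] [Module K M]

lemma isMultilinear_act_step {F : ℕ → List V → M} (hF : ∀ T, IsMultilinear K (F T)) (T : ℕ)
    (p : List V) (z : V) (m : ℕ) (d : ℤ) :
    IsMultilinear K (fun w => F T (p ++ z :: tw 𝒱 α m d w)) := by
  have := (((hF T).append_left p).append_left [z]).comp_tw 𝒱 (α := α) m d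
  simpa using this

/-- Each letter of the word enters exactly one of prefix, block and rest, and does so linearly. The
block also enters through its length, which `IsMultilinear.of_length` freezes. -/
lemma isMultilinear_act {X : List (ℤ × (List V → V))} (hX : ∀ x ∈ X, IsMultilinear K x.2)
    {F : ℕ → List V → M} (hF : ∀ T, IsMultilinear K (F T)) : IsMultilinear K (act 𝒱 α X F) := by
  induction X generalizing F with
  | nil => exact hF 0
  | cons x X ih =>
    have ih' := fun F hF => ih (fun y hy => hX y (by simp [hy])) (F := F) hF
    have hx := hX x (by simp)
    refine .split (fun r => ?_) fun u => .split (fun w => ?_) fun b => ?_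
    · refine IsMultilinear.of_list (fun a c y z => ?_) (fun a c s y => ?_)
      · rw [← split_add]
        refine split_congr fun b w _ => ?_
        rw [← ite_zero_add, ← act_add]
        simp only [tw_append, tw_cons, map_add, List.append_assoc, List.cons_append,
          (hF _).map_add]
      · rw [smul_split]
        refine split_congr fun b w _ => ?_
        rw [smul_ite, smul_zero, ← act_smul]
        simp only [tw_append, tw_cons, map_smul, List.append_assoc, List.cons_append,
          (hF _).map_smul]
    · refine IsMultilinear.of_length (f := fun n b => if n = 0 then 0 else
        act 𝒱 α X (fun T w' => F (T + (n - 1)) (tw 𝒱 α (T + (n - 1)) (x.1 + deg X) u ++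
          (α ^ T) (x.2 (tw 𝒱 α 0 (deg X) b)) :: tw 𝒱 α (n - 1) 0 w')) w) fun n => ?_
      split_ifs with hn
      · exact isMultilinear_zero
      · have h : ∀ T w', IsMultilinear K (fun b => F (T + (n - 1))
            (tw 𝒱 α (T + (n - 1)) (x.1 + deg X) u ++
              (α ^ T) (x.2 (tw 𝒱 α 0 (deg X) b)) :: tw 𝒱 α (n - 1) 0 w')) := fun T w' =>
          (hF _).insert ((hx.comp_tw 𝒱 0 (deg X)).linear_comp (α ^ T)) _ _
        refine IsMultilinear.of_list (fun a c y z => ?_) (fun a c s y => ?_)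
        · rw [← act_add]; simp only [(h _ _).map_add]
        · rw [← act_smul]; simp only [(h _ _).map_smul]
    · split_ifs
      · exact isMultilinear_zero
      · exact ih' _ fun T => isMultilinear_act_step hF _ _ _ _ _

lemma map_act_linear {N : Type*} [AddCommGroup N] (g : M → N) (hg : ∀ x y, g (x + y) = g x + g y)
    (X : List (ℤ × (List V → V))) (F : ℕ → List V → M) (v : List V) :
    g (act 𝒱 α X F v) = act 𝒱 α X (fun T w => g (F T w)) v :=
  map_act 𝒱 α (AddMonoidHom.mk' g hg) X F v

lemma units_smul_act (s : ℤˣ) (X : List (ℤ × (List V → V))) (F : ℕ → List V → M) (v : List V) :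
    act 𝒱 α X (fun T w => s • F T w) v = s • act 𝒱 α X F v :=
  act_smul 𝒱 α s X F v

/-- A list of cochains, with their degrees. -/
def IsCoders (𝒱 : ℤ → Submodule K V) (α : V →ₗ[K] V) (X : List (ℤ × (List V → V))) : Prop :=
  ∀ x ∈ X, x.2 ∈ Coder 𝒱 α x.1

lemma isCoders_cons {x : ℤ × (List V → V)} {X : List (ℤ × (List V → V))} :
    IsCoders 𝒱 α (x :: X) ↔ x.2 ∈ Coder 𝒱 α x.1 ∧ IsCoders 𝒱 α X := List.forall_mem_cons

lemma isCoders_append {X Y : List (ℤ × (List V → V))} :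
    IsCoders 𝒱 α (X ++ Y) ↔ IsCoders 𝒱 α X ∧ IsCoders 𝒱 α Y := List.forall_mem_append

lemma isCoders_nil : IsCoders 𝒱 α [] := by simp [IsCoders]

/-- Each inserted cochain commutes with `tw` up to its Koszul sign, by `coder_tw`; the signs
multiply to that of the total degree. -/
lemma act_tw (hα : ∀ i, ∀ a ∈ 𝒱 i, α a ∈ 𝒱 i) {X : List (ℤ × (List V → V))}
    (hX : IsCoders 𝒱 α X) {F : ℕ → List V → M} (hF : ∀ T, IsMultilinear K (F T)) (n : ℕ) (s : ℤ)
    (v : List V) : act 𝒱 α X (fun T w => F T (tw 𝒱 α n s w)) v =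
      (s * deg X).negOnePow • act 𝒱 α X F (tw 𝒱 α n s v) := by
  induction X generalizing F v with
  | nil => simp
  | cons x X ih =>
    rw [isCoders_cons] at hX
    simp only [act_cons, split_tw, units_smul_split, length_tw, smul_ite, smul_zero]
    refine split_congr fun u r _ => split_congr fun b w _ => if_congr Iff.rfl rfl ?_
    have hx : ∀ T : ℕ, (α ^ T) (x.2 (tw 𝒱 α 0 (deg X) (tw 𝒱 α n s b))) =
        (s * x.1).negOnePow • twl 𝒱 α n s ((α ^ T) (x.2 (tw 𝒱 α 0 (deg X) b))) := by
      intro T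
      rw [tw_tw 𝒱 hα, zero_add, add_comm (deg X), ← add_zero n, ← tw_tw 𝒱 hα, coder_tw hX.1,
        LinearMap.map_smul_of_tower, ← twl_zero_right 𝒱, twl_twl 𝒱 hα, twl_twl 𝒱 hα, mul_comm,
        add_zero, zero_add, add_zero, add_comm T]
    simp only [hx, (hF _).map_units, units_smul_act, smul_smul, ← Int.negOnePow_add, deg_cons]
    rw [show s * (x.1 + deg X) + s * x.1 = s * deg X + 2 * (s * x.1) by ring, Int.negOnePow_add,
      Int.negOnePow_two_mul, mul_one, ← ih hX.2 fun T => isMultilinear_act_step hF _ _ _ _ _]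
    simp only [tw_append, tw_cons, tw_tw 𝒱 hα, add_comm]

/-- The form in which additivity of excess is used. After insertions of excess `T` into a block, `T
+ (w.length - 1)` depends only on the original length, so a cochain applied to the result twists its
surroundings as one cochain of the original arity would. -/
lemma act_congr_ite {M : Type*} [AddCommMonoid M] {X : List (ℤ × (List V → V))}
    {F : ℕ → List V → M} {G : List V → M}
    {v : List V} (h : v.length ≠ 0 → ∀ T w, w.length ≠ 0 → T + (w.length - 1) = v.length - 1 →
      F T w = G w) :
    act 𝒱 α X (fun T w => if w.length = 0 then 0 else F T w) v =
      if v.length = 0 then 0 else act 𝒱 α X (fun _ w => G w) v := by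
  split_ifs with hv
  · exact (act_congr 𝒱 α fun T w h1 h2 => if_pos (h2.2 hv)).trans (act_zero 𝒱 α X v)
  · refine act_congr 𝒱 α fun T w h1 h2 => ?_
    have hw : w.length ≠ 0 := fun h => hv (h2.1 h)
    rw [if_neg hw]
    exact h hv T w hw (by omega)

/-- The composition of the insertion of one cochain with the insertion of several. -/
lemma act_act_singleton (hα : ∀ i, ∀ a ∈ 𝒱 i, α a ∈ 𝒱 i) {X : List (ℤ × (List V → V))}
    (hX : IsCoders 𝒱 α X) {d : ℤ} {y : List V → V} (hy : y ∈ Coder 𝒱 α d)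
    {F : ℕ → List V → M} (hF : ∀ T, IsMultilinear K (F T)) (v : List V) :
    act 𝒱 α X (fun T w => act 𝒱 α [(d, y)] (fun S => F (T + S)) w) v =
      split (fun X₁ R => split (fun X₂ X₃ => (d * deg X₁).negOnePow •
        act 𝒱 α (X₁ ++ (d + deg X₂, act 𝒱 α X₂ (fun _ => y)) :: X₃) F v) R) X := by
  have h1 : ∀ T w, act 𝒱 α [(d, y)] (fun S => F (T + S)) w =
      split (fun u r => split (fun b w' => if b.length = 0 then 0 else
        F (T + (b.length - 1)) (tw 𝒱 α (b.length - 1) d u ++ y b ::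
          tw 𝒱 α (b.length - 1) 0 w')) r) w := by
    intro T w
    simp [act_cons]
  simp only [h1]
  -- Cutting the intermediate word where the block of `y` begins determines `X₁`.
  rw [act_split hα]
  refine split_congr fun X₁ R hX' => ?_
  subst hX'
  rw [isCoders_append] at hX
  simp only [split_tw, act_split_const]
  -- Cutting it again where that block ends separates the cochains `X₂` swallowed by `y` from `X₃`.
  simp only [act_split hα R]
  rw [split_comm]
  refine split_congr fun X₂ X₃ hX' => ?_
  subst hX'
  rw [act_append_cons hα, units_smul_split]
  refine split_congr fun v₁ r _ => ?_
  rw [units_smul_split]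
  refine split_congr fun b₀ v₃ _ => ?_
  simp only [length_tw, act_ite_const, smul_ite, smul_zero]
  rw [← units_smul_act, ← act_ite_const]
  congr 1
  funext T₂ w₂
  -- The excess of `X₂` and that of `y` add up to the excess of the single cochain `{y}{X₂}` on
  -- `b₀`.
  have hl : ∀ T₁ (w₁ : List V), T₁ + (w₁.length - 1) = b₀.length - 1 → ∀ T, T + (T₁ + T₂) +
      (w₁.length - 1) = T + T₂ + (b₀.length - 1) := by omega
  rw [act_congr_ite (G := fun w₁ => act 𝒱 α X₁ (fun T w => F (T + T₂ + (b₀.length - 1))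
      (tw 𝒱 α (T₂ + (b₀.length - 1)) d w ++ (α ^ (T + T₂)) (y w₁) ::
        tw 𝒱 α (T + (b₀.length - 1)) 0 w₂)) (tw 𝒱 α 0 (deg (X₂ ++ X₃)) v₁))]
  · rw [length_tw]
    refine if_congr Iff.rfl rfl ?_
    -- Additivity in the slot of `y` moves the sum over insertions of `X₂` into that slot, where it
    -- is the value of `{y}{X₂}`.
    rw [← map_act_linear (fun z => act 𝒱 α X₁ (fun T w => F (T + T₂ + (b₀.length - 1))
      (tw 𝒱 α (T₂ + (b₀.length - 1)) d w ++ (α ^ (T + T₂)) z ::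
        tw 𝒱 α (T + (b₀.length - 1)) 0 w₂)) (tw 𝒱 α 0 (deg (X₂ ++ X₃)) v₁))]
    -- The sign operator of `y` acts on the letters after `X₁` has been inserted; moving it in front
    -- of `X₁` costs `(-1)^{d · deg X₁}`.
    · have := act_tw hα hX.1 (F := fun T w => F (T + T₂ + (b₀.length - 1))
        (tw 𝒱 α (T₂ + (b₀.length - 1)) 0 w ++
          (α ^ (T + T₂)) (act 𝒱 α X₂ (fun x => y) (tw 𝒱 α 0 (deg X₃) b₀)) ::
            tw 𝒱 α (T + (b₀.length - 1)) 0 w₂))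
        (fun T => ((hF _).append_right _).comp_tw 𝒱 _ _) 0 d (tw 𝒱 α 0 (deg (X₂ ++ X₃)) v₁)
      simp only [tw_tw 𝒱 hα, add_zero, zero_add] at this
      rw [deg_append, ← add_assoc] at this
      rw [deg_append]
      exact this
    · intro x z
      simp only [map_add, (hF _).map_add, act_add]
  · intro hb T₁ w₁ hw h
    rw [length_tw] at h
    congr 1
    funext T w
    rw [hl T₁ w₁ h]
    simp only [tw_tw 𝒱 hα, coder_tw hy, mul_zero, add_zero, Int.negOnePow_zero, one_smul,
      twl_zero_right]
    rw [← h]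
    simp only [add_comm, add_left_comm, add_assoc]

/-- The sum of `Φ X₁ x X₂` over all decompositions `X = X₁ ++ x :: X₂`. -/
def splitAt {X M : Type*} [AddCommMonoid M] (Φ : List X → X → List X → M) : List X → M
  | [] => 0
  | x :: l => Φ [] x l + splitAt (fun u => Φ (x :: u)) l

lemma units_smul_splitAt {X : Type*} (s : ℤˣ) (Φ : List X → X → List X → M) (l : List X) :
    s • splitAt Φ l = splitAt (fun u x w => s • Φ u x w) l := by
  induction l generalizing Φ with
  | nil => exact smul_zero _
  | cons x l ih => rw [splitAt, splitAt, smul_add, ih]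

lemma split_splitAt_comm {X Y : Type*} (Φ : List Y → List Y → List X → X → List X → M) (l : List X)
    (v : List Y) : split (fun a b => splitAt (Φ a b) l) v =
      splitAt (fun u x w => split (fun a b => Φ a b u x w) v) l := by
  induction l generalizing Φ with
  | nil => exact split_zero v
  | cons x l ih => simp only [splitAt, split_add, ih]

lemma ite_splitAt {X : Type*} (p : Prop) [Decidable p] (Φ : List X → X → List X → M) (l : List X) :
    (if p then 0 else splitAt Φ l) = splitAt (fun u x w => if p then 0 else Φ u x w) l := by
  induction l generalizing Φ with
  | nil => exact ite_self _
  | cons x l ih => rw [splitAt, splitAt, ite_zero_add, ih]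

lemma splitAt_congr {X : Type*} {Φ Ψ : List X → X → List X → M} {l : List X}
    (h : ∀ u x w, u ++ x :: w = l → Φ u x w = Ψ u x w) : splitAt Φ l = splitAt Ψ l := by
  induction l generalizing Φ Ψ with
  | nil => rfl
  | cons x l ih =>
    rw [splitAt, splitAt, h [] x l rfl, ih]
    rintro u y w rfl
    exact h _ _ _ rfl

/-- The composition of the insertion of several cochains with the insertion of one. -/
lemma act_singleton_act (hα : ∀ i, ∀ a ∈ 𝒱 i, α a ∈ 𝒱 i) {X : List (ℤ × (List V → V))}
    (hX : IsCoders 𝒱 α X) {d : ℤ} {y : List V → V} (hy : y ∈ Coder 𝒱 α d)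
    {F : ℕ → List V → M} (hF : ∀ T, IsMultilinear K (F T)) (v : List V) :
    act 𝒱 α [(d, y)] (fun T w => act 𝒱 α X (fun S => F (T + S)) w) v =
      split (fun X₁ X₂ => (d * deg X₂).negOnePow • act 𝒱 α (X₁ ++ (d, y) :: X₂) F v) X +
      splitAt (fun X₁ x X₂ => (d * deg X₂).negOnePow •
        act 𝒱 α (X₁ ++ (x.1 + d, act 𝒱 α [(d, y)] (fun _ => x.2)) :: X₂) F v) X := by
  have hY : IsCoders 𝒱 α [(d, y)] := isCoders_cons.2 ⟨hy, isCoders_nil⟩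
  induction X generalizing F v with
  | nil => simp [split_nil, splitAt, act_cons]
  | cons x X ih =>
    have hX' := hX
    rw [isCoders_cons] at hX
    -- `y` lands to the left of the block of `x`: the summand with `X₁ = []` of the first sum.
    have hB : split (fun v₁ r => act 𝒱 α [(d, y)] (fun T w₁ => split (fun b w =>
        if b.length = 0 then 0 else act 𝒱 α X (fun S w' => F (T + (S + (b.length - 1)))
          (tw 𝒱 α (S + (b.length - 1)) (x.1 + deg X) w₁ ++ (α ^ S) (x.2 (tw 𝒱 α 0 (deg X) b)) ::
            tw 𝒱 α (b.length - 1) 0 w')) w) (tw 𝒱 α T 0 r)) v₁) v =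
        (d * (x.1 + deg X)).negOnePow • act 𝒱 α ((d, y) :: x :: X) F v := by
      have h : ∀ v₁ r, act 𝒱 α [(d, y)] (fun T w₁ => split (fun b w =>
          if b.length = 0 then 0 else act 𝒱 α X (fun S w' => F (T + (S + (b.length - 1)))
            (tw 𝒱 α (S + (b.length - 1)) (x.1 + deg X) w₁ ++ (α ^ S) (x.2 (tw 𝒱 α 0 (deg X) b)) ::
              tw 𝒱 α (b.length - 1) 0 w')) w) (tw 𝒱 α T 0 r)) v₁ =
          split (fun p q => split (fun c u => if c.length = 0 then 0 else split (fun b w =>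
            if b.length = 0 then 0 else act 𝒱 α X
              (fun S w' => F (c.length - 1 + (S + (b.length - 1)))
                (tw 𝒱 α (S + (b.length - 1)) (x.1 + deg X)
                  (tw 𝒱 α (c.length - 1) d p ++ y c :: tw 𝒱 α (c.length - 1) 0 u) ++
                (α ^ S) (x.2 (tw 𝒱 α 0 (deg X) (tw 𝒱 α (c.length - 1) 0 b))) ::
                  tw 𝒱 α (b.length - 1) 0 w')) (tw 𝒱 α (c.length - 1) 0 w)) r) q) v₁ := by
        intro v₁ r
        simp only [act_cons, act_nil, split_tw, length_tw, deg_nil, add_zero, zero_add, tw_zero,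
          pow_zero, Module.End.one_apply]
      simp only [h, act_cons _ _ (d, y), act_cons _ _ x, units_smul_split, smul_ite, smul_zero,
        ite_split]
      simp only [split_assoc]
      refine split_congr fun p r _ => split_congr fun c r' _ => split_congr fun u s _ =>
        split_congr fun b w _ => if_congr Iff.rfl rfl (if_congr Iff.rfl rfl ?_)
      have hw := act_tw hα hX.2 (F := fun S w' => F (c.length - 1 + (S + (b.length - 1)))
        (tw 𝒱 α (S + (b.length - 1)) (x.1 + deg X)
          (tw 𝒱 α (c.length - 1) d p ++ y c :: tw 𝒱 α (c.length - 1) 0 u) ++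
        (α ^ S) (x.2 (tw 𝒱 α 0 (deg X) (tw 𝒱 α (c.length - 1) 0 b))) ::
          tw 𝒱 α (b.length - 1) 0 w'))
        (fun T => isMultilinear_act_step (F := fun _ => F _) (fun _ => hF _) T _ _ _ _)
        (c.length - 1) 0 w
      rw [zero_mul, Int.negOnePow_zero, one_smul] at hw
      rw [← hw, ← units_smul_act]
      congr 1
      funext S w'
      have hxb : ∀ m, x.2 (tw 𝒱 α 0 (deg X) (tw 𝒱 α m 0 b)) =
          (α ^ m) (x.2 (tw 𝒱 α 0 (deg X) b)) := by
        intro m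
        have := coder_tw hX.1 m 0 (tw 𝒱 α 0 (deg X) b)
        rw [mul_zero, Int.negOnePow_zero, one_smul, twl_zero_right] at this
        rw [← this, tw_tw 𝒱 hα, tw_tw 𝒱 hα, zero_add, add_zero, zero_add, add_zero]
      have hyc : ∀ m e, twl 𝒱 α m e (y c) = (d * e).negOnePow • (α ^ m) (y (tw 𝒱 α 0 e c)) := by
        intro m e
        rw [coder_tw hy, LinearMap.map_smul_of_tower, smul_smul, ← Int.negOnePow_add, ← two_mul,
          Int.negOnePow_two_mul, one_smul, ← twl_zero_right 𝒱, twl_twl 𝒱 hα, add_zero, zero_add]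
      simp only [tw_append, tw_cons, hxb, hyc, List.append_assoc, List.cons_append,
        (hF _).map_units]
      simp only [tw_tw 𝒱 hα, deg_cons, twl_zero_right, ← Module.End.mul_apply, ← pow_add]
      simp only [add_zero, add_comm, add_left_comm]
    -- `y` lands inside the block of `x`, and the two combine to `{x}{y}`: the summand with `X₁ =
    -- []` of the second sum.
    have hA : split (fun u r => split (fun b w => act 𝒱 α [(d, y)] (fun T b' =>
        if b'.length = 0 then 0 else act 𝒱 α X (fun S w' => F (T + (S + (b'.length - 1)))
          (tw 𝒱 α (S + (b'.length - 1)) (x.1 + deg X) (tw 𝒱 α T d u) ++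
            (α ^ S) (x.2 (tw 𝒱 α 0 (deg X) b')) :: tw 𝒱 α (b'.length - 1) 0 w')) (tw 𝒱 α T 0 w))
          b) r) v = (d * deg X).negOnePow •
        act 𝒱 α ((x.1 + d, act 𝒱 α [(d, y)] (fun _ => x.2)) :: X) F v := by
      rw [act_cons, units_smul_split]
      refine split_congr fun u r _ => ?_
      rw [units_smul_split]
      refine split_congr fun b w _ => ?_
      rw [act_congr_ite (G := fun b' => act 𝒱 α X (fun S w' => F (S + (b.length - 1))
          (tw 𝒱 α (S + (b.length - 1)) (x.1 + d + deg X) u ++ (α ^ S) (x.2 (tw 𝒱 α 0 (deg X) b')) ::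
            tw 𝒱 α (b.length - 1) 0 w')) w)]
      · rw [smul_ite, smul_zero]
        refine if_congr Iff.rfl rfl ?_
        rw [← map_act_linear (fun z => act 𝒱 α X (fun S w' => F (S + (b.length - 1))
          (tw 𝒱 α (S + (b.length - 1)) (x.1 + d + deg X) u ++ (α ^ S) z ::
            tw 𝒱 α (b.length - 1) 0 w')) w)]
        · rw [act_tw hα hY (F := fun _ => x.2) (fun _ => hX.1.2.1), deg_cons, deg_nil, add_zero]
          simp only [LinearMap.map_smul_of_tower, (hF _).map_units, units_smul_act, mul_comm]
        · intro z z'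
          simp only [map_add, (hF _).map_add, act_add]
      · intro hb T b' hb' h
        have := act_tw hα hX.2 (F := fun S w' => F (T + (S + (b'.length - 1)))
          (tw 𝒱 α (S + (b'.length - 1)) (x.1 + deg X) (tw 𝒱 α T d u) ++
            (α ^ S) (x.2 (tw 𝒱 α 0 (deg X) b')) :: tw 𝒱 α (b'.length - 1) 0 w'))
          (fun T => isMultilinear_act_step (F := fun _ => F _) (fun _ => hF _) T _ _ _ _) T 0 w
        rw [zero_mul, Int.negOnePow_zero, one_smul] at this
        rw [← this, ← h]
        simp only [tw_tw 𝒱 hα, add_zero, add_comm, add_left_comm, add_assoc]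
    -- `y` lands to the right of the block of `x`; the induction hypothesis, with the functional
    -- `F'` that remembers prefix and block, gives all other summands.
    have hC : split (fun u r => split (fun b w => act 𝒱 α [(d, y)] (fun T w₁ =>
        if b.length = 0 then 0 else act 𝒱 α X (fun S w' => F (T + (S + (b.length - 1)))
          (tw 𝒱 α (S + (b.length - 1)) (x.1 + deg X) (tw 𝒱 α T d u) ++
            (α ^ S) (x.2 (tw 𝒱 α 0 (deg X) (tw 𝒱 α T d b))) :: tw 𝒱 α (b.length - 1) 0 w')) w₁)
          w) r) v =
        split (fun X₁ X₂ => (d * deg X₂).negOnePow • act 𝒱 α (x :: X₁ ++ (d, y) :: X₂) F v) X +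
        splitAt (fun X₁ z X₂ => (d * deg X₂).negOnePow •
          act 𝒱 α (x :: X₁ ++ (z.1 + d, act 𝒱 α [(d, y)] (fun _ => z.2)) :: X₂) F v) X := by
      let F' : List V → List V → ℕ → List V → M := fun u b R w' => F (R + (b.length - 1))
        (tw 𝒱 α (R + (b.length - 1)) (x.1 + (d + deg X)) u ++
          (α ^ R) (x.2 (tw 𝒱 α 0 (d + deg X) b)) :: tw 𝒱 α (b.length - 1) 0 w')
      have h : ∀ (u b w : List V), act 𝒱 α [(d, y)] (fun T w₁ =>
          act 𝒱 α X (fun S w' => F (T + (S + (b.length - 1)))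
          (tw 𝒱 α (S + (b.length - 1)) (x.1 + deg X) (tw 𝒱 α T d u) ++
            (α ^ S) (x.2 (tw 𝒱 α 0 (deg X) (tw 𝒱 α T d b))) :: tw 𝒱 α (b.length - 1) 0 w')) w₁) w =
          split (fun X₁ X₂ => (d * deg X₂).negOnePow • act 𝒱 α (X₁ ++ (d, y) :: X₂) (F' u b) w) X +
          splitAt (fun X₁ z X₂ => (d * deg X₂).negOnePow •
            act 𝒱 α (X₁ ++ (z.1 + d, act 𝒱 α [(d, y)] (fun _ => z.2)) :: X₂) (F' u b) w) X := by
        intro u b w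
        refine Eq.trans ?_ (ih hX.2 (fun T => isMultilinear_act_step hF _ _ _ _ _) w)
        congr 1
        funext T w₁
        congr 1
        funext S w'
        have hx : (α ^ S) (x.2 (tw 𝒱 α 0 (deg X) (tw 𝒱 α T d b))) =
            (α ^ (T + S)) (x.2 (tw 𝒱 α 0 (d + deg X) b)) := by
          rw [tw_tw 𝒱 hα, add_comm T S, pow_add, Module.End.mul_apply]
          congr 1
          have := coder_tw hX.1 T 0 (tw 𝒱 α 0 (d + deg X) b)
          rw [mul_zero, Int.negOnePow_zero, one_smul, twl_zero_right, tw_tw 𝒱 hα] at this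
          rw [← this]
          simp only [add_zero, add_comm]
        rw [hx]
        simp only [tw_tw 𝒱 hα, add_comm, add_left_comm, add_assoc]
      simp only [act_ite_const, h, F']
      simp only [ite_zero_add, split_add, ite_split, ite_splitAt, List.cons_append,
        act_cons _ _ x, units_smul_split]
      congr 1
      · refine ((split_congr fun u r _ => split_comm _ _ _).trans (split_comm _ _ _)).trans ?_
        refine split_congr fun X₁ X₂ hX' => split_congr fun u r _ => split_congr fun b w _ => ?_
        subst hX'
        rw [smul_ite, smul_zero]
        simp only [deg_append, deg_cons, add_left_comm]
      · refine ((split_congr fun u r _ => split_splitAt_comm _ _ _).trans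
          (split_splitAt_comm _ _ _)).trans ?_
        refine splitAt_congr fun X₁ z X₂ hX' => split_congr fun u r _ => split_congr fun b w _ => ?_
        subst hX'
        rw [smul_ite, smul_zero]
        simp only [deg_append, deg_cons, add_left_comm, add_assoc, add_comm]
    have hx : ∀ T w, act 𝒱 α (x :: X) (fun S => F (T + S)) w = split (fun u r => split (fun b w =>
        if b.length = 0 then 0 else act 𝒱 α X (fun S w' => F (T + (S + (b.length - 1)))
          (tw 𝒱 α (S + (b.length - 1)) (x.1 + deg X) u ++ (α ^ S) (x.2 (tw 𝒱 α 0 (deg X) b)) ::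
            tw 𝒱 α (b.length - 1) 0 w')) w) r) w := fun T w => rfl
    simp only [hx]
    -- A one-element list has only two decompositions: `y` goes to the left or to the right of a
    -- cut. Cutting at both ends of the block of `x` gives the three cases.
    rw [act_split hα]
    simp only [split_cons, split_nil, act_nil, splitAt, zero_add, add_zero, tw_zero, deg_nil,
      deg_cons]
    rw [hB]
    simp only [act_split hα, split_cons, split_nil, act_nil, split_add]
    simp only [deg_cons, deg_nil, add_zero, zero_add, tw_tw 𝒱 hα, length_tw, tw_zero] at hA hC ⊢
    rw [hA, hC]
    simp only [List.nil_append, List.cons_append]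
    abel

end BraceRelations

/-! ### Braces and coderivations expressed by insertions. -/

section BraceAct

variable {K : Type*} [Field K] {V : Type*} [AddCommGroup V] [Module K V]
  {𝒱 : ℤ → Submodule K V} [DirectSum.Decomposition 𝒱] {α : V →ₗ[K] V}

lemma sum_blocks_eq_split {X M : Type*} [AddCommMonoid M] (Φ : List X → List X → List X → M)
    (v : List X) : ∑ i ∈ Finset.range v.length, ∑ m ∈ Finset.Icc 1 (v.length - i),
      Φ (v.take i) ((v.drop i).take m) (v.drop (i + m)) =
    split (fun u r => split (fun b w => if b.length = 0 then 0 else Φ u b w) r) v := by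
  simp only [split_ite_length]
  rw [split, Finset.sum_range_succ, List.drop_length, List.length_nil]
  simp [List.drop_drop]

lemma insertSum_cons (T : ℕ) (x : ℤ × (List V → V)) (X : List (ℤ × (List V → V)))
    (F : List V → V) (v : List V) : insertSum 𝒱 α T (x :: X) F v =
      split (fun u r => split (fun b w => if b.length = 0 then 0 else insertSum 𝒱 α T X
        (fun w => F (tw 𝒱 α T (x.1 + deg X) u ++
          (α ^ (T + 1 - b.length)) (x.2 (tw 𝒱 α 0 (deg X) b)) :: w)) w) r) v := by
  rw [← sum_blocks_eq_split, insertSum]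
  refine Finset.sum_congr rfl fun i _ => Finset.sum_congr rfl fun m hm => ?_
  rw [Finset.mem_Icc] at hm
  have : ((v.drop i).take m).length = m := by simp; omega
  rw [this, tw, tw, twl_zero_left]
  rfl

lemma insertSum_congr (T : ℕ) {X : List (ℤ × (List V → V))} {F G : List V → V} {v : List V}
    (h : ∀ w, w.length ≤ v.length → F w = G w) :
    insertSum 𝒱 α T X F v = insertSum 𝒱 α T X G v := by
  induction X generalizing F G v with
  | nil => exact h _ (by simp)
  | cons x X ih =>
    rw [insertSum_cons, insertSum_cons]
    refine split_congr fun u r hv => split_congr fun b w hr => ?_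
    subst hr hv
    split_ifs with hb
    · rfl
    · refine ih fun w' hw => h _ ?_
      simp only [List.length_append, length_tw, List.length_cons]
      omega

lemma insertSum_zero (T : ℕ) (X : List (ℤ × (List V → V))) (v : List V) :
    insertSum 𝒱 α T X (fun _ => 0) v = 0 := by
  simpa using insertSum_smul 𝒱 α T X (0 : K) (fun _ => 0) v

/-- `insertSum` fixes the total excess in advance while `act` accumulates it. The extra twist `c`
makes the induction work: it records the excess already used up by the blocks to the left. -/
lemma insertSum_eq_act (hα : ∀ i, ∀ a ∈ 𝒱 i, α a ∈ 𝒱 i) (T c : ℕ) (X : List (ℤ × (List V → V)))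
    (G : List V → V) (v : List V) :
    insertSum 𝒱 α (T + c) X (fun w => if w.length + T = v.length then G w else 0) v =
      act 𝒱 α X (fun S w => if S = T then G (tw 𝒱 α c 0 w) else 0) v := by
  induction X generalizing T c G v with
  | nil =>
    rcases Nat.eq_zero_or_pos T with rfl | hT
    · simp [insertSum, tw, twl_zero_right]
    · rw [insertSum, act_nil, if_neg (by simp; omega), if_neg (by omega)]
  | cons x X ih =>
    rw [insertSum_cons, act_cons]
    refine split_congr fun u r hv => split_congr fun b w hr => ?_
    subst hr hv
    refine ite_congr rfl (fun _ => rfl) fun hb => ?_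
    by_cases hT : b.length - 1 ≤ T
    · obtain ⟨S, rfl⟩ := Nat.exists_eq_add_of_le' hT
      have := ih S (b.length - 1 + c) (fun w' =>
        G (tw 𝒱 α (S + (b.length - 1) + c) (x.1 + deg X) u ++
          (α ^ (S + (b.length - 1) + c + 1 - b.length)) (x.2 (tw 𝒱 α 0 (deg X) b)) :: w')) w
      rw [← add_assoc] at this
      refine Eq.trans ?_ (this.trans ?_)
      · congr 1
        funext w'
        refine if_congr ?_ rfl rfl
        simp only [List.length_append, length_tw, List.length_cons]
        omega
      · refine act_congr 𝒱 α fun T w' _ _ => ?_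
        refine ite_congr (by simp) (fun h => ?_) fun _ => rfl
        obtain rfl : T = S := by omega
        rw [show T + (b.length - 1) + c + 1 - b.length = c + T by omega]
        simp only [tw_append, tw_cons, tw_tw 𝒱 hα, twl_zero_right, zero_add, add_zero, pow_add,
          Module.End.mul_apply]
        simp only [add_comm]
    -- A block whose excess alone is larger than `T` contributes nothing: the guards on both sides
    -- fail.
    · rw [insertSum_congr (G := fun _ => 0), insertSum_zero]
      · refine ((act_congr 𝒱 α fun S w' _ _ => if_neg ?_).trans (act_zero 𝒱 α X w)).symm
        omega
      · intro w' hw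
        rw [if_neg]
        simp only [List.length_append, length_tw, List.length_cons]
        omega

/-- An insertion determines its excess, so exactly one value of `T` contributes to each term and the
sum over `T` collapses. -/
lemma brace_eq_act (hα : ∀ i, ∀ a ∈ 𝒱 i, α a ∈ 𝒱 i) (f : List V → V)
    (X : List (ℤ × (List V → V))) : brace 𝒱 α f X = act 𝒱 α X (fun _ => f) := by
  funext v
  have h := fun T => insertSum_eq_act hα T 0 X f v
  simp only [add_zero, tw_zero] at h
  simp only [brace, h, ← act_sum]
  refine act_congr 𝒱 α fun T w hT _ => ?_
  rw [Finset.sum_ite_eq, if_pos]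
  simp; omega

lemma brace_nil (hα : ∀ i, ∀ a ∈ 𝒱 i, α a ∈ 𝒱 i) (f : List V → V) : brace 𝒱 α f [] = f := by
  rw [brace_eq_act hα]; rfl

lemma forall₂_append_split {A B : Type*} {R : A → B → Prop} {u w : List A} {e : List B}
    (h : List.Forall₂ R (u ++ w) e) :
    ∃ e₁ e₂, e = e₁ ++ e₂ ∧ List.Forall₂ R u e₁ ∧ List.Forall₂ R w e₂ := by
  induction u generalizing e with
  | nil => exact ⟨[], e, rfl, .nil, h⟩
  | cons a u ih =>
    rcases h with _ | ⟨ha, h⟩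
    obtain ⟨e₁, e₂, rfl, h₁, h₂⟩ := ih h
    exact ⟨_ :: e₁, e₂, rfl, .cons ha h₁, h₂⟩

lemma forall₂_tw (hα : ∀ i, ∀ a ∈ 𝒱 i, α a ∈ 𝒱 i) (n : ℕ) (d : ℤ) {v : List V} {e : List ℤ}
    (h : List.Forall₂ (fun a i => a ∈ 𝒱 i) v e) :
    List.Forall₂ (fun a i => a ∈ 𝒱 i) (tw 𝒱 α n d v) e := by
  induction h with
  | nil => exact .nil
  | cons ha _ ih => exact .cons (twl_mem 𝒱 hα n d _ ha) ih

/-- An insertion raises the total degree of a homogeneous word by `deg X`. The target is an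
arbitrary additive submonoid, so that it can be a graded piece. -/
lemma act_mem (hα : ∀ i, ∀ a ∈ 𝒱 i, α a ∈ 𝒱 i) {X : List (ℤ × (List V → V))}
    (hX : IsCoders 𝒱 α X) {M S : Type*} [AddCommMonoid M] [SetLike S M] [AddSubmonoidClass S M]
    {N : S} {F : ℕ → List V → M} {v : List V} {e : List ℤ}
    (hv : List.Forall₂ (fun a i => a ∈ 𝒱 i) v e)
    (h : ∀ T w e', List.Forall₂ (fun a i => a ∈ 𝒱 i) w e' → e'.sum = e.sum + deg X → F T w ∈ N) :
    act 𝒱 α X F v ∈ N := by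
  induction X generalizing F v e with
  | nil => exact h 0 v e hv (by simp)
  | cons x X ih =>
    rw [isCoders_cons] at hX
    rw [act_cons]
    refine split_mem _ fun u r huv => split_mem _ fun b w hr => ?_
    subst hr huv
    obtain ⟨e₁, e₂, rfl, h₁, h₂⟩ := forall₂_append_split hv
    obtain ⟨e₂, e₃, rfl, h₂, h₃⟩ := forall₂_append_split h₂
    split_ifs
    · exact zero_mem _
    · refine ih hX.2 h₃ fun T w' e' hw he => ?_
      refine h _ _ (e₁ ++ (e₂.sum + x.1) :: e') ?_ ?_
      · exact List.rel_append (forall₂_tw hα _ _ h₁) (.cons (pow_map_mem 𝒱 hα _ _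
          (hX.1.2.2.1.mem 𝒱 (forall₂_tw hα _ _ h₂))) (forall₂_tw hα _ _ hw))
      · simp [he]; ring

lemma brace_mem (hα : ∀ i, ∀ a ∈ 𝒱 i, α a ∈ 𝒱 i) {X : List (ℤ × (List V → V))}
    (hX : IsCoders 𝒱 α X) {d : ℤ} {f : List V → V} (hf : f ∈ Coder 𝒱 α d) :
    brace 𝒱 α f X ∈ Coder 𝒱 α (d + deg X) := by
  rw [brace_eq_act hα]
  refine ⟨?_, isMultilinear_act (fun x hx => (hX x hx).2.1) fun _ => hf.2.1, ?_, fun v => ?_⟩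
  · cases X with
    | nil => exact hf.1
    | cons x X => simp [act_cons, split_nil]
  · refine HasDegree.of_list 𝒱 fun v e hv => ?_
    refine act_mem hα hX hv fun T w e' hw he => ?_
    have := hf.2.2.1.mem 𝒱 hw
    rwa [he, add_assoc, add_comm (deg X)] at this
  · have h1 : ∀ v : List V, v.map α = tw 𝒱 α 1 0 v := fun v => by
      rw [tw, twl_zero_right, pow_one]
    have := act_tw hα hX (F := fun _ => f) (fun _ => hf.2.1) 1 0 v
    rw [zero_mul, Int.negOnePow_zero, one_smul, ← h1] at this
    rw [← this, map_act]
    congr 1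
    funext T w
    rw [← h1, hf.2.2.2]

lemma act_slot_add (hα : ∀ i, ∀ a ∈ 𝒱 i, α a ∈ 𝒱 i) {M : Type*} [AddCommGroup M] [Module K M]
    {F : ℕ → List V → M} (hF : ∀ T, IsMultilinear K (F T)) (X₁ X₃ : List (ℤ × (List V → V)))
    (d : ℤ) (x y : List V → V) : act 𝒱 α (X₁ ++ (d, x + y) :: X₃) F =
      act 𝒱 α (X₁ ++ (d, x) :: X₃) F + act 𝒱 α (X₁ ++ (d, y) :: X₃) F := by
  funext v
  simp only [Pi.add_apply, act_append_cons hα, ← split_add, ← ite_zero_add, ← act_add, map_add,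
    (hF _).map_add]

lemma act_slot_smul (hα : ∀ i, ∀ a ∈ 𝒱 i, α a ∈ 𝒱 i) {M : Type*} [AddCommGroup M] [Module K M]
    {F : ℕ → List V → M} (hF : ∀ T, IsMultilinear K (F T)) (X₁ X₃ : List (ℤ × (List V → V)))
    (d : ℤ) (r : K) (x : List V → V) : act 𝒱 α (X₁ ++ (d, r • x) :: X₃) F =
      r • act 𝒱 α (X₁ ++ (d, x) :: X₃) F := by
  funext v
  simp only [Pi.smul_apply, act_append_cons hα, smul_split, smul_ite, smul_zero, ← act_smul,
    map_smul, (hF _).map_smul]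

/-- The action of a list of cochains is linear in each cochain. -/
def actSlot (hα : ∀ i, ∀ a ∈ 𝒱 i, α a ∈ 𝒱 i) {M : Type*} [AddCommGroup M] [Module K M]
    {F : ℕ → List V → M} (hF : ∀ T, IsMultilinear K (F T)) (X₁ X₃ : List (ℤ × (List V → V)))
    (d : ℤ) : (List V → V) →ₗ[K] (List V → M) where
  toFun x := act 𝒱 α (X₁ ++ (d, x) :: X₃) F
  map_add' := act_slot_add hα hF X₁ X₃ d
  map_smul' := act_slot_smul hα hF X₁ X₃ d

lemma actSlot_apply (hα : ∀ i, ∀ a ∈ 𝒱 i, α a ∈ 𝒱 i) {M : Type*} [AddCommGroup M] [Module K M]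
    {F : ℕ → List V → M} (hF : ∀ T, IsMultilinear K (F T)) (X₁ X₃ : List (ℤ × (List V → V)))
    (d : ℤ) (x : List V → V) :
    actSlot hα hF X₁ X₃ d x = act 𝒱 α (X₁ ++ (d, x) :: X₃) F := rfl

lemma split_apply {X Y M : Type*} [AddCommMonoid M] (Φ : List X → List X → Y → M) (l : List X)
    (y : Y) : split Φ l y = split (fun a b => Φ a b y) l := Finset.sum_apply _ _ _

lemma splitAt_apply {X Y M : Type*} [AddCommMonoid M] (Φ : List X → X → List X → Y → M)
    (l : List X) (y : Y) : splitAt Φ l y = splitAt (fun a x b => Φ a x b y) l := by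
  induction l generalizing Φ with
  | nil => rfl
  | cons x l ih => rw [splitAt, splitAt, Pi.add_apply, ih]

/-- The brace relation `{{f}{y}}{X} = ∑ ± {f}{X₁, {y}{X₂}, X₃}`. -/
lemma brace_brace_singleton (hα : ∀ i, ∀ a ∈ 𝒱 i, α a ∈ 𝒱 i) {X : List (ℤ × (List V → V))}
    (hX : IsCoders 𝒱 α X) {d : ℤ} {y : List V → V} (hy : y ∈ Coder 𝒱 α d)
    {f : List V → V} (hf : IsMultilinear K f) :
    brace 𝒱 α (brace 𝒱 α f [(d, y)]) X =
      split (fun X₁ R => split (fun X₂ X₃ => (d * deg X₁).negOnePow •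
        brace 𝒱 α f (X₁ ++ (d + deg X₂, brace 𝒱 α y X₂) :: X₃)) R) X := by
  funext v
  simp only [brace_eq_act hα, split_apply, Pi.smul_apply]
  exact act_act_singleton hα hX hy (F := fun _ => f) (fun _ => hf) v

/-- The brace relation `{{f}{X}}{y} = ∑ ± {f}{X₁, y, X₂} + ∑ ± {f}{X₁, {x}{y}, X₂}`. -/
lemma brace_singleton_brace (hα : ∀ i, ∀ a ∈ 𝒱 i, α a ∈ 𝒱 i) {X : List (ℤ × (List V → V))}
    (hX : IsCoders 𝒱 α X) {d : ℤ} {y : List V → V} (hy : y ∈ Coder 𝒱 α d)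
    {f : List V → V} (hf : IsMultilinear K f) :
    brace 𝒱 α (brace 𝒱 α f X) [(d, y)] =
      split (fun X₁ X₂ => (d * deg X₂).negOnePow • brace 𝒱 α f (X₁ ++ (d, y) :: X₂)) X +
      splitAt (fun X₁ x X₂ => (d * deg X₂).negOnePow •
        brace 𝒱 α f (X₁ ++ (x.1 + d, brace 𝒱 α x.2 [(d, y)]) :: X₂)) X := by
  funext v
  simp only [brace_eq_act hα, split_apply, splitAt_apply, Pi.smul_apply, Pi.add_apply]
  exact act_singleton_act hα hX hy (F := fun _ => f) (fun _ => hf) v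

/-- With the tautological functional `word K`, composition of endomorphisms of `TV` falls under the
same composition law as the braces. -/
lemma coderWord_eq_act (d : ℤ) (f : List V → V) :
    coderWord 𝒱 α d f = act 𝒱 α [(d, f)] (fun _ => word K) := by
  funext v
  rw [act_cons]
  simp only [act_nil, deg_nil, tw_zero, zero_add, add_zero, pow_zero, Module.End.one_apply]
  rw [← sum_blocks_eq_split, coderWord]
  refine Finset.sum_congr rfl fun i _ => Finset.sum_congr rfl fun m hm => ?_
  rw [Finset.mem_Icc] at hm
  have : ((v.drop i).take m).length = m := by simp; omega
  rw [this, coderTerm, tw, tw, twl_zero_right]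
  rfl

lemma TV_ext {W : Type*} [AddCommGroup W] [Module K W] {f g : TV K V →ₗ[K] W}
    (h : ∀ v : List V, f (word K v) = g (word K v)) : f = g := by
  refine DirectSum.linearMap_ext K fun n => PiTensorProduct.ext (MultilinearMap.ext fun v => ?_)
  have := h (List.ofFn v)
  rw [word_ofFn] at this
  exact this

lemma coderLift_word (d : ℤ) (f : Coder 𝒱 α d) (v : List V) :
    coderLift 𝒱 α d f (word K v) = act 𝒱 α [(d, f.1)] (fun _ => word K) v := by
  rw [coderLift, linearize_word, coderWord_eq_act]

/-- The block of `f` either contains the value of `g`, which gives the coderivation of `{f}{g}`, or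
avoids it on the left or on the right. The last two terms are symmetric in `f` and `g` up to
`(-1)^{de}` and disappear from the graded commutator. -/
lemma coderLift_comp_word (hα : ∀ i, ∀ a ∈ 𝒱 i, α a ∈ 𝒱 i) {d e : ℤ} (f : Coder 𝒱 α d)
    (g : Coder 𝒱 α e) (v : List V) :
    coderLift 𝒱 α d f (coderLift 𝒱 α e g (word K v)) =
      act 𝒱 α [(d + e, brace 𝒱 α f.1 [(e, g.1)])] (fun _ => word K) v +
      act 𝒱 α [(d, f.1), (e, g.1)] (fun _ => word K) v +
      (d * e).negOnePow • act 𝒱 α [(e, g.1), (d, f.1)] (fun _ => word K) v := by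
  have h := act_act_singleton hα (X := [(e, g.1)]) (isCoders_cons.2 ⟨g.2, isCoders_nil⟩) f.2
    (F := fun _ => word K) (fun _ => isMultilinear_word K) v
  rw [coderLift_word, map_act]
  simp only [coderLift_word]
  rw [h]
  simp only [split_cons, split_nil, deg_nil, deg_cons, mul_zero, add_zero, Int.negOnePow_zero,
    one_smul, List.nil_append, brace_eq_act hα]
  rw [show act 𝒱 α [] (fun _ => f.1) = f.1 from rfl]
  simp only [List.cons_append, List.nil_append]
  abel

lemma isCoders_singleton {d : ℤ} {x : List V → V} (hx : x ∈ Coder 𝒱 α d) :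
    IsCoders 𝒱 α [(d, x)] := isCoders_cons.2 ⟨hx, isCoders_nil⟩

lemma bracket_mem (hα : ∀ i, ∀ a ∈ 𝒱 i, α a ∈ 𝒱 i) {d e : ℤ} {f g : List V → V}
    (hf : f ∈ Coder 𝒱 α d) (hg : g ∈ Coder 𝒱 α e) :
    bracket 𝒱 α d f e g ∈ Coder 𝒱 α (d + e) := by
  have h1 := brace_mem hα (isCoders_singleton hg) hf
  have h2 := brace_mem hα (isCoders_singleton hf) hg
  simp only [deg_cons, deg_nil, add_zero] at h1 h2
  rw [add_comm] at h2
  exact Submodule.sub_mem _ h1 (Submodule.smul_of_tower_mem _ _ h2)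

/-- The bracket of coderivations is their graded commutator. -/
lemma coderLift_bracket (hα : ∀ i, ∀ a ∈ 𝒱 i, α a ∈ 𝒱 i) {d e : ℤ} (f : Coder 𝒱 α d)
    (g : Coder 𝒱 α e) (h : bracket 𝒱 α d f.1 e g.1 ∈ Coder 𝒱 α (d + e)) :
    coderLift 𝒱 α (d + e) ⟨bracket 𝒱 α d f.1 e g.1, h⟩ =
      coderLift 𝒱 α d f ∘ₗ coderLift 𝒱 α e g -
        (d * e).negOnePow • (coderLift 𝒱 α e g ∘ₗ coderLift 𝒱 α d f) := by
  refine TV_ext fun v => ?_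
  rw [LinearMap.sub_apply, LinearMap.smul_apply, LinearMap.comp_apply, LinearMap.comp_apply,
    coderLift_comp_word hα, coderLift_comp_word hα, coderLift_word]
  change act 𝒱 α [(d + e, brace 𝒱 α f.1 [(e, g.1)] -
    (d * e).negOnePow • brace 𝒱 α g.1 [(d, f.1)])] _ v = _
  have hw : ∀ _ : ℕ, IsMultilinear K (word K (V := V)) := fun _ => isMultilinear_word K
  have h1 := actSlot_apply hα hw [] [] (d + e)
  simp only [List.nil_append] at h1
  rw [← h1, map_sub, LinearMap.map_smul_of_tower, h1, h1, Pi.sub_apply,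
    Pi.smul_apply, add_comm e d, mul_comm e d, smul_add, smul_add, smul_smul,
    ← Int.negOnePow_add, ← two_mul, Int.negOnePow_two_mul, one_smul]
  abel

end BraceAct

/-! ### Decompositions with an empty or a one-letter factor. -/

section SplitIndicator

variable {X M : Type*}

lemma split_ite_add [AddCommMonoid M] (Φ : List X → List X → M) (v : List X) :
    split Φ v = Φ [] v + split (fun b w => if b.length = 0 then 0 else Φ b w) v := by
  cases v with
  | nil => simp [split_nil]
  | cons a v => simp [split_cons]

lemma split_left_nil [AddCommMonoid M] (Φ : List X → M) (v : List X) :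
    split (fun u w => if u = [] then Φ w else 0) v = Φ v := by
  cases v with
  | nil => simp [split_nil]
  | cons a v => simp [split_cons, split_zero]

lemma split_right_nil [AddCommMonoid M] (Φ : List X → M) (v : List X) :
    split (fun u w => if w = [] then Φ u else 0) v = Φ v := by
  induction v generalizing Φ with
  | nil => simp [split_nil]
  | cons a v ih => simp [split_cons, ih]

/-- The value at `x` on a one-letter word `[x]`, and zero on all other words. -/
def onSingle [Zero M] (h : X → M) : List X → M
  | [x] => h x
  | _ => 0

lemma onSingle_singleton [Zero M] (h : X → M) (x : X) : onSingle h [x] = h x := rfl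

lemma onSingle_cons_cons [Zero M] (h : X → M) (x y : X) (l : List X) :
    onSingle h (x :: y :: l) = 0 := rfl

lemma split_onSingle [AddCommMonoid M] (Φ : List X → X → List X → M) (v : List X) :
    split (fun u r => split (fun b w => onSingle (fun x => Φ u x w) b) r) v = splitAt Φ v := by
  induction v generalizing Φ with
  | nil => simp [split_nil, onSingle, splitAt]
  | cons a v ih =>
    have h : split (fun b w => onSingle (fun x => Φ [] x w) b) (a :: v) = Φ [] a v := by
      cases v <;> simp [split_cons, split_nil, onSingle, split_zero]
    rw [split_cons, splitAt, ih, h]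

end SplitIndicator

lemma split_sub {X M : Type*} [AddCommGroup M] (Φ Ψ : List X → List X → M) (v : List X) :
    split (fun u w => Φ u w - Ψ u w) v = split Φ v - split Ψ v := Finset.sum_sub_distrib _ _

/-! ### Pre-Lie, Jacobi and homotopy identities. -/

section Identities

variable {K : Type*} [Field K] {V : Type*} [AddCommGroup V] [Module K V]
  {𝒱 : ℤ → Submodule K V} [DirectSum.Decomposition 𝒱] {α : V →ₗ[K] V}

lemma brace_sub_left (f g : List V → V) (X : List (ℤ × (List V → V))) :
    brace 𝒱 α (f - g) X = brace 𝒱 α f X - brace 𝒱 α g X := by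
  rw [sub_eq_add_neg, brace_add_left, ← neg_one_smul K g, brace_smul_left, neg_one_smul,
    sub_eq_add_neg]

lemma brace_units_left (s : ℤˣ) (f : List V → V) (X : List (ℤ × (List V → V))) :
    brace 𝒱 α (s • f) X = s • brace 𝒱 α f X := by
  have := brace_smul_left 𝒱 α ((s : ℤ) : K) f X
  simpa only [Int.cast_smul_eq_zsmul, ← Units.smul_def] using this

lemma brace_slot_sub (hα : ∀ i, ∀ a ∈ 𝒱 i, α a ∈ 𝒱 i) {f : List V → V} (hf : IsMultilinear K f)
    (X₁ X₃ : List (ℤ × (List V → V))) (d : ℤ) (x y : List V → V) :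
    brace 𝒱 α f (X₁ ++ (d, x - y) :: X₃) =
      brace 𝒱 α f (X₁ ++ (d, x) :: X₃) - brace 𝒱 α f (X₁ ++ (d, y) :: X₃) := by
  simp only [brace_eq_act hα, ← actSlot_apply hα (F := fun _ => f) (fun _ => hf), map_sub]

lemma brace_slot_units (hα : ∀ i, ∀ a ∈ 𝒱 i, α a ∈ 𝒱 i) {f : List V → V} (hf : IsMultilinear K f)
    (X₁ X₃ : List (ℤ × (List V → V))) (d : ℤ) (s : ℤˣ) (x : List V → V) :
    brace 𝒱 α f (X₁ ++ (d, s • x) :: X₃) = s • brace 𝒱 α f (X₁ ++ (d, x) :: X₃) := by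
  simp only [brace_eq_act hα, ← actSlot_apply hα (F := fun _ => f) (fun _ => hf),
    LinearMap.map_smul_of_tower]

lemma brace_slot_zero (hα : ∀ i, ∀ a ∈ 𝒱 i, α a ∈ 𝒱 i) {f : List V → V} (hf : IsMultilinear K f)
    (X₁ X₃ : List (ℤ × (List V → V))) (d : ℤ) : brace 𝒱 α f (X₁ ++ (d, 0) :: X₃) = 0 := by
  simp only [brace_eq_act hα, ← actSlot_apply hα (F := fun _ => f) (fun _ => hf), map_zero]

lemma brace_singleton_mem (hα : ∀ i, ∀ a ∈ 𝒱 i, α a ∈ 𝒱 i) {d e : ℤ} {f g : List V → V}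
    (hf : f ∈ Coder 𝒱 α d) (hg : g ∈ Coder 𝒱 α e) : brace 𝒱 α f [(e, g)] ∈ Coder 𝒱 α (d + e) := by
  simpa using brace_mem hα (isCoders_singleton hg) hf

lemma brace_pair_mem (hα : ∀ i, ∀ a ∈ 𝒱 i, α a ∈ 𝒱 i) {d e g : ℤ} {f x y : List V → V}
    (hf : f ∈ Coder 𝒱 α d) (hx : x ∈ Coder 𝒱 α e) (hy : y ∈ Coder 𝒱 α g) :
    brace 𝒱 α f [(e, x), (g, y)] ∈ Coder 𝒱 α (d + e + g) := by
  have := brace_mem (X := [(e, x), (g, y)]) hα (isCoders_cons.2 ⟨hx, isCoders_singleton hy⟩) hf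
  simpa [add_assoc] using this

/-- The pre-Lie relation. -/
lemma brace_pre_lie (hα : ∀ i, ∀ a ∈ 𝒱 i, α a ∈ 𝒱 i) {d e : ℤ} {f y z : List V → V}
    (hf : IsMultilinear K f) (hy : y ∈ Coder 𝒱 α d) (hz : z ∈ Coder 𝒱 α e) :
    brace 𝒱 α (brace 𝒱 α f [(d, y)]) [(e, z)] =
      brace 𝒱 α f [(d + e, brace 𝒱 α y [(e, z)])] + brace 𝒱 α f [(d, y), (e, z)] +
        (d * e).negOnePow • brace 𝒱 α f [(e, z), (d, y)] := by
  rw [brace_brace_singleton hα (isCoders_singleton hz) hy hf]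
  simp only [split_cons, split_nil, deg_nil, deg_cons, mul_zero, add_zero, Int.negOnePow_zero,
    one_smul, List.nil_append, List.cons_append, brace_nil hα]
  abel

/-- The brace relation `{{f}{y}}{z₁, z₂}`. -/
lemma brace_brace_pair (hα : ∀ i, ∀ a ∈ 𝒱 i, α a ∈ 𝒱 i) {d e g : ℤ} {f y z₁ z₂ : List V → V}
    (hf : IsMultilinear K f) (hy : y ∈ Coder 𝒱 α d) (h₁ : z₁ ∈ Coder 𝒱 α e)
    (h₂ : z₂ ∈ Coder 𝒱 α g) :
    brace 𝒱 α (brace 𝒱 α f [(d, y)]) [(e, z₁), (g, z₂)] =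
      brace 𝒱 α f [(d, y), (e, z₁), (g, z₂)] +
      (d * e).negOnePow • brace 𝒱 α f [(e, z₁), (d, y), (g, z₂)] +
      (d * (e + g)).negOnePow • brace 𝒱 α f [(e, z₁), (g, z₂), (d, y)] +
      brace 𝒱 α f [(d + e, brace 𝒱 α y [(e, z₁)]), (g, z₂)] +
      (d * e).negOnePow • brace 𝒱 α f [(e, z₁), (d + g, brace 𝒱 α y [(g, z₂)])] +
      brace 𝒱 α f [(d + (e + g), brace 𝒱 α y [(e, z₁), (g, z₂)])] := by
  rw [brace_brace_singleton hα (X := [(e, z₁), (g, z₂)])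
    (isCoders_cons.2 ⟨h₁, isCoders_singleton h₂⟩) hy hf]
  simp only [split_cons, split_nil, deg_nil, deg_cons, mul_zero, add_zero, Int.negOnePow_zero,
    one_smul, List.nil_append, List.cons_append, brace_nil hα]
  abel

/-- The brace relation `{{f}{z₁, z₂}}{y}`. -/
lemma brace_pair_brace (hα : ∀ i, ∀ a ∈ 𝒱 i, α a ∈ 𝒱 i) {d e g : ℤ} {f y z₁ z₂ : List V → V}
    (hf : IsMultilinear K f) (hy : y ∈ Coder 𝒱 α d) (h₁ : z₁ ∈ Coder 𝒱 α e)
    (h₂ : z₂ ∈ Coder 𝒱 α g) :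
    brace 𝒱 α (brace 𝒱 α f [(e, z₁), (g, z₂)]) [(d, y)] =
      (d * (e + g)).negOnePow • brace 𝒱 α f [(d, y), (e, z₁), (g, z₂)] +
      (d * g).negOnePow • brace 𝒱 α f [(e, z₁), (d, y), (g, z₂)] +
      brace 𝒱 α f [(e, z₁), (g, z₂), (d, y)] +
      (d * g).negOnePow • brace 𝒱 α f [(e + d, brace 𝒱 α z₁ [(d, y)]), (g, z₂)] +
      brace 𝒱 α f [(e, z₁), (g + d, brace 𝒱 α z₂ [(d, y)])] := by
  rw [brace_singleton_brace hα (X := [(e, z₁), (g, z₂)])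
    (isCoders_cons.2 ⟨h₁, isCoders_singleton h₂⟩) hy hf]
  simp only [split_cons, split_nil, splitAt, deg_nil, deg_cons, mul_zero, add_zero,
    Int.negOnePow_zero, one_smul, List.nil_append, List.cons_append]
  abel

lemma bracket_skew (d e : ℤ) (x y : List V → V) :
    bracket 𝒱 α d x e y = -((d * e).negOnePow • bracket 𝒱 α e y d x) := by
  rw [bracket, bracket, smul_sub, smul_smul, mul_comm e d, ← Int.negOnePow_add, ← two_mul,
    Int.negOnePow_two_mul, one_smul]
  abel

/-- The Jacobi identity for the bracket of coderivations. -/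
lemma bracket_jacobi (hα : ∀ i, ∀ a ∈ 𝒱 i, α a ∈ 𝒱 i) {d e g : ℤ} {x y z : List V → V}
    (hx : x ∈ Coder 𝒱 α d) (hy : y ∈ Coder 𝒱 α e) (hz : z ∈ Coder 𝒱 α g) :
    bracket 𝒱 α d x (e + g) (bracket 𝒱 α e y g z) =
      bracket 𝒱 α (d + e) (bracket 𝒱 α d x e y) g z +
        (d * e).negOnePow • bracket 𝒱 α e y (d + g) (bracket 𝒱 α d x g z) := by
  have sub := fun {f} (hf : IsMultilinear K f) => brace_slot_sub hα hf [] []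
  have uni := fun {f} (hf : IsMultilinear K f) => brace_slot_units hα hf [] []
  simp only [List.nil_append] at sub uni
  simp only [bracket, sub hx.2.1, sub hy.2.1, sub hz.2.1, uni hx.2.1, uni hy.2.1, uni hz.2.1,
    brace_sub_left, brace_units_left, brace_pre_lie hα hx.2.1 hy hz,
    brace_pre_lie hα hx.2.1 hz hy, brace_pre_lie hα hy.2.1 hx hz, brace_pre_lie hα hy.2.1 hz hx,
    brace_pre_lie hα hz.2.1 hx hy, brace_pre_lie hα hz.2.1 hy hx, mul_add, add_mul,
    Int.negOnePow_add, mul_comm e d, mul_comm g d, mul_comm g e, add_comm e d, add_comm g d,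
    add_comm g e]
  -- All signs are products of these three. In each of the eight cases the identity is additive: the
  -- pair braces `{x}{y, z}` and their permutations cancel.
  rcases Int.units_eq_one_or (d * e).negOnePow with h1 | h1 <;>
  rcases Int.units_eq_one_or (d * g).negOnePow with h2 | h2 <;>
  rcases Int.units_eq_one_or (e * g).negOnePow with h3 | h3 <;>
  simp only [h1, h2, h3, one_smul, Units.neg_smul, smul_add, smul_sub, smul_neg, mul_one, mul_neg,
    neg_neg] <;> abel

/-! ### The operations attached to an element `D` of degree `-1`. -/

section SquareZero

variable {D : List V → V}

lemma negOnePow_neg_one_mul (d : ℤ) : (-1 * d).negOnePow = d.negOnePow := by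
  rw [neg_one_mul, Int.negOnePow_neg]

/-- `{x}{y}` is a homotopy for the commutativity of the product. -/
lemma bracket_brace (hα : ∀ i, ∀ a ∈ 𝒱 i, α a ∈ 𝒱 i) (hD : D ∈ Coder 𝒱 α (-1)) {d e : ℤ}
    {x y : List V → V} (hx : x ∈ Coder 𝒱 α d) (hy : y ∈ Coder 𝒱 α e) :
    bracket 𝒱 α (-1) D (d + e) (brace 𝒱 α x [(e, y)]) =
      brace 𝒱 α (bracket 𝒱 α (-1) D d x) [(e, y)] +
      d.negOnePow • brace 𝒱 α x [(-1 + e, bracket 𝒱 α (-1) D e y)] -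
      brace 𝒱 α D [(d, x), (e, y)] - (d * e).negOnePow • brace 𝒱 α D [(e, y), (d, x)] := by
  have sub := fun {f} (hf : IsMultilinear K f) => brace_slot_sub hα hf [] []
  have uni := fun {f} (hf : IsMultilinear K f) => brace_slot_units hα hf [] []
  simp only [List.nil_append] at sub uni
  simp only [bracket, sub hx.2.1, uni hx.2.1, brace_sub_left, brace_units_left,
    brace_pre_lie hα hD.2.1 hx hy, brace_pre_lie hα hx.2.1 hy hD, brace_pre_lie hα hx.2.1 hD hy,
    mul_comm e (-1), negOnePow_neg_one_mul, Int.negOnePow_add, add_comm e (-1)]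
  rcases Int.units_eq_one_or (d * e).negOnePow with h1 | h1 <;>
  rcases Int.units_eq_one_or d.negOnePow with h2 | h2 <;>
  rcases Int.units_eq_one_or e.negOnePow with h3 | h3 <;>
  simp only [h1, h2, h3, one_smul, Units.neg_smul, smul_add, smul_sub, smul_neg, mul_one, mul_neg,
    neg_neg] <;> abel

/-- `{x}{y, z}` is a homotopy for the Leibniz rule. -/
lemma bracket_brace_pair (hα : ∀ i, ∀ a ∈ 𝒱 i, α a ∈ 𝒱 i) (hD : D ∈ Coder 𝒱 α (-1)) {d e g : ℤ}
    {x y z : List V → V} (hx : x ∈ Coder 𝒱 α d) (hy : y ∈ Coder 𝒱 α e) (hz : z ∈ Coder 𝒱 α g) :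
    bracket 𝒱 α (-1) D (d + (e + g)) (brace 𝒱 α x [(e, y), (g, z)]) =
      brace 𝒱 α (bracket 𝒱 α (-1) D d x) [(e, y), (g, z)] +
      d.negOnePow • brace 𝒱 α x [(-1 + e, bracket 𝒱 α (-1) D e y), (g, z)] +
      (d + e).negOnePow • brace 𝒱 α x [(e, y), (-1 + g, bracket 𝒱 α (-1) D g z)] +
      d.negOnePow • bracket 𝒱 α d x (-1 + (e + g)) (brace 𝒱 α D [(e, y), (g, z)]) -
      brace 𝒱 α D [(d + e, bracket 𝒱 α d x e y), (g, z)] -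
      (d * e).negOnePow • brace 𝒱 α D [(e, y), (d + g, bracket 𝒱 α d x g z)] := by
  have sub := fun {f} (hf : IsMultilinear K f) => brace_slot_sub hα hf [] [(g, z)]
  have uni := fun {f} (hf : IsMultilinear K f) => brace_slot_units hα hf [] [(g, z)]
  have sub' := fun {f} (hf : IsMultilinear K f) => brace_slot_sub hα hf [(e, y)] []
  have uni' := fun {f} (hf : IsMultilinear K f) => brace_slot_units hα hf [(e, y)] []
  simp only [List.nil_append, List.cons_append] at sub uni sub' uni'
  simp only [bracket, sub hx.2.1, uni hx.2.1, sub' hx.2.1, uni' hx.2.1, sub hD.2.1, uni hD.2.1,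
    sub' hD.2.1, uni' hD.2.1, brace_sub_left, brace_units_left,
    brace_brace_pair hα hD.2.1 hx hy hz, brace_pair_brace hα hD.2.1 hx hy hz,
    brace_brace_pair hα hx.2.1 hD hy hz, brace_pair_brace hα hx.2.1 hD hy hz, mul_add,
    mul_neg, mul_one, Int.negOnePow_neg,
    neg_one_mul, Int.negOnePow_add, add_comm e (-1), add_comm g (-1),
    add_comm e d, add_comm g d]
  rcases Int.units_eq_one_or (d * e).negOnePow with h1 | h1 <;>
  rcases Int.units_eq_one_or (d * g).negOnePow with h2 | h2 <;>
  rcases Int.units_eq_one_or d.negOnePow with h3 | h3 <;>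
  rcases Int.units_eq_one_or e.negOnePow with h4 | h4 <;>
  rcases Int.units_eq_one_or g.negOnePow with h5 | h5 <;>
  simp only [h1, h2, h3, h4, h5, one_smul, Units.neg_smul, smul_add, smul_sub, smul_neg, mul_one,
    mul_neg, neg_neg] <;> abel

variable (𝒱 α D) in
/-- The operations `{D}{x₁, …, x_k}`, with `{D}{x}` replaced by `[D, x]`. -/
def psi (X : List (ℤ × (List V → V))) : List V → V :=
  brace 𝒱 α D X - onSingle (fun x => x.1.negOnePow • brace 𝒱 α x.2 [(-1, D)]) X

lemma psi_singleton (d : ℤ) (x : List V → V) :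
    psi 𝒱 α D [(d, x)] = bracket 𝒱 α (-1) D d x := by
  rw [psi, onSingle_singleton, bracket, negOnePow_neg_one_mul]

lemma psi_cons_cons (x y : ℤ × (List V → V)) (X : List (ℤ × (List V → V))) :
    psi 𝒱 α D (x :: y :: X) = brace 𝒱 α D (x :: y :: X) := sub_zero _

/-- In the pre-Lie relation the term `{x}{{D}{D}}` is zero, and since `D` has odd degree the two
copies of `{x}{D, D}` have opposite signs. -/
lemma brace_brace_self (hα : ∀ i, ∀ a ∈ 𝒱 i, α a ∈ 𝒱 i) (hD : D ∈ Coder 𝒱 α (-1))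
    (hDD : brace 𝒱 α D [(-1, D)] = 0) {x : List V → V} (hx : IsMultilinear K x) :
    brace 𝒱 α (brace 𝒱 α x [(-1, D)]) [(-1, D)] = 0 := by
  have h0 := brace_slot_zero hα hx [] [] (-1 + -1)
  rw [List.nil_append] at h0
  rw [brace_pre_lie hα hx hD hD, hDD, h0]
  simp

/-- The `A_∞`-relations for the operations `psi`. -/
lemma psi_relation (hα : ∀ i, ∀ a ∈ 𝒱 i, α a ∈ 𝒱 i) (hD : D ∈ Coder 𝒱 α (-1))
    (hDD : brace 𝒱 α D [(-1, D)] = 0) {X : List (ℤ × (List V → V))} (hX : IsCoders 𝒱 α X)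
    (hX0 : X ≠ []) :
    split (fun X₁ R => split (fun X₂ X₃ => if X₂.length = 0 then 0 else (deg X₁).negOnePow •
      psi 𝒱 α D (X₁ ++ (-1 + deg X₂, psi 𝒱 α D X₂) :: X₃)) R) X = 0 := by
  -- the three parts of the sum
  let A : List (ℤ × (List V → V)) → _ → _ → List V → V := fun X₁ X₂ X₃ => (deg X₁).negOnePow •
    brace 𝒱 α D (X₁ ++ (-1 + deg X₂, brace 𝒱 α D X₂) :: X₃)
  let B : List (ℤ × (List V → V)) → ℤ × (List V → V) → _ → List V → V := fun X₁ x X₃ =>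
    (deg X₁ + x.1).negOnePow • brace 𝒱 α D (X₁ ++ (x.1 + -1, brace 𝒱 α x.2 [(-1, D)]) :: X₃)
  let C : List (ℤ × (List V → V)) → List V → V := fun X =>
    (-1 + deg X).negOnePow • brace 𝒱 α (brace 𝒱 α D X) [(-1, D)]
  -- `psi` is a brace minus a correction on one-element lists. `A` uses no correction, `B` the inner
  -- one, present when `X₂` is a single cochain, and `C` the outer one, present when `X₁` and `X₃`
  -- are empty.
  have key : ∀ X₁ X₂ X₃, X₁ ++ (X₂ ++ X₃) = X →
      (if X₂.length = 0 then 0 else (deg X₁).negOnePow •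
        psi 𝒱 α D (X₁ ++ (-1 + deg X₂, psi 𝒱 α D X₂) :: X₃)) =
      (if X₂.length = 0 then 0 else A X₁ X₂ X₃) - onSingle (fun x => B X₁ x X₃) X₂ -
        if X₁ = [] then (if X₃ = [] then C X₂ else 0) else 0 := by
    intro X₁ X₂ X₃ h
    have hout : ∀ z : ℤ × (List V → V), psi 𝒱 α D (X₁ ++ z :: X₃) = brace 𝒱 α D (X₁ ++ z :: X₃) -
        if X₁ = [] then (if X₃ = [] then z.1.negOnePow • brace 𝒱 α z.2 [(-1, D)] else 0)
          else 0 := by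
      intro z
      rw [psi]
      congr 1
      rcases X₁ with _ | ⟨a, _ | ⟨b, X₁⟩⟩ <;> rcases X₃ with _ | ⟨c, X₃⟩ <;> simp [onSingle]
    by_cases h2 : X₂ = []
    · subst h2
      have : ¬ (X₁ = [] ∧ X₃ = []) := by
        rintro ⟨rfl, rfl⟩
        exact hX0 h.symm
      by_cases h1 : X₁ = [] <;> simp_all [onSingle]
    have hm : ∀ x ∈ X₂, IsMultilinear K x.2 := fun x hx =>
      (hX x (by rw [← h]; simp [hx])).2.1
    -- The correction of the correction is `{{x}{D}}{D}` up to sign, which vanishes.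
    have hin : brace 𝒱 α (psi 𝒱 α D X₂) [(-1, D)] = brace 𝒱 α (brace 𝒱 α D X₂) [(-1, D)] := by
      rw [psi, brace_sub_left, sub_eq_self]
      rcases X₂ with _ | ⟨a, _ | ⟨b, X₂⟩⟩
      · exact absurd rfl h2
      · rw [onSingle_singleton, brace_units_left, brace_brace_self hα hD hDD (hm a (by simp)),
          smul_zero]
      · rw [onSingle_cons_cons]; simpa using brace_smul_left 𝒱 α (0 : K) D [(-1, D)]
    have hc : (deg X₁).negOnePow • brace 𝒱 α D (X₁ ++ (-1 + deg X₂, onSingle (fun x =>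
        x.1.negOnePow • brace 𝒱 α x.2 [(-1, D)]) X₂) :: X₃) = onSingle (fun x => B X₁ x X₃) X₂ := by
      rcases X₂ with _ | ⟨a, _ | ⟨b, X₂⟩⟩
      · exact absurd rfl h2
      · rw [onSingle_singleton, onSingle_singleton, brace_slot_units hα hD.2.1, smul_smul,
          ← Int.negOnePow_add, deg_cons, deg_nil, add_zero, add_comm (-1)]
      · rw [onSingle_cons_cons, onSingle_cons_cons, brace_slot_zero hα hD.2.1, smul_zero]
    rw [if_neg (by simpa using h2), if_neg (by simpa using h2), hout, hin, psi,
      brace_slot_sub hα hD.2.1, smul_sub, smul_sub, hc]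
    congr 1
    by_cases h1 : X₁ = []
    · subst h1
      simp [C]
    · simp [h1]
  have hA := brace_brace_singleton hα hX hD hD.2.1
  have h0 : brace 𝒱 α (0 : List V → V) X = 0 := by
    simpa using brace_smul_left 𝒱 α (0 : K) D X
  rw [hDD, h0] at hA
  simp only [negOnePow_neg_one_mul] at hA
  -- `{{D}{D}}{X} = 0` is the vanishing of the sum of all `A X₁ X₂ X₃`, those with empty `X₂`
  -- included.
  have hA' : split (fun X₁ R => split (fun X₂ X₃ => if X₂.length = 0 then 0 else A X₁ X₂ X₃) R) X =
      -split (fun X₁ X₃ => A X₁ [] X₃) X := by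
    rw [eq_neg_iff_add_eq_zero, add_comm, ← split_add]
    exact (split_congr fun X₁ R _ => (split_ite_add _ _).symm).trans hA.symm
  -- Expanding `{{D}{X}}{D}`: where `D` falls between blocks it gives the terms `A X₁ [] X₃`, and
  -- where it falls into a block it gives the terms `B`.
  have hC : C X = -split (fun X₁ X₃ => A X₁ [] X₃) X - splitAt B X := by
    have hneg : ∀ a : ℤ, (-1 + a).negOnePow = -a.negOnePow := fun a => by
      rw [Int.negOnePow_add, Int.negOnePow_neg, Int.negOnePow_one, neg_one_mul]
    have hs : ∀ a b : ℤ, (a + b).negOnePow * (-1 * b).negOnePow = a.negOnePow := fun a b => by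
      rw [negOnePow_neg_one_mul, ← Int.negOnePow_add, add_assoc, ← two_mul, Int.negOnePow_add,
        Int.negOnePow_two_mul, mul_one]
    simp only [C]
    rw [brace_singleton_brace hα hX hD hD.2.1, hneg, Units.neg_smul, smul_add, neg_add,
      units_smul_split, units_smul_splitAt, sub_eq_add_neg]
    congr 2
    · refine split_congr fun X₁ X₃ h => ?_
      rw [← h, smul_smul, deg_append, hs]
      simp only [A, brace_nil hα, deg_nil, add_zero]
    · refine splitAt_congr fun X₁ x X₃ h => ?_
      rw [← h, smul_smul, deg_append, deg_cons, ← add_assoc, hs]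
  calc _ = split (fun X₁ R => split (fun X₂ X₃ => (if X₂.length = 0 then 0 else A X₁ X₂ X₃) -
        onSingle (fun x => B X₁ x X₃) X₂ -
        if X₁ = [] then (if X₃ = [] then C X₂ else 0) else 0) R) X := by
        refine split_congr fun X₁ R hR => split_congr fun X₂ X₃ hX' => key _ _ _ ?_
        rw [hX', hR]
    _ = -split (fun X₁ X₃ => A X₁ [] X₃) X - splitAt B X - C X := by
        simp only [split_sub]
        rw [hA', split_onSingle]
        congr 1
        rw [← split_left_nil C X]
        refine split_congr fun X₁ R _ => ?_
        split_ifs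
        · exact split_right_nil _ _
        · exact split_zero _
    _ = 0 := by rw [hC]; abel

end SquareZero

end Identities

/-- The Koszul sign exponent `∑_j (k - j) e_j`. -/
def koszul : List ℤ → ℤ
  | [] => 0
  | e :: es => es.length * e + koszul es

lemma koszul_append (a b : List ℤ) : koszul (a ++ b) = koszul a + b.length * a.sum + koszul b := by
  induction a with
  | nil => simp [koszul]
  | cons x a ih => simp [koszul, ih]; ring

/-- The sign dictionary of the suspension. The sign of an `HA_∞`-term, in the degrees `e - 1`, times
the suspension signs of its outer and inner operations is the Koszul sign of moving an odd symbol
past `u`, up to a sign that depends only on the whole word. It is used for `{D}{D} = 0` and, in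
reverse, for the cochain algebra. -/
lemma koszul_sign (u b w : List ℤ) :
    ((u.length + 1 : ℤ) * (b.length + 1) + b.length * (u.sum - u.length)).negOnePow *
        ((koszul (u ++ (b.sum + -1) :: w)).negOnePow * (koszul b).negOnePow) =
      (koszul (u ++ (b ++ w)) + (u ++ (b ++ w)).length + 1).negOnePow * u.sum.negOnePow := by
  rw [← Int.negOnePow_add, ← Int.negOnePow_add, ← Int.negOnePow_add, Int.negOnePow_eq_iff]
  -- The two exponents differ by `-2 * w.length`, from the `-1` in the degree of the inner value.
  refine ⟨-w.length, ?_⟩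
  simp only [koszul_append, koszul, List.length_append, List.length_cons]
  push_cast
  ring

/-! ### The `HA_∞`-relation in terms of words. -/

section Words

variable {K : Type*} [Field K] {A : Type*} [AddCommGroup A] [Module K A]

/-- A family of operations as a function on words. -/
def onWords (μ : (k : ℕ) → MultilinearMap K (fun _ : Fin k => A) A) (v : List A) : A :=
  μ v.length v.get

lemma onWords_ofFn (μ : (k : ℕ) → MultilinearMap K (fun _ : Fin k => A) A) {k : ℕ}
    (f : Fin k → A) : onWords μ (List.ofFn f) = μ k f := by
  have key : ∀ (w : List A) (n : ℕ) (h : w.length = n), onWords μ w =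
      μ n (fun j => w.get (j.cast h.symm)) := by
    rintro w n rfl
    rfl
  rw [key _ k (List.length_ofFn)]
  congr 1
  funext j
  simp

lemma isMultilinear_onWords (μ : (k : ℕ) → MultilinearMap K (fun _ : Fin k => A) A) :
    IsMultilinear K (onWords μ) := fun n => ⟨μ n, fun v => (onWords_ofFn μ v).symm⟩

/-- The substitution is `l = k + 1`, `i = m`: the position of the inner operation becomes the number
`k` of letters in front of its block. -/
lemma sum_Icc_Icc_eq {M : Type*} [AddCommMonoid M] (n : ℕ) (f : ℕ → ℕ → M) :
    ∑ i ∈ Finset.Icc 1 n, ∑ l ∈ Finset.Icc 1 (n + 1 - i), f i l =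
      ∑ k ∈ Finset.range n, ∑ m ∈ Finset.Icc 1 (n - k), f m (k + 1) := by
  rw [Finset.sum_sigma', Finset.sum_sigma']
  refine Finset.sum_bij' (fun x _ => ⟨x.2 - 1, x.1⟩) (fun x _ => ⟨x.2, x.1 + 1⟩) ?_ ?_ ?_ ?_ ?_
  · rintro ⟨i, l⟩ h
    simp only [Finset.mem_sigma, Finset.mem_Icc, Finset.mem_range] at h ⊢
    omega
  · rintro ⟨i, l⟩ h
    simp only [Finset.mem_sigma, Finset.mem_Icc, Finset.mem_range] at h ⊢
    omega
  · rintro ⟨i, l⟩ h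
    simp only [Finset.mem_sigma, Finset.mem_Icc] at h ⊢
    congr
    omega
  · rintro ⟨i, l⟩ h
    rfl
  · rintro ⟨i, l⟩ h
    simp only [Finset.mem_sigma, Finset.mem_Icc] at h ⊢
    rw [Nat.sub_add_cancel h.2.1]

lemma relation_word (μ : (k : ℕ) → MultilinearMap K (fun _ : Fin k => A) A) (β : A →ₗ[K] A)
    (n : ℕ) (a : ℕ → A) (k m : ℕ) (hk : k < n) (hm : m ≤ n - k) :
    μ (n + 1 - m) (fun t : Fin (n + 1 - m) =>
      if (t : ℕ) + 1 < k + 1 then (β ^ (m - 1)) (a (t + 1))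
      else if (t : ℕ) + 1 = k + 1 then μ m (fun s : Fin m => a (k + 1 + s))
      else (β ^ (m - 1)) (a (t + m))) =
    onWords μ (((List.ofFn fun t : Fin n => a (t + 1)).take k).map (β ^ (m - 1)) ++
      onWords μ (((List.ofFn fun t : Fin n => a (t + 1)).drop k).take m) ::
        ((List.ofFn fun t : Fin n => a (t + 1)).drop (k + m)).map (β ^ (m - 1))) := by
  have hb : ((List.ofFn fun t : Fin n => a (t + 1)).drop k).take m =
      List.ofFn fun s : Fin m => a (k + 1 + s) := by
    refine List.ext_getElem (by simp; omega) fun i h1 h2 => ?_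
    simp only [List.getElem_take, List.getElem_drop, List.getElem_ofFn]
    congr 1
    omega
  rw [hb, onWords_ofFn, ← onWords_ofFn]
  congr 1
  refine List.ext_getElem (by simp; omega) fun i h1 h2 => ?_
  simp only [List.getElem_ofFn, List.getElem_append, List.length_map, List.length_take,
    List.length_ofFn, List.getElem_map, List.getElem_take]
  simp only [min_eq_left hk.le]
  by_cases h : i < k
  · simp [h]
  · rw [if_neg (by omega), dif_neg h]
    by_cases h' : i = k
    · simp [h']
    · obtain ⟨j, hj⟩ : ∃ j, i - k = j + 1 := ⟨i - k - 1, by omega⟩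
      simp only [hj, List.getElem_cons_succ, List.getElem_map, List.getElem_drop, List.getElem_ofFn]
      rw [if_neg (by omega)]
      congr 2
      omega

/-- The `HA_∞`-relation as a sum over decompositions of a word. -/
lemma relation_sum_eq (μ : (k : ℕ) → MultilinearMap K (fun _ : Fin k => A) A) (β : A →ₗ[K] A)
    (n : ℕ) (e : ℕ → ℤ) (a : ℕ → A) :
    ∑ i ∈ Finset.Icc 1 n, ∑ l ∈ Finset.Icc 1 (n + 1 - i),
      ((l : ℤ) * (i + 1) + i * ∑ t ∈ Finset.Ico 1 l, e t).negOnePow •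
        μ (n + 1 - i) (fun t : Fin (n + 1 - i) =>
          if (t : ℕ) + 1 < l then (β ^ (i - 1)) (a (t + 1))
          else if (t : ℕ) + 1 = l then μ i (fun s : Fin i => a (l + s))
          else (β ^ (i - 1)) (a (t + i))) =
    split (fun u r => split (fun b w => if b.length = 0 then 0 else
      ((u.length + 1 : ℤ) * (b.length + 1) + b.length *
        (((List.ofFn fun t : Fin n => e (t + 1)).take u.length).sum)).negOnePow •
      onWords μ (u.map (β ^ (b.length - 1)) ++ onWords μ b :: w.map (β ^ (b.length - 1)))) r)
        (List.ofFn fun t : Fin n => a (t + 1)) := by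
  rw [sum_Icc_Icc_eq, ← sum_blocks_eq_split, List.length_ofFn]
  refine Finset.sum_congr rfl fun k hk => Finset.sum_congr rfl fun m hm => ?_
  rw [Finset.mem_range] at hk
  rw [Finset.mem_Icc] at hm
  have h1 : ((List.ofFn fun t : Fin n => a (t + 1)).take k).length = k := by simp; omega
  have h2 : (((List.ofFn fun t : Fin n => a (t + 1)).drop k).take m).length = m := by simp; omega
  rw [h1, h2, relation_word μ β n a k m hk hm.2]
  congr 5
  rw [Finset.sum_Ico_eq_sum_range, add_tsub_cancel_right]
  have : (List.ofFn fun t : Fin n => e (t + 1)).take k =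
      List.ofFn fun t : Fin k => e (t + 1) := by
    refine List.ext_getElem (by simp; omega) fun i h1 h2 => by simp
  rw [this, List.sum_ofFn, Finset.sum_range]
  exact Finset.sum_congr rfl fun t _ => by rw [add_comm]

end Words

/-! ### The coderivation of an `HA_∞`-algebra squares to zero. -/

section Structure

variable {K : Type*} [Field K] {A : Type*} [AddCommGroup A] [Module K A]
  {𝒜 : ℤ → Submodule K A}

lemma HAInfAlgebra.relation_list (S : HAInfAlgebra K A 𝒜) {v : List A} {E : List ℤ}
    (h : List.Forall₂ (fun a i => a ∈ 𝒜 i) v E) (hv : v ≠ []) :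
    split (fun u r => split (fun b w => if b.length = 0 then 0 else
      ((u.length + 1 : ℤ) * (b.length + 1) + b.length * ((E.take u.length).sum)).negOnePow •
      onWords S.μ (u.map (S.α ^ (b.length - 1)) ++ onWords S.μ b ::
        w.map (S.α ^ (b.length - 1)))) r) v = 0 := by
  have hlen := h.length_eq
  -- The relation is indexed from `1`, hence the shift `t - 1`. Beyond the word the sequences are
  -- padded by the zero vector, which is homogeneous of every degree.
  have hr := S.relation v.length (List.length_pos_iff.2 hv) (fun t => E.getD (t - 1) 0)
    (fun t => v.getD (t - 1) 0) (fun t => by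
      by_cases ht : t - 1 < v.length
      · rw [List.getD_eq_getElem _ _ ht, List.getD_eq_getElem _ _ (hlen ▸ ht)]
        exact h.get ht (hlen ▸ ht)
      · rw [List.getD_eq_default _ _ (not_lt.1 ht)]
        exact Submodule.zero_mem _)
  rw [relation_sum_eq S.μ S.α v.length (fun t => E.getD (t - 1) 0)
    (fun t => v.getD (t - 1) 0)] at hr
  have h1 : (List.ofFn fun t : Fin v.length => v.getD ((t : ℕ) + 1 - 1) 0) = v :=
    List.ext_getElem (by simp) fun i h1 h2 => by simp
  have h2 : (List.ofFn fun t : Fin v.length => E.getD ((t : ℕ) + 1 - 1) 0) = E :=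
    List.ext_getElem (by simp [hlen]) fun i h1 h2 => by simp [h2]
  rwa [h1, h2] at hr

lemma HAInfAlgebra.susp_α (S : HAInfAlgebra K A 𝒜) :
    ∀ i, ∀ a ∈ susp 𝒜 i, S.α a ∈ susp 𝒜 i := fun i a ha => S.α_degree (i - 1) a ha

lemma HAInfAlgebra.onWords_map_α (S : HAInfAlgebra K A 𝒜) (v : List A) :
    onWords S.μ (v.map S.α) = S.α (onWords S.μ v) := by
  refine Eq.trans ?_ (S.α_μ v.length v.get).symm
  rw [← onWords_ofFn]
  congr 1
  exact List.ext_getElem (by simp) fun i h1 h2 => by simp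

variable [DirectSum.Decomposition 𝒜]

/-- The letters of `v`, with the signs from moving `s⁻¹` past them. -/
def desusp (𝒜 : ℤ → Submodule K A) [DirectSum.Decomposition 𝒜] : List A → List A
  | [] => []
  | a :: v => sgn (susp 𝒜) v.length a :: desusp 𝒜 v

lemma ofFn_desusp (v : List A) :
    (List.ofFn fun j : Fin v.length => sgn (susp 𝒜) ((v.length : ℤ) - 1 - (j : ℕ)) (v.get j)) =
      desusp 𝒜 v := by
  induction v with
  | nil => rfl
  | cons a v ih =>
    rw [desusp, ← ih, List.ofFn_succ]
    congr 1
    · simp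
    · congr 1
      funext j
      simp only [List.length_cons, Fin.val_succ]
      congr 2
      push_cast
      ring

lemma HAInfAlgebra.D_eq (S : HAInfAlgebra K A 𝒜) (v : List A) :
    S.D v = onWords S.μ (desusp 𝒜 v) := by
  rw [HAInfAlgebra.D, ← onWords_ofFn, ofFn_desusp]

lemma HAInfAlgebra.D_homogeneous (S : HAInfAlgebra K A 𝒜) {v : List A} {e : List ℤ}
    (h : List.Forall₂ (fun a i => a ∈ susp 𝒜 i) v e) :
    S.D v = (koszul e).negOnePow • onWords S.μ v := by
  rw [S.D_eq]
  suffices H : ∀ p, onWords S.μ (p ++ desusp 𝒜 v) = (koszul e).negOnePow • onWords S.μ (p ++ v) by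
    simpa using H []
  induction h with
  | nil => simp [desusp, koszul]
  | @cons x i v e hx hv ih =>
    intro p
    have := ih (p ++ [x])
    simp only [List.append_assoc, List.singleton_append] at this
    rw [desusp, sgn_of_mem _ _ i hx, (isMultilinear_onWords S.μ).map_units, this, smul_smul, koszul,
      Int.negOnePow_add, hv.length_eq]

lemma HAInfAlgebra.D_mem (S : HAInfAlgebra K A 𝒜) : S.D ∈ Coder (susp 𝒜) S.α (-1) := by
  refine ⟨?_, S.isMultilinear_D, HasDegree.of_list _ fun v e h => ?_, fun v => ?_⟩
  · rw [S.D_eq]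
    change S.μ 0 _ = 0
    rw [S.μ_zero]
    rfl
  · rw [S.D_homogeneous h]
    refine Submodule.smul_of_tower_mem _ _ ?_
    have hl := h.length_eq
    have := S.μ_degree v.length (fun j => e.get (j.cast hl) - 1) v.get
      fun j => h.get j.2 (hl ▸ j.2)
    have hs : ∑ j : Fin v.length, e.get (j.cast hl) = e.sum := by
      rw [← List.sum_ofFn]
      congr 1
      exact List.ext_getElem (by simp [hl]) fun i h1 h2 => by simp
    -- In `A` the letters have degrees `e_j - 1` and `μ_k` has degree `k - 2`. The value has degree
    -- `∑ e_j - 2` in `A`, which is degree `∑ e_j - 1` in `sA`.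
    have hd : ∑ j : Fin v.length, (e.get (j.cast hl) - 1) + ((v.length : ℤ) - 2) =
        e.sum + -1 - 1 := by
      rw [Finset.sum_sub_distrib, hs]
      simp
      ring
    rw [hd] at this
    exact this
  · rw [S.D_eq, S.D_eq, ← S.onWords_map_α]
    congr 1
    induction v with
    | nil => rfl
    | cons a v ih => simp [desusp, ih, map_sgn (susp 𝒜) S.susp_α]

/-- On a nonempty homogeneous word, each summand of `{D}{D}` is the corresponding summand of the
`HA_∞`-relation times one sign common to all of them. -/
lemma HAInfAlgebra.brace_D_D (S : HAInfAlgebra K A 𝒜) :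
    brace (susp 𝒜) S.α S.D [(-1, S.D)] = 0 := by
  have hα := S.susp_α
  have hmem := brace_singleton_mem hα S.D_mem S.D_mem
  funext v
  refine hmem.2.1.eq_zero (susp 𝒜) (fun v hv => ?_) v
  obtain ⟨e, he⟩ := exists_degrees (susp 𝒜) hv
  by_cases hv0 : v = []
  · rw [hv0]; exact hmem.1
  have he' : List.Forall₂ (fun a i => a ∈ 𝒜 i) v (e.map (· - 1)) := by
    rw [List.forall₂_map_right_iff]
    exact he
  have hrel := S.relation_list he' hv0
  rw [brace_eq_act hα, act_cons]
  have hm := isMultilinear_onWords S.μ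
  refine (Eq.trans ?_ (congrArg ((koszul e + e.length + 1).negOnePow • ·) hrel)).trans
    (smul_zero _)
  simp only
  rw [units_smul_split]
  refine split_congr fun u r hr => ?_
  rw [units_smul_split]
  refine split_congr fun b w hw => ?_
  subst hw hr
  obtain ⟨eu, er, rfl, hu, her⟩ := forall₂_append_split he
  obtain ⟨eb, ew, rfl, hb, hw⟩ := forall₂_append_split her
  rw [smul_ite, smul_zero]
  refine ite_congr rfl (fun _ => rfl) fun _ => ?_
  simp only [act_nil, deg_nil, tw_zero, zero_add, add_zero, pow_zero, Module.End.one_apply]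
  rw [S.D_homogeneous (e := eu ++ (eb.sum + -1) :: ew) (List.rel_append
    (forall₂_tw hα _ _ hu) (.cons (S.D_mem.2.2.1.mem _ hb) (forall₂_tw hα _ _ hw))),
    S.D_homogeneous hb, hm.map_units, smul_smul]
  have h1 := (hm.append_right (onWords S.μ b :: tw (susp 𝒜) S.α (b.length - 1) 0 w)).map_tw_sgn
    (α := S.α) (susp 𝒜) (-1) (forall₂_tw hα (b.length - 1) 0 hu)
  rw [tw_tw _ hα, zero_add, add_zero] at h1
  rw [h1, smul_smul, negOnePow_neg_one_mul]
  have h2 : ((eu ++ (eb ++ ew)).map (· - 1)).take u.length = eu.map (· - 1) := by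
    rw [List.map_append, hu.length_eq, ← List.length_map (f := (· - 1)) (as := eu),
      List.take_left]
  have h3 : (eu.map (· - 1)).sum = eu.sum - eu.length := by
    clear * -
    induction eu with
    | nil => simp
    | cons x l ih => simp [ih]; ring
  rw [h2, h3, smul_smul, ← hu.length_eq]
  have h4 := koszul_sign eu eb ew
  rw [← hu.length_eq, ← hb.length_eq] at h4
  have h5 : ∀ l : List A, l.map (S.α ^ (b.length - 1)) = tw (susp 𝒜) S.α (b.length - 1) 0 l := by
    intro l
    rw [tw, twl_zero_right]
  rw [h5, h5]
  congr 1
  -- `koszul_sign` has to be solved for the product of the two suspension signs; every factor is its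
  -- own inverse.
  rcases Int.units_eq_one_or eu.sum.negOnePow with hs | hs <;>
  rcases Int.units_eq_one_or (koszul (eu ++ (eb ++ ew)) + (eu ++ (eb ++ ew)).length + 1).negOnePow
    with hs' | hs' <;>
  rcases Int.units_eq_one_or ((u.length + 1 : ℤ) * (b.length + 1) + b.length *
    (eu.sum - u.length)).negOnePow with hs'' | hs'' <;>
  rw [hs, hs', hs''] at h4 <;> rw [hs, hs', hs''] <;> simpa [neg_eq_iff_eq_neg] using h4

/-- In the composition formula the term of `{D}{D}` is zero, and the two terms with disjoint blocks
cancel because `(-1) * (-1)` is an odd exponent. -/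
lemma HAInfAlgebra.coderLift_D_comp (S : HAInfAlgebra K A 𝒜) :
    coderLift (susp 𝒜) S.α (-1) ⟨S.D, S.D_mem⟩ ∘ₗ coderLift (susp 𝒜) S.α (-1) ⟨S.D, S.D_mem⟩ =
      0 := by
  refine TV_ext fun v => ?_
  rw [LinearMap.comp_apply, coderLift_comp_word S.susp_α, S.brace_D_D]
  have h1 := actSlot_apply S.susp_α (F := fun _ => word K) (fun _ => isMultilinear_word K)
    [] [] (-1 + -1) 0
  rw [map_zero, List.nil_append] at h1
  rw [← h1]
  simp

end Structure

/-! ### Degree and linearity of the operations `psi`. -/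

section PsiLinear

variable {K : Type*} [Field K] {V : Type*} [AddCommGroup V] [Module K V]
  {𝒱 : ℤ → Submodule K V} [DirectSum.Decomposition 𝒱] {α : V →ₗ[K] V} {D : List V → V}

lemma psi_mem (hα : ∀ i, ∀ a ∈ 𝒱 i, α a ∈ 𝒱 i) (hD : D ∈ Coder 𝒱 α (-1))
    {X : List (ℤ × (List V → V))} (hX : IsCoders 𝒱 α X) : psi 𝒱 α D X ∈ Coder 𝒱 α (-1 + deg X) := by
  refine Submodule.sub_mem _ (brace_mem hα hX hD) ?_
  rcases X with _ | ⟨x, _ | ⟨y, X⟩⟩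
  · exact Submodule.zero_mem _
  · have := brace_singleton_mem hα (hX x (by simp)) hD
    rw [onSingle_singleton, deg_cons, deg_nil, add_zero, add_comm]
    exact Submodule.smul_of_tower_mem _ _ this
  · exact Submodule.zero_mem _

lemma psi_slot_add (hα : ∀ i, ∀ a ∈ 𝒱 i, α a ∈ 𝒱 i) (hD : IsMultilinear K D)
    (X₁ X₃ : List (ℤ × (List V → V))) (d : ℤ) (x y : List V → V) :
    psi 𝒱 α D (X₁ ++ (d, x + y) :: X₃) =
      psi 𝒱 α D (X₁ ++ (d, x) :: X₃) + psi 𝒱 α D (X₁ ++ (d, y) :: X₃) := by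
  have h : onSingle (fun x => x.1.negOnePow • brace 𝒱 α x.2 [(-1, D)]) (X₁ ++ (d, x + y) :: X₃) =
      onSingle (fun x => x.1.negOnePow • brace 𝒱 α x.2 [(-1, D)]) (X₁ ++ (d, x) :: X₃) +
      onSingle (fun x => x.1.negOnePow • brace 𝒱 α x.2 [(-1, D)]) (X₁ ++ (d, y) :: X₃) := by
    rcases X₁ with _ | ⟨a, _ | ⟨b, X₁⟩⟩ <;> rcases X₃ with _ | ⟨c, X₃⟩ <;>
      simp [onSingle, brace_add_left]
  simp only [psi, h]
  simp only [brace_eq_act hα, ← actSlot_apply hα (F := fun _ => D) (fun _ => hD), map_add]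
  abel

lemma psi_slot_smul (hα : ∀ i, ∀ a ∈ 𝒱 i, α a ∈ 𝒱 i) (hD : IsMultilinear K D)
    (X₁ X₃ : List (ℤ × (List V → V))) (d : ℤ) (r : K) (x : List V → V) :
    psi 𝒱 α D (X₁ ++ (d, r • x) :: X₃) = r • psi 𝒱 α D (X₁ ++ (d, x) :: X₃) := by
  have h : onSingle (fun x => x.1.negOnePow • brace 𝒱 α x.2 [(-1, D)]) (X₁ ++ (d, r • x) :: X₃) =
      r • onSingle (fun x => x.1.negOnePow • brace 𝒱 α x.2 [(-1, D)]) (X₁ ++ (d, x) :: X₃) := by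
    rcases X₁ with _ | ⟨a, _ | ⟨b, X₁⟩⟩ <;> rcases X₃ with _ | ⟨c, X₃⟩ <;>
      simp [onSingle, brace_smul_left, smul_comm r]
  simp only [psi, h, smul_sub]
  simp only [brace_eq_act hα, ← actSlot_apply hα (F := fun _ => D) (fun _ => hD), map_smul]

lemma coderLift_congr {d e : ℤ} (h : d = e) {f : List V → V} (hf : f ∈ Coder 𝒱 α d)
    (hf' : f ∈ Coder 𝒱 α e) : coderLift 𝒱 α d ⟨f, hf⟩ = coderLift 𝒱 α e ⟨f, hf'⟩ := by
  subst h
  rfl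

end PsiLinear

lemma koszul_ofFn {k : ℕ} (f : Fin k → ℤ) :
    koszul (List.ofFn f) = ∑ j : Fin k, ((k : ℤ) - 1 - (j : ℕ)) * f j := by
  induction k with
  | zero => rfl
  | succ k ih =>
    rw [List.ofFn_succ, koszul, ih, Fin.sum_univ_succ, List.length_ofFn]
    simp only [Fin.val_zero, Fin.val_succ]
    congr 1
    · push_cast; ring
    · exact Finset.sum_congr rfl fun j _ => by push_cast; ring

/-! ### From the operations `psi` to an `HA_∞`-algebra. -/

section PsiAlgebra

variable {K : Type*} [Field K] {V : Type*} [AddCommGroup V] [Module K V]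
  {𝒱 : ℤ → Submodule K V} [DirectSum.Decomposition 𝒱] {α : V →ₗ[K] V} {D : List V → V}

/-- The operations `psi` define an `A_∞`-algebra on a space of coderivations. -/
def psiAlgebra (hα : ∀ i, ∀ a ∈ 𝒱 i, α a ∈ 𝒱 i) (hD : D ∈ Coder 𝒱 α (-1))
    (hDD : brace 𝒱 α D [(-1, D)] = 0) {W : Type*} [AddCommGroup W] [Module K W]
    {𝒲 : ℤ → Submodule K W} (μ : (k : ℕ) → MultilinearMap K (fun _ : Fin k => W) W)
    (hμ0 : μ 0 = 0) (ι : ℤ → (List V → V) →ₗ[K] W)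
    (hι : ∀ i, ∀ x ∈ Coder 𝒱 α (i + 1), ι (i + 1) x ∈ 𝒲 i)
    (hι' : ∀ i, ∀ a ∈ 𝒲 i, ∃ x ∈ Coder 𝒱 α (i + 1), a = ι (i + 1) x)
    (hμ : ∀ X, IsCoders 𝒱 α X → X ≠ [] → onWords μ (X.map fun x => ι x.1 x.2) =
      (koszul (X.map Prod.fst)).negOnePow • ι (-1 + deg X) (psi 𝒱 α D X)) :
    HAInfAlgebra K W 𝒲 where
  μ := μ
  μ_zero := hμ0
  α := LinearMap.id
  μ_degree k e a ha := by
    choose x hx hxa using fun j => hι' _ _ (ha j)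
    rcases Nat.eq_zero_or_pos k with rfl | hk
    · exact hμ0 ▸ Submodule.zero_mem _
    have hX : IsCoders 𝒱 α (List.ofFn fun j => (e j + 1, x j)) := by
      intro y hy
      rw [List.mem_ofFn] at hy
      obtain ⟨j, rfl⟩ := hy
      exact hx j
    have h := hμ _ hX (by simp; omega)
    have ha' : a = fun j => ι (e j + 1) (x j) := funext hxa
    rw [List.map_ofFn] at h
    rw [ha', ← onWords_ofFn μ]
    refine h ▸ Submodule.smul_of_tower_mem _ _ ?_
    -- Degree `i` of `W` corresponds to coderivation degree `i + 1`, so `k` inputs add `k` to the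
    -- degree and `psi` subtracts one.
    have hd : -1 + deg (List.ofFn fun j => (e j + 1, x j)) = ∑ j, e j + ((k : ℤ) - 2) + 1 := by
      rw [deg, List.map_ofFn, List.sum_ofFn]
      simp only [Function.comp_apply, Finset.sum_add_distrib]
      simp
      ring
    have hp := psi_mem hα hD hX
    rw [hd] at hp ⊢
    exact hι _ _ hp
  α_degree _ _ ha := ha
  α_μ _ _ := rfl
  relation n hn e a ha := by
    choose x hx hxa using fun l => hι' _ _ (ha l)
    have hpow : ∀ m : ℕ, (LinearMap.id : W →ₗ[K] W) ^ m = LinearMap.id :=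
      fun m => one_pow m
    refine (relation_sum_eq μ LinearMap.id n e a).trans ?_
    simp only [hpow, LinearMap.id_coe, List.map_id]
    set X : List (ℤ × (List V → V)) :=
      List.ofFn fun t : Fin n => (e (t + 1) + 1, x (t + 1)) with hXdef
    have hX : IsCoders 𝒱 α X := by
      intro y hy
      rw [List.mem_ofFn] at hy
      obtain ⟨j, rfl⟩ := hy
      exact hx _
    have hX0 : X ≠ [] := by rw [hXdef]; simp; omega
    have h1 : (List.ofFn fun t : Fin n => a (t + 1)) = X.map fun x => ι x.1 x.2 := by
      rw [hXdef, List.map_ofFn]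
      congr 1
      exact funext fun t => hxa _
    have h2 : (List.ofFn fun t : Fin n => e (t + 1)) = X.map fun x => x.1 - 1 := by
      rw [hXdef, List.map_ofFn]
      congr 1
      exact funext fun t => (add_sub_cancel_right _ _).symm
    have hm := isMultilinear_onWords μ
    have hrel := psi_relation hα hD hDD hX hX0
    -- The common sign is the one from `koszul_sign`; `psi` is composed with itself, which lowers
    -- the degree by `2`.
    refine Eq.trans ?_ ((congrArg (fun f => (koszul (X.map Prod.fst) + X.length + 1).negOnePow •
      ι (-2 + deg X) f) hrel).trans (by rw [map_zero, smul_zero]))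
    rw [h1, h2, split_map, map_split, units_smul_split]
    refine split_congr fun u r hr => ?_
    rw [split_map, map_split, units_smul_split]
    refine split_congr fun b w hw => ?_
    subst hw
    rw [apply_ite (ι _), map_zero, smul_ite, smul_zero, List.length_map]
    refine ite_congr rfl (fun _ => rfl) fun hb0 => ?_
    rw [← hr] at hX ⊢
    have hXu := (isCoders_append.1 hX).1
    have hXb := (isCoders_append.1 (isCoders_append.1 hX).2).1
    have hXw := (isCoders_append.1 (isCoders_append.1 hX).2).2
    have hb := hμ _ hXb (by simpa using hb0)
    have hout := hμ (u ++ (-1 + deg b, psi 𝒱 α D b) :: w)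
      (isCoders_append.2 ⟨hXu, isCoders_cons.2 ⟨psi_mem hα hD hXb, hXw⟩⟩) (by simp)
    rw [List.map_append, List.map_cons] at hout
    rw [hb, hm.map_units, hout, LinearMap.map_smul_of_tower, smul_smul, smul_smul, smul_smul]
    have hd : -1 + deg (u ++ (-1 + deg b, psi 𝒱 α D b) :: w) =
        -2 + deg (u ++ (b ++ w)) := by
      simp only [deg_append, deg_cons]
      ring
    rw [hd]
    congr 1
    have hs := koszul_sign (u.map Prod.fst) (b.map Prod.fst) (w.map Prod.fst)
    have hsum : ((List.map (fun x => x.1 - 1) (u ++ (b ++ w))).take u.length).sum =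
        deg u - u.length := by
      rw [List.map_append, List.take_left' (by simp), deg]
      clear * -
      induction u with
      | nil => simp
      | cons x l ih => simp [ih]; ring
    simp only [List.length_map, List.length_append] at hs ⊢
    rw [hsum]
    simp only [List.map_append, List.map_cons, deg]
    rw [add_comm (-1), mul_assoc, mul_comm (koszul (b.map Prod.fst)).negOnePow]
    exact hs

end PsiAlgebra

/-! ### The complex and the `A_∞`-algebra of Hochschild cochains. -/

section Cochains

variable {K : Type*} [Field K] {A : Type*} [AddCommGroup A] [Module K A]
  {𝒜 : ℤ → Submodule K A} [DirectSum.Decomposition 𝒜] (S : HAInfAlgebra K A 𝒜)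

namespace HAInfAlgebra

lemma cochainBracket_mem {p q : ℤ} {x y : List A → A} (hx : x ∈ S.C p) (hy : y ∈ S.C q) :
    S.cochainBracket p q x y ∈ S.C (p + q - 1) := by
  have := bracket_mem S.susp_α hx hy
  rwa [show -(p - 1) + -(q - 1) = -(p + q - 1 - 1) by ring] at this

lemma coderLift_cochainBracket {p q : ℤ} (x : S.C p) (y : S.C q)
    (h : S.cochainBracket p q x y ∈ S.C (p + q - 1)) :
    coderLift (susp 𝒜) S.α (-(p + q - 1 - 1)) ⟨S.cochainBracket p q x y, h⟩ =
      coderLift (susp 𝒜) S.α (-(p - 1)) x ∘ₗ coderLift (susp 𝒜) S.α (-(q - 1)) y -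
        ((p - 1) * (q - 1)).negOnePow •
          (coderLift (susp 𝒜) S.α (-(q - 1)) y ∘ₗ coderLift (susp 𝒜) S.α (-(p - 1)) x) := by
  have := coderLift_bracket S.susp_α x y (bracket_mem S.susp_α x.2 y.2)
  rw [neg_mul_neg] at this
  rw [← this]
  exact coderLift_congr (by ring) _ _

lemma δ_mem {p : ℤ} (x : S.C p) : S.δ p x ∈ S.C (p + 1) := by
  have := bracket_mem S.susp_α S.D_mem x.2
  rwa [show -1 + -(p - 1) = -(p + 1 - 1) by ring] at this

/-- This is the `A_∞`-relation with a single input. -/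
lemma bracket_D_bracket_D {d : ℤ} {x : List A → A} (hx : x ∈ Coder (susp 𝒜) S.α d) :
    bracket (susp 𝒜) S.α (-1) S.D (-1 + d) (bracket (susp 𝒜) S.α (-1) S.D d x) = 0 := by
  have := psi_relation S.susp_α S.D_mem S.brace_D_D (isCoders_singleton hx) (by simp)
  simpa [split_cons, split_nil, psi_singleton] using this

lemma δ_δ {p : ℤ} (x : S.C p) : S.δ (p + 1) ⟨S.δ p x, S.δ_mem x⟩ = 0 := by
  have := S.bracket_D_bracket_D x.2
  rwa [show -1 + -(p - 1) = -(p + 1 - 1) by ring] at this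

lemma ψ_eq_psi {k : ℕ} (hk : 1 ≤ k) (p : Fin k → ℤ) (x : (j : Fin k) → S.C (p j)) :
    S.ψ k p x =
      psi (susp 𝒜) S.α S.D (List.ofFn fun j => (-(p j - 1), (x j : List A → A))) := by
  match k, hk with
  | 1, _ =>
    rw [List.ofFn_succ, List.ofFn_zero, psi_singleton]
    rfl
  | k + 2, _ =>
    rw [ψ, List.ofFn_succ, List.ofFn_succ, psi_cons_cons]

/-- A linear map that sends a coderivation of degree `d` to the cochain that it is. -/
def incl (d : ℤ) : (List A → A) →ₗ[K] ⨁ p, S.C p :=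
  -- Extending from the subspace to all functions on words makes `incl d` linear without membership
  -- proofs in its arguments; only its values on coderivations of degree `d` matter.
  (LinearMap.exists_extend (V' := ⨁ p, S.C p)
    (DirectSum.lof K ℤ (fun p => S.C p) (1 - d))).choose

lemma incl_eq {d p : ℤ} (h : p = 1 - d) {x : List A → A} (hx : x ∈ S.C p) :
    S.incl d x = DirectSum.lof K ℤ (fun p => S.C p) p ⟨x, hx⟩ := by
  subst h
  exact LinearMap.congr_fun (LinearMap.exists_extend (V' := ⨁ p, S.C p)
    (DirectSum.lof K ℤ (fun p => S.C p) (1 - d))).choose_spec ⟨x, hx⟩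

lemma incl_mem {d i : ℤ} (h : d = i + 1) {x : List A → A} (hx : x ∈ Coder (susp 𝒜) S.α d) :
    S.incl d x ∈ S.cochainGrading i := by
  subst h
  have hx' : x ∈ S.C (-i) := by rwa [C, show -(-i - 1) = i + 1 by ring]
  rw [S.incl_eq (by ring) hx']
  exact LinearMap.mem_range_self _ _

lemma exists_incl {i : ℤ} {a : ⨁ p, S.C p} (ha : a ∈ S.cochainGrading i) :
    ∃ x ∈ Coder (susp 𝒜) S.α (i + 1), a = S.incl (i + 1) x := by
  obtain ⟨x, rfl⟩ := ha
  have : (x : List A → A) ∈ Coder (susp 𝒜) S.α (-(-i - 1)) := x.2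
  rw [show -(-i - 1) = i + 1 by ring] at this
  exact ⟨x, this, (S.incl_eq (by ring) x.2).symm⟩

/-- The pairs of a degree and a coderivation that belong to a family of cochains. -/
def toPairs {k : ℕ} (p : Fin k → ℤ) (x : (j : Fin k) → S.C (p j)) : List (ℤ × (List A → A)) :=
  List.ofFn fun j => (-(p j - 1), (x j : List A → A))

lemma toPairs_update {k : ℕ} [DecidableEq (Fin k)] (p : Fin k → ℤ) (x : (j : Fin k) → S.C (p j))
    (j : Fin k) (y : S.C (p j)) : S.toPairs p (Function.update x j y) =
      (S.toPairs p x).take j ++ (-(p j - 1), (y : List A → A)) :: (S.toPairs p x).drop (j + 1) := by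
  rw [toPairs, toPairs, ← ofFn_update]
  congr 1
  funext i
  by_cases h : i = j
  · subst h
    simp
  · simp [h]

/-- The operations of the `A_∞`-algebra of cochains. -/
def cochainOp : (k : ℕ) → MultilinearMap K (fun _ : Fin k => ⨁ p, S.C p) (⨁ p, S.C p)
  | 0 => 0
  | k + 1 => MultilinearMap.fromDirectSumEquiv (M := fun (_ : Fin (k + 1)) p => S.C p) fun p =>
    { toFun := fun x => (koszul (List.ofFn fun j => -(p j - 1))).negOnePow •
        S.incl (-1 + (List.ofFn fun j => -(p j - 1)).sum) (psi (susp 𝒜) S.α S.D (S.toPairs p x))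
      map_update_add' := fun x j y z => by
        simp only [toPairs_update, Submodule.coe_add, psi_slot_add S.susp_α S.D_mem.2.1, map_add,
          smul_add]
      map_update_smul' := fun x j r y => by
        simp only [toPairs_update, Submodule.coe_smul, psi_slot_smul S.susp_α S.D_mem.2.1,
          map_smul]
        rw [smul_comm] }

lemma cochainOp_lof {k : ℕ} (hk : 1 ≤ k) (p : Fin k → ℤ) (x : (j : Fin k) → S.C (p j)) :
    S.cochainOp k (fun j => DirectSum.lof K ℤ (fun p => S.C p) (p j) (x j)) =
      (koszul (List.ofFn fun j => -(p j - 1))).negOnePow •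
        S.incl (-1 + (List.ofFn fun j => -(p j - 1)).sum)
          (psi (susp 𝒜) S.α S.D (S.toPairs p x)) := by
  match k, hk with
  | k + 1, _ =>
    exact MultilinearMap.fromDirectSumEquiv_lof (M := fun (_ : Fin (k + 1)) p => S.C p) _ p x

lemma onWords_cochainOp {X : List (ℤ × (List A → A))} (hX : IsCoders (susp 𝒜) S.α X)
    (hX0 : X ≠ []) : onWords S.cochainOp (X.map fun x => S.incl x.1 x.2) =
      (koszul (X.map Prod.fst)).negOnePow •
        S.incl (-1 + deg X) (psi (susp 𝒜) S.α S.D X) := by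
  have hmem : ∀ j : Fin X.length, (X.get j).2 ∈ S.C (1 - (X.get j).1) := fun j => by
    rw [C, show ∀ d : ℤ, -(1 - d - 1) = d by intro d; ring]
    exact hX _ (List.get_mem _ _)
  have h := S.cochainOp_lof (List.length_pos_iff.2 hX0) (fun j => 1 - (X.get j).1)
    (fun j => ⟨(X.get j).2, hmem j⟩)
  have hd : ∀ d : ℤ, -(1 - d - 1) = d := fun d => by ring
  have h1 : S.toPairs (fun j => 1 - (X.get j).1) (fun j => ⟨(X.get j).2, hmem j⟩) = X := by
    simp only [toPairs, hd]
    exact List.ofFn_get X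
  have h2 : (List.ofFn fun j => -(1 - (X.get j).1 - 1)) = X.map Prod.fst := by
    simp only [hd]
    exact List.ext_getElem (by simp) fun i h1 h2 => by simp
  rw [h1, h2] at h
  refine Eq.trans ?_ ((onWords_ofFn S.cochainOp _).trans h)
  congr 1
  refine List.ext_getElem (by simp) fun i h1 h2 => ?_
  simp only [List.getElem_map, List.getElem_ofFn, List.get_eq_getElem]
  exact S.incl_eq rfl _

/-- The `A_∞`-algebra of Hochschild cochains. -/
def cochainAlgebra : HAInfAlgebra K (⨁ p, S.C p) S.cochainGrading :=
  psiAlgebra S.susp_α S.D_mem S.brace_D_D S.cochainOp rfl S.incl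
    (fun _ _ hx => S.incl_mem rfl hx) (fun _ _ ha => S.exists_incl ha)
    (fun _ hX hX0 => S.onWords_cochainOp hX hX0)

lemma cochainAlgebra_μ {k : ℕ} (hk : 1 ≤ k) (p : Fin k → ℤ) (x : (j : Fin k) → S.C (p j)) :
    ∃ h : S.ψ k p x ∈ S.C (∑ j, p j + 2 - k),
      S.cochainAlgebra.μ k (fun j => DirectSum.lof K ℤ (fun p => S.C p) (p j) (x j)) =
        (∑ j : Fin k, ((k : ℤ) - 1 - (j : ℕ)) * (p j - 1)).negOnePow •
          DirectSum.lof K ℤ (fun p => S.C p) (∑ j, p j + 2 - k) ⟨S.ψ k p x, h⟩ := by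
  have hX : IsCoders (susp 𝒜) S.α (S.toPairs p x) := by
    intro y hy
    rw [toPairs, List.mem_ofFn] at hy
    obtain ⟨j, rfl⟩ := hy
    exact (x j).2
  have hψ : S.ψ k p x = psi (susp 𝒜) S.α S.D (S.toPairs p x) := S.ψ_eq_psi hk p x
  have hsum : (List.ofFn fun j => -(p j - 1)).sum = k - ∑ j, p j := by
    rw [List.sum_ofFn, Finset.sum_neg_distrib, Finset.sum_sub_distrib]
    simp
  have hdeg : deg (S.toPairs p x) = k - ∑ j, p j := by
    rw [← hsum, deg, toPairs, List.map_ofFn]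
    rfl
  have h : S.ψ k p x ∈ S.C (∑ j, p j + 2 - k) := by
    have := psi_mem S.susp_α S.D_mem hX
    rw [hdeg] at this
    rwa [hψ, C, show -(∑ j, p j + 2 - (k : ℤ) - 1) = -1 + (k - ∑ j, p j) by ring]
  refine ⟨h, (S.cochainOp_lof hk p x).trans ?_⟩
  rw [← hψ, hsum, S.incl_eq (p := ∑ j, p j + 2 - (k : ℤ)) (by ring) h, koszul_ofFn]
  -- The Koszul exponent is formed from `-(p_j - 1)`, the stated one from `p_j - 1`; they have the
  -- same parity.
  simp only [mul_neg, Finset.sum_neg_distrib, Int.negOnePow_neg]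

end HAInfAlgebra

end Cochains

/-! ### Identities between classes of cocycles. -/

section Cocycles

variable {K : Type*} [Field K] {V : Type*} [AddCommGroup V] [Module K V]
  {𝒱 : ℤ → Submodule K V} [DirectSum.Decomposition 𝒱] {α : V →ₗ[K] V} {D : List V → V}

variable (𝒱 α D) in
/-- `x` is a coderivation of degree `d` with `[D, x] = 0`. -/
def IsCocycle (d : ℤ) (x : List V → V) : Prop :=
  x ∈ Coder 𝒱 α d ∧ bracket 𝒱 α (-1) D d x = 0

/-- `[D, -]` is a derivation of the product, up to signs. -/
lemma bracket_brace_D (hα : ∀ i, ∀ a ∈ 𝒱 i, α a ∈ 𝒱 i) (hD : D ∈ Coder 𝒱 α (-1))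
    (hDD : brace 𝒱 α D [(-1, D)] = 0) {d e : ℤ} {x y : List V → V} (hx : x ∈ Coder 𝒱 α d)
    (hy : y ∈ Coder 𝒱 α e) :
    bracket 𝒱 α (-1) D (-1 + d + e) (brace 𝒱 α D [(d, x), (e, y)]) =
      -brace 𝒱 α D [(-1 + d, bracket 𝒱 α (-1) D d x), (e, y)] -
        d.negOnePow • brace 𝒱 α D [(d, x), (-1 + e, bracket 𝒱 α (-1) D e y)] := by
  have h := psi_relation (X := [(d, x), (e, y)]) hα hD hDD
    (isCoders_cons.2 ⟨hx, isCoders_singleton hy⟩) (by simp)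
  simp only [split_cons, split_nil, deg_nil, deg_cons, List.nil_append, List.cons_append,
    List.length_nil, List.length_cons, psi_singleton, psi_cons_cons, add_zero, Int.negOnePow_zero,
    one_smul, if_true, zero_add, if_false, add_eq_zero, one_ne_zero,
    and_false, ← add_assoc] at h
  rw [← sub_eq_zero, ← h]
  abel

lemma bracket_zero_right (hα : ∀ i, ∀ a ∈ 𝒱 i, α a ∈ 𝒱 i) {x : List V → V} (hx : IsMultilinear K x)
    (d e : ℤ) : bracket 𝒱 α d x e 0 = 0 := by
  have h1 := brace_slot_zero hα hx [] [] e
  have h2 : brace 𝒱 α (0 : List V → V) [(d, x)] = 0 := by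
    simpa using brace_smul_left 𝒱 α (0 : K) x [(d, x)]
  rw [List.nil_append] at h1
  rw [bracket, h1, h2, smul_zero, sub_zero]

lemma bracket_zero_left (hα : ∀ i, ∀ a ∈ 𝒱 i, α a ∈ 𝒱 i) {y : List V → V} (hy : IsMultilinear K y)
    (d e : ℤ) : bracket 𝒱 α d 0 e y = 0 := by
  rw [bracket_skew, bracket_zero_right hα hy, smul_zero, neg_zero]

lemma isCocycle_brace (hα : ∀ i, ∀ a ∈ 𝒱 i, α a ∈ 𝒱 i) (hD : D ∈ Coder 𝒱 α (-1))
    (hDD : brace 𝒱 α D [(-1, D)] = 0) {d e : ℤ} {x y : List V → V} (hx : IsCocycle 𝒱 α D d x)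
    (hy : IsCocycle 𝒱 α D e y) :
    IsCocycle 𝒱 α D (-1 + d + e) (brace 𝒱 α D [(d, x), (e, y)]) := by
  refine ⟨brace_pair_mem hα hD hx.1 hy.1, ?_⟩
  have h1 := brace_slot_zero hα hD.2.1 [] [(e, y)] (-1 + d)
  have h2 := brace_slot_zero hα hD.2.1 [(d, x)] [] (-1 + e)
  simp only [List.nil_append, List.cons_append] at h1 h2
  rw [bracket_brace_D hα hD hDD hx.1 hy.1, hx.2, hy.2, h1, h2, smul_zero, neg_zero, sub_zero]

lemma isCocycle_bracket (hα : ∀ i, ∀ a ∈ 𝒱 i, α a ∈ 𝒱 i) (hD : D ∈ Coder 𝒱 α (-1))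
    {d e : ℤ} {x y : List V → V} (hx : IsCocycle 𝒱 α D d x) (hy : IsCocycle 𝒱 α D e y) :
    IsCocycle 𝒱 α D (d + e) (bracket 𝒱 α d x e y) := by
  refine ⟨bracket_mem hα hx.1 hy.1, ?_⟩
  rw [bracket_jacobi hα hD hx.1 hy.1, hx.2, hy.2, bracket_zero_right hα hx.1.2.1,
    bracket_zero_left hα hy.1.2.1, smul_zero, add_zero]

section Classes

variable {W : Type*} [AddCommGroup W] [Module K W] {cl : ℤ → (List V → V) →ₗ[K] W}

/-- For a cocycle `y`, the two-input relation gives `[D, {D}{u, y}] = -{D}{[D, u], y}`. In this and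
the next lemmas `cl` is any family of linear maps that kills boundaries. -/
lemma class_brace_boundary_left (hα : ∀ i, ∀ a ∈ 𝒱 i, α a ∈ 𝒱 i) (hD : D ∈ Coder 𝒱 α (-1))
    (hDD : brace 𝒱 α D [(-1, D)] = 0)
    (hcl : ∀ d, ∀ u ∈ Coder 𝒱 α d, cl (-1 + d) (bracket 𝒱 α (-1) D d u) = 0) {d e : ℤ}
    {u y : List V → V} (hu : u ∈ Coder 𝒱 α d) (hy : IsCocycle 𝒱 α D e y) :
    cl (-1 + (-1 + d) + e) (brace 𝒱 α D [(-1 + d, bracket 𝒱 α (-1) D d u), (e, y)]) = 0 := by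
  have h := hcl _ _ (brace_pair_mem hα hD hu hy.1)
  have h2 := brace_slot_zero hα hD.2.1 [(d, u)] [] (-1 + e)
  simp only [List.cons_append, List.nil_append] at h2
  rw [bracket_brace_D hα hD hDD hu hy.1, hy.2, h2, smul_zero, sub_zero, map_neg, neg_eq_zero] at h
  rw [← h]
  congr 2
  ring

lemma class_brace_boundary_right (hα : ∀ i, ∀ a ∈ 𝒱 i, α a ∈ 𝒱 i) (hD : D ∈ Coder 𝒱 α (-1))
    (hDD : brace 𝒱 α D [(-1, D)] = 0)
    (hcl : ∀ d, ∀ u ∈ Coder 𝒱 α d, cl (-1 + d) (bracket 𝒱 α (-1) D d u) = 0) {d e : ℤ}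
    {x u : List V → V} (hx : IsCocycle 𝒱 α D d x) (hu : u ∈ Coder 𝒱 α e) :
    cl (-1 + d + (-1 + e)) (brace 𝒱 α D [(d, x), (-1 + e, bracket 𝒱 α (-1) D e u)]) = 0 := by
  have h := hcl _ _ (brace_pair_mem hα hD hx.1 hu)
  have h2 := brace_slot_zero hα hD.2.1 [] [(e, u)] (-1 + d)
  simp only [List.nil_append] at h2
  rw [bracket_brace_D hα hD hDD hx.1 hu, hx.2, h2, neg_zero, zero_sub, map_neg, neg_eq_zero,
    LinearMap.map_smul_of_tower, smul_eq_zero_iff_eq] at h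
  rw [← h]
  congr 2
  ring

/-- By the Jacobi identity and `[D, x] = 0`, the bracket `[x, [D, u]]` is `[D, [x, u]]` up to sign.
-/
lemma class_bracket_boundary_right (hα : ∀ i, ∀ a ∈ 𝒱 i, α a ∈ 𝒱 i) (hD : D ∈ Coder 𝒱 α (-1))
    (hcl : ∀ d, ∀ u ∈ Coder 𝒱 α d, cl (-1 + d) (bracket 𝒱 α (-1) D d u) = 0) {d e : ℤ}
    {x u : List V → V} (hx : IsCocycle 𝒱 α D d x) (hu : u ∈ Coder 𝒱 α e) :
    cl (d + (-1 + e)) (bracket 𝒱 α d x (-1 + e) (bracket 𝒱 α (-1) D e u)) = 0 := by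
  have h := hcl _ _ (bracket_mem hα hx.1 hu)
  rw [bracket_jacobi hα hD hx.1 hu, hx.2, bracket_zero_left hα hu.2.1, zero_add,
    LinearMap.map_smul_of_tower, smul_eq_zero_iff_eq] at h
  rw [← h]
  congr 2
  ring

lemma class_bracket_boundary_left (hα : ∀ i, ∀ a ∈ 𝒱 i, α a ∈ 𝒱 i) (hD : D ∈ Coder 𝒱 α (-1))
    (hcl : ∀ d, ∀ u ∈ Coder 𝒱 α d, cl (-1 + d) (bracket 𝒱 α (-1) D d u) = 0) {d e : ℤ}
    {u y : List V → V} (hu : u ∈ Coder 𝒱 α d) (hy : IsCocycle 𝒱 α D e y) :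
    cl (-1 + d + e) (bracket 𝒱 α (-1 + d) (bracket 𝒱 α (-1) D d u) e y) = 0 := by
  rw [bracket_skew, map_neg, LinearMap.map_smul_of_tower, add_comm (-1 + d) e,
    class_bracket_boundary_right hα hD hcl hy hu, smul_zero, neg_zero]

/-- The three-input relation: terms with `[D, x]`, `[D, y]` or `[D, z]` vanish, `[D, {D}{x, y, z}]`
is a boundary, and the two double products remain. -/
lemma class_assoc (hα : ∀ i, ∀ a ∈ 𝒱 i, α a ∈ 𝒱 i) (hD : D ∈ Coder 𝒱 α (-1))
    (hDD : brace 𝒱 α D [(-1, D)] = 0)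
    (hcl : ∀ d, ∀ u ∈ Coder 𝒱 α d, cl (-1 + d) (bracket 𝒱 α (-1) D d u) = 0) {d e g : ℤ}
    {x y z : List V → V} (hx : IsCocycle 𝒱 α D d x) (hy : IsCocycle 𝒱 α D e y)
    (hz : IsCocycle 𝒱 α D g z) :
    cl (-1 + (-1 + d + e) + g) (brace 𝒱 α D [(-1 + d + e, brace 𝒱 α D [(d, x), (e, y)]), (g, z)]) =
      -(d.negOnePow • cl (-1 + d + (-1 + e + g))
        (brace 𝒱 α D [(d, x), (-1 + e + g, brace 𝒱 α D [(e, y), (g, z)])])) := by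
  have hX : IsCoders 𝒱 α [(d, x), (e, y), (g, z)] :=
    isCoders_cons.2 ⟨hx.1, isCoders_cons.2 ⟨hy.1, isCoders_singleton hz.1⟩⟩
  have h := psi_relation hα hD hDD hX (by simp)
  have h1 := brace_slot_zero hα hD.2.1 [] [(e, y), (g, z)] (-1 + d)
  have h2 := brace_slot_zero hα hD.2.1 [(d, x)] [(g, z)] (-1 + e)
  have h3 := brace_slot_zero hα hD.2.1 [(d, x), (e, y)] [] (-1 + g)
  have h4 := hcl _ _ (psi_mem hα hD hX)
  simp only [List.nil_append, List.cons_append] at h1 h2 h3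
  simp only [split_cons, split_nil, deg_nil, deg_cons, List.nil_append, List.cons_append,
    List.length_nil, List.length_cons, psi_singleton, psi_cons_cons, add_zero, Int.negOnePow_zero,
    one_smul, if_true, zero_add, if_false, add_eq_zero, one_ne_zero,
    and_false, ← add_assoc, hx.2, hy.2, hz.2, h1, h2, h3, smul_zero] at h h4
  have h5 := congrArg (cl (-1 + -1 + d + e + g)) h
  simp only [map_add, map_zero, LinearMap.map_smul_of_tower, h4] at h5
  rw [eq_neg_iff_add_eq_zero, ← h5]
  simp only [← add_assoc, add_zero, show -1 + d + -1 + e + g = -1 + -1 + d + e + g by ring]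

/-- For cocycles, `[D, {x}{y}]` is minus the graded symmetrization of the product. -/
lemma class_comm (hα : ∀ i, ∀ a ∈ 𝒱 i, α a ∈ 𝒱 i) (hD : D ∈ Coder 𝒱 α (-1))
    (hcl : ∀ d, ∀ u ∈ Coder 𝒱 α d, cl (-1 + d) (bracket 𝒱 α (-1) D d u) = 0) {d e : ℤ}
    {x y : List V → V} (hx : IsCocycle 𝒱 α D d x) (hy : IsCocycle 𝒱 α D e y) :
    cl (-1 + d + e) (brace 𝒱 α D [(d, x), (e, y)]) =
      -((d * e).negOnePow • cl (-1 + e + d) (brace 𝒱 α D [(e, y), (d, x)])) := by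
  have h := hcl _ _ (brace_singleton_mem hα hx.1 hy.1)
  have h1 := brace_slot_zero hα hx.1.2.1 [] [] (-1 + e)
  have h2 : brace 𝒱 α (0 : List V → V) [(e, y)] = 0 := by
    simpa using brace_smul_left 𝒱 α (0 : K) x [(e, y)]
  rw [List.nil_append] at h1
  rw [bracket_brace hα hD hx.1 hy.1, hx.2, hy.2, h1, h2, smul_zero, zero_add, zero_sub, map_sub,
    map_neg, LinearMap.map_smul_of_tower] at h
  rw [show -1 + e + d = -1 + (d + e) by ring, add_assoc, eq_neg_iff_add_eq_zero, ← neg_eq_zero, ← h]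
  abel

/-- For cocycles, `[D, {x}{y, z}]` is the deviation from the Leibniz rule; the bracket enters with
the sign of moving `x` past `D`. -/
lemma class_leibniz (hα : ∀ i, ∀ a ∈ 𝒱 i, α a ∈ 𝒱 i) (hD : D ∈ Coder 𝒱 α (-1))
    (hcl : ∀ d, ∀ u ∈ Coder 𝒱 α d, cl (-1 + d) (bracket 𝒱 α (-1) D d u) = 0) {d e g : ℤ}
    {x y z : List V → V} (hx : IsCocycle 𝒱 α D d x) (hy : IsCocycle 𝒱 α D e y)
    (hz : IsCocycle 𝒱 α D g z) :
    d.negOnePow • cl (d + (-1 + e + g))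
        (bracket 𝒱 α d x (-1 + e + g) (brace 𝒱 α D [(e, y), (g, z)])) =
      cl (-1 + (d + e) + g) (brace 𝒱 α D [(d + e, bracket 𝒱 α d x e y), (g, z)]) +
      (d * e).negOnePow • cl (-1 + e + (d + g))
        (brace 𝒱 α D [(e, y), (d + g, bracket 𝒱 α d x g z)]) := by
  have h := hcl _ _ (brace_pair_mem hα hx.1 hy.1 hz.1)
  have h1 := brace_slot_zero hα hx.1.2.1 [] [(g, z)] (-1 + e)
  have h3 := brace_slot_zero hα hx.1.2.1 [(e, y)] [] (-1 + g)
  have h2 : brace 𝒱 α (0 : List V → V) [(e, y), (g, z)] = 0 := by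
    simpa using brace_smul_left 𝒱 α (0 : K) x [(e, y), (g, z)]
  simp only [List.nil_append, List.cons_append] at h1 h3
  rw [add_assoc d e g, bracket_brace_pair hα hD hx.1 hy.1 hz.1, hx.2, hy.2, hz.2, h1, h2, h3,
    smul_zero, smul_zero, zero_add, zero_add, zero_add] at h
  simp only [map_sub, LinearMap.map_smul_of_tower] at h
  rw [show d + (-1 + e + g) = -1 + (d + (e + g)) by ring, add_assoc (-1) e g,
    show -1 + (d + e) + g = -1 + (d + (e + g)) by ring,
    show -1 + e + (d + g) = -1 + (d + (e + g)) by ring, ← sub_eq_zero, ← h]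
  abel

end Classes

end Cocycles

/-! ### Bilinear maps on quotients and on direct sums. -/

section Descent

variable {K : Type*} [Field K]

/-- The bilinear map of quotients induced by a bilinear map. -/
def quotientLift₂ {M N W : Type*} [AddCommGroup M] [Module K M] [AddCommGroup N] [Module K N]
    [AddCommGroup W] [Module K W] (P : Submodule K M) (Q : Submodule K N) (β : M →ₗ[K] N →ₗ[K] W)
    (h₁ : ∀ x ∈ P, ∀ y, β x y = 0) (h₂ : ∀ x, ∀ y ∈ Q, β x y = 0) :
    (M ⧸ P) →ₗ[K] (N ⧸ Q) →ₗ[K] W :=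
  (Q.liftQ (P.liftQ β fun x hx => LinearMap.ext (h₁ x hx)).flip fun y hy => by
    refine LinearMap.ext fun x => ?_
    obtain ⟨x, rfl⟩ := P.mkQ_surjective x
    exact h₂ x y hy).flip

/-- The bilinear map on a direct sum with given components. -/
def directSumLift₂ {ι : Type*} [DecidableEq ι] {H : ι → Type*} [∀ p, AddCommGroup (H p)]
    [∀ p, Module K (H p)] {W : Type*} [AddCommGroup W] [Module K W]
    (γ : ∀ p q, H p →ₗ[K] H q →ₗ[K] W) : (⨁ p, H p) →ₗ[K] (⨁ p, H p) →ₗ[K] W :=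
  DirectSum.toModule K ι _ fun p => (DirectSum.toModule K ι _ fun q => (γ p q).flip).flip

lemma directSumLift₂_lof {ι : Type*} [DecidableEq ι] {H : ι → Type*} [∀ p, AddCommGroup (H p)]
    [∀ p, Module K (H p)] {W : Type*} [AddCommGroup W] [Module K W]
    (γ : ∀ p q, H p →ₗ[K] H q →ₗ[K] W) (p q : ι) (x : H p) (y : H q) :
    directSumLift₂ γ (DirectSum.lof K ι H p x) (DirectSum.lof K ι H q y) = γ p q x y := by
  simp [directSumLift₂]

/-- The direct sum of a family of vector spaces. -/
abbrev GradedSum (H : ℤ → Type*) [∀ p, AddCommGroup (H p)] : Type _ := ⨁ p, H p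

/-- A linear map on `M` that is `π (1 - d)` on the subspace `Z (1 - d)`. -/
def gradedExtend {M : Type*} [AddCommGroup M] [Module K M] {H : ℤ → Type*}
    [∀ p, AddCommGroup (H p)] [∀ p, Module K (H p)] {Z : ℤ → Submodule K M}
    (π : ∀ p, Z p →ₗ[K] H p) (d : ℤ) : M →ₗ[K] GradedSum H :=
  (LinearMap.exists_extend (V' := GradedSum H)
    (DirectSum.lof K ℤ H (1 - d) ∘ₗ π (1 - d))).choose

/-- On `Z p` the value does not depend on the chosen extension. Keeping `d` and `p` as separate
variables with an equation turns changes of degree into arithmetic instead of transport. -/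
lemma gradedExtend_eq {M : Type*} [AddCommGroup M] [Module K M] {H : ℤ → Type*}
    [∀ p, AddCommGroup (H p)] [∀ p, Module K (H p)] {Z : ℤ → Submodule K M}
    (π : ∀ p, Z p →ₗ[K] H p) {d p : ℤ} (h : d = 1 - p) {x : M} (hx : x ∈ Z p) :
    gradedExtend π d x = DirectSum.lof K ℤ H p (π p ⟨x, hx⟩) := by
  obtain rfl : p = 1 - d := by omega
  exact LinearMap.congr_fun (LinearMap.exists_extend (V' := GradedSum H)
    (DirectSum.lof K ℤ H (1 - d) ∘ₗ π (1 - d))).choose_spec ⟨x, hx⟩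

end Descent

/-! ### The Gerstenhaber algebra of classes. -/

section Gerstenhaber

variable {K : Type*} [Field K] {V : Type*} [AddCommGroup V] [Module K V]
  {𝒱 : ℤ → Submodule K V} [DirectSum.Decomposition 𝒱] {α : V →ₗ[K] V} {D : List V → V}

lemma class_induction {H : ℤ → Type*} [∀ p, AddCommGroup (H p)] [∀ p, Module K (H p)]
    {cl : ℤ → (List V → V) →ₗ[K] ⨁ p, H p}
    (hsurj : ∀ p (a : H p), ∃ x, IsCocycle 𝒱 α D (1 - p) x ∧
      DirectSum.lof K ℤ H p a = cl (1 - p) x) {P : (⨁ p, H p) → Prop} (h0 : P 0)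
    (hadd : ∀ a b, P a → P b → P (a + b)) (hP : ∀ d x, IsCocycle 𝒱 α D d x → P (cl d x))
    (a : ⨁ p, H p) : P a := by
  refine DirectSum.induction_on a h0 (fun p a => ?_) hadd
  obtain ⟨x, hx, hxa⟩ := hsurj p a
  rw [← DirectSum.lof_eq_of K, hxa]
  exact hP _ _ hx

/-- The Gerstenhaber algebra of classes of coderivations that commute with `D`. -/
def gerstenhaberOfClasses (hα : ∀ i, ∀ a ∈ 𝒱 i, α a ∈ 𝒱 i) (hD : D ∈ Coder 𝒱 α (-1))
    (hDD : brace 𝒱 α D [(-1, D)] = 0) {H : ℤ → Type*} [∀ p, AddCommGroup (H p)]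
    [∀ p, Module K (H p)] (cl : ℤ → (List V → V) →ₗ[K] ⨁ p, H p)
    (hcl : ∀ d, ∀ u ∈ Coder 𝒱 α d, cl (-1 + d) (bracket 𝒱 α (-1) D d u) = 0)
    (hrange : ∀ d x, IsCocycle 𝒱 α D d x → cl d x ∈ LinearMap.range (DirectSum.lof K ℤ H (1 - d)))
    (hsurj : ∀ p (a : H p), ∃ x, IsCocycle 𝒱 α D (1 - p) x ∧
      DirectSum.lof K ℤ H p a = cl (1 - p) x)
    (mul br : (⨁ p, H p) →ₗ[K] (⨁ p, H p) →ₗ[K] (⨁ p, H p))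
    (hmul : ∀ d e x y, IsCocycle 𝒱 α D d x → IsCocycle 𝒱 α D e y → mul (cl d x) (cl e y) =
      d.negOnePow • cl (-1 + d + e) (brace 𝒱 α D [(d, x), (e, y)]))
    (hbr : ∀ d e x y, IsCocycle 𝒱 α D d x → IsCocycle 𝒱 α D e y → br (cl d x) (cl e y) =
      cl (d + e) (bracket 𝒱 α d x e y)) : GerstenhaberAlgebra K H where
  mul := mul
  bracket := br
  mul_degree p q a b := by
    obtain ⟨x, hx, hxa⟩ := hsurj p a
    obtain ⟨y, hy, hyb⟩ := hsurj q b
    rw [hxa, hyb, hmul _ _ _ _ hx hy]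
    have := hrange _ _ (isCocycle_brace hα hD hDD hx hy)
    rw [show 1 - (-1 + (1 - p) + (1 - q)) = p + q by ring] at this
    exact Submodule.smul_of_tower_mem _ _ this
  bracket_degree p q a b := by
    obtain ⟨x, hx, hxa⟩ := hsurj p a
    obtain ⟨y, hy, hyb⟩ := hsurj q b
    rw [hxa, hyb, hbr _ _ _ _ hx hy]
    have := hrange _ _ (isCocycle_bracket hα hD hx hy)
    rwa [show 1 - (1 - p + (1 - q)) = p + q - 1 by ring] at this
  mul_assoc a b c := by
    refine class_induction (P := fun a => mul (mul a b) c = mul a (mul b c)) hsurj (by simp)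
      (fun a a' h h' => by simp only [map_add, LinearMap.add_apply, h, h']) (fun d x hx => ?_) a
    refine class_induction (P := fun b => mul (mul (cl d x) b) c = mul (cl d x) (mul b c)) hsurj
      (by simp) (fun b b' h h' => by simp only [map_add, LinearMap.add_apply, h, h'])
      (fun e y hy => ?_) b
    refine class_induction (P := fun c => mul (mul (cl d x) (cl e y)) c =
      mul (cl d x) (mul (cl e y) c)) hsurj (by simp)
      (fun c c' h h' => by simp only [map_add, h, h']) (fun g z hz => ?_) c
    rw [hmul _ _ _ _ hx hy, hmul _ _ _ _ hy hz, LinearMap.map_smul_of_tower,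
      LinearMap.map_smul_of_tower, LinearMap.smul_apply,
      hmul _ _ _ _ (isCocycle_brace hα hD hDD hx hy) hz,
      hmul _ _ _ _ hx (isCocycle_brace hα hD hDD hy hz), class_assoc hα hD hDD hcl hx hy hz]
    -- The factors `(-1)^d` in the product absorb the sign of `class_assoc`, turning associativity
    -- in suspended degrees into strict associativity.
    simp only [Int.negOnePow_add, Int.negOnePow_neg, Int.negOnePow_one]
    rcases Int.units_eq_one_or d.negOnePow with h1 | h1 <;>
    rcases Int.units_eq_one_or e.negOnePow with h2 | h2 <;>
    simp only [h1, h2, one_smul, Units.neg_smul, smul_neg, mul_one, mul_neg, neg_neg]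
  mul_comm p q a b := by
    obtain ⟨d, rfl⟩ : ∃ d, p = 1 - d := ⟨1 - p, by ring⟩
    obtain ⟨e, rfl⟩ : ∃ e, q = 1 - e := ⟨1 - q, by ring⟩
    obtain ⟨x, hx, hxa⟩ := hsurj _ a
    obtain ⟨y, hy, hyb⟩ := hsurj _ b
    rw [sub_sub_cancel] at hx hy hxa hyb
    rw [hxa, hyb, hmul _ _ _ _ hx hy, hmul _ _ _ _ hy hx, class_comm hα hD hcl hx hy,
      show (1 - d) * (1 - e) = 1 - d - e + d * e by ring]
    simp only [Int.negOnePow_add, Int.negOnePow_sub, Int.negOnePow_one]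
    rcases Int.units_eq_one_or (d * e).negOnePow with h1 | h1 <;>
    rcases Int.units_eq_one_or d.negOnePow with h2 | h2 <;>
    rcases Int.units_eq_one_or e.negOnePow with h3 | h3 <;>
    simp only [h1, h2, h3, one_smul, Units.neg_smul, smul_neg, mul_one, mul_neg, neg_neg]
  bracket_skew p q a b := by
    obtain ⟨x, hx, hxa⟩ := hsurj p a
    obtain ⟨y, hy, hyb⟩ := hsurj q b
    rw [hxa, hyb, hbr _ _ _ _ hx hy, hbr _ _ _ _ hy hx, bracket_skew, map_neg,
      LinearMap.map_smul_of_tower, add_comm (1 - p),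
      show (1 - p) * (1 - q) = (p - 1) * (q - 1) by ring]
  jacobi p q a b c := by
    obtain ⟨x, hx, hxa⟩ := hsurj p a
    obtain ⟨y, hy, hyb⟩ := hsurj q b
    rw [hxa, hyb, hbr _ _ _ _ hx hy]
    refine class_induction (P := fun c => br (cl (1 - p) x) (br (cl (1 - q) y) c) =
      br (cl (1 - p + (1 - q)) (bracket 𝒱 α (1 - p) x (1 - q) y)) c +
        ((p - 1) * (q - 1)).negOnePow • br (cl (1 - q) y) (br (cl (1 - p) x) c)) hsurj (by simp)
      (fun c c' h h' => by simp only [map_add, smul_add, h, h']; abel) (fun g z hz => ?_) c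
    rw [hbr _ _ _ _ hy hz, hbr _ _ _ _ hx hz, hbr _ _ _ _ hx (isCocycle_bracket hα hD hy hz),
      hbr _ _ _ _ hy (isCocycle_bracket hα hD hx hz),
      hbr _ _ _ _ (isCocycle_bracket hα hD hx hy) hz, bracket_jacobi hα hx.1 hy.1 hz.1, map_add,
      LinearMap.map_smul_of_tower, show (1 - p) * (1 - q) = (p - 1) * (q - 1) by ring, add_assoc,
      add_left_comm (1 - q)]
  leibniz p q a b c := by
    obtain ⟨d, rfl⟩ : ∃ d, p = 1 - d := ⟨1 - p, by ring⟩
    obtain ⟨e, rfl⟩ : ∃ e, q = 1 - e := ⟨1 - q, by ring⟩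
    obtain ⟨x, hx, hxa⟩ := hsurj _ a
    obtain ⟨y, hy, hyb⟩ := hsurj _ b
    rw [sub_sub_cancel] at hx hy hxa hyb
    rw [hxa, hyb, hbr _ _ _ _ hx hy]
    refine class_induction (P := fun c => br (cl d x) (mul (cl e y) c) =
      mul (cl (d + e) (bracket 𝒱 α d x e y)) c +
        ((1 - d - 1) * (1 - e)).negOnePow • mul (cl e y) (br (cl d x) c)) hsurj (by simp)
      (fun c c' h h' => by simp only [map_add, smul_add, h, h']; abel) (fun g z hz => ?_) c
    rw [hmul _ _ _ _ hy hz, hbr _ _ _ _ hx hz, LinearMap.map_smul_of_tower,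
      hbr _ _ _ _ hx (isCocycle_brace hα hD hDD hy hz),
      hmul _ _ _ _ (isCocycle_bracket hα hD hx hy) hz,
      hmul _ _ _ _ hy (isCocycle_bracket hα hD hx hz),
      show (1 - d - 1) * (1 - e) = -d + d * e by ring]
    -- The homotopy determines the bracket with a product up to `(-1)^d`, which is moved to the
    -- other side.
    have h := class_leibniz hα hD hcl hx hy hz
    rw [← eq_inv_smul_iff] at h
    rw [h]
    simp only [Int.negOnePow_add, Int.negOnePow_neg]
    rcases Int.units_eq_one_or (d * e).negOnePow with h1 | h1 <;>
    rcases Int.units_eq_one_or d.negOnePow with h2 | h2 <;>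
    rcases Int.units_eq_one_or e.negOnePow with h3 | h3 <;>
    simp only [h1, h2, h3, inv_one, inv_neg, one_smul, Units.neg_smul, smul_neg, smul_add, mul_one,
      mul_neg, neg_neg]

end Gerstenhaber

/-! ### Cocycles, boundaries and classes in Hochschild cohomology. -/

section Cohomology

variable {K : Type*} [Field K] {A : Type*} [AddCommGroup A] [Module K A]
  {𝒜 : ℤ → Submodule K A} [DirectSum.Decomposition 𝒜] (S : HAInfAlgebra K A 𝒜)

namespace HAInfAlgebra

lemma mem_Z_iff {p : ℤ} {x : List A → A} :
    x ∈ S.Z p ↔ IsCocycle (susp 𝒜) S.α S.D (-(p - 1)) x := by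
  simp only [Z, Submodule.mem_map, LinearMap.mem_ker, Submodule.subtype_apply, IsCocycle]
  constructor
  · rintro ⟨y, hy, rfl⟩
    exact ⟨y.2, hy⟩
  · rintro ⟨h, hx⟩
    exact ⟨⟨x, h⟩, hx, rfl⟩

/-- A linear map that sends a cocycle of degree `d` to its class. -/
def classMap : ℤ → (List A → A) →ₗ[K] GradedSum S.H :=
  gradedExtend (H := S.H) fun p => ((S.B p).submoduleOf (S.Z p)).mkQ

lemma classMap_eq {d p : ℤ} (h : d = 1 - p) {x : List A → A} (hx : x ∈ S.Z p) :
    S.classMap d x = S.cls p ⟨x, hx⟩ :=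
  gradedExtend_eq (H := S.H) _ h hx

lemma isCocycle_boundary {d : ℤ} {u : List A → A} (hu : u ∈ Coder (susp 𝒜) S.α d) :
    IsCocycle (susp 𝒜) S.α S.D (-1 + d) (bracket (susp 𝒜) S.α (-1) S.D d u) :=
  ⟨bracket_mem S.susp_α S.D_mem hu, S.bracket_D_bracket_D hu⟩

lemma mem_B_iff {p : ℤ} {x : List A → A} : x ∈ S.B p ↔
    ∃ u ∈ Coder (susp 𝒜) S.α (2 - p), bracket (susp 𝒜) S.α (-1) S.D (2 - p) u = x := by
  have h : -(p - 1 - 1) = 2 - p := by ring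
  simp only [B, LinearMap.mem_range]
  rw [← h]
  constructor
  · rintro ⟨u, rfl⟩
    exact ⟨u, u.2, rfl⟩
  · rintro ⟨u, hu, rfl⟩
    exact ⟨⟨u, hu⟩, rfl⟩

lemma classMap_boundary (d : ℤ) (u : List A → A) (hu : u ∈ Coder (susp 𝒜) S.α d) :
    S.classMap (-1 + d) (bracket (susp 𝒜) S.α (-1) S.D d u) = 0 := by
  have hZ : bracket (susp 𝒜) S.α (-1) S.D d u ∈ S.Z (2 - d) := by
    rw [mem_Z_iff, show -(2 - d - 1) = -1 + d by ring]
    exact S.isCocycle_boundary hu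
  have hB : bracket (susp 𝒜) S.α (-1) S.D d u ∈ S.B (2 - d) :=
    S.mem_B_iff.2 ⟨u, by rwa [sub_sub_cancel], by rw [sub_sub_cancel]⟩
  refine (S.classMap_eq (by ring) hZ).trans ?_
  rw [cls, (Submodule.Quotient.mk_eq_zero _).2 (show _ ∈ (S.B (2 - d)).submoduleOf _ from hB)]
  exact map_zero _

/-- The operation on cohomology induced by an operation on cocycles. -/
def inducedOp (β : ∀ p q, S.Z p →ₗ[K] S.Z q →ₗ[K] GradedSum S.H)
    (h₁ : ∀ p q, ∀ x : S.Z p, (x : List A → A) ∈ S.B p → ∀ y, β p q x y = 0)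
    (h₂ : ∀ p q x, ∀ y : S.Z q, (y : List A → A) ∈ S.B q → β p q x y = 0) :
    GradedSum S.H →ₗ[K] GradedSum S.H →ₗ[K] GradedSum S.H :=
  directSumLift₂ (H := S.H) (W := GradedSum S.H) fun p q => quotientLift₂ _ _ (β p q)
    (fun x hx y => h₁ p q x hx y) (fun x y hy => h₂ p q x y hy)

lemma inducedOp_cls (β : ∀ p q, S.Z p →ₗ[K] S.Z q →ₗ[K] GradedSum S.H)
    (h₁ : ∀ p q, ∀ x : S.Z p, (x : List A → A) ∈ S.B p → ∀ y, β p q x y = 0)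
    (h₂ : ∀ p q x, ∀ y : S.Z q, (y : List A → A) ∈ S.B q → β p q x y = 0) (p q : ℤ) (x : S.Z p)
    (y : S.Z q) : S.inducedOp β h₁ h₂ (S.cls p x) (S.cls q y) = β p q x y :=
  directSumLift₂_lof (H := S.H) (W := GradedSum S.H) _ p q _ _

end HAInfAlgebra

end Cohomology

/-! ### Product and bracket on Hochschild cohomology. -/

section Operations

variable {K : Type*} [Field K] {A : Type*} [AddCommGroup A] [Module K A]
  {𝒜 : ℤ → Submodule K A} [DirectSum.Decomposition 𝒜] (S : HAInfAlgebra K A 𝒜)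

namespace HAInfAlgebra

lemma brace_D_slot_add (X₁ X₃ : List (ℤ × (List A → A))) (d : ℤ) (x y : List A → A) :
    brace (susp 𝒜) S.α S.D (X₁ ++ (d, x + y) :: X₃) =
      brace (susp 𝒜) S.α S.D (X₁ ++ (d, x) :: X₃) +
        brace (susp 𝒜) S.α S.D (X₁ ++ (d, y) :: X₃) := by
  simp only [brace_eq_act S.susp_α, ← actSlot_apply S.susp_α (F := fun _ => S.D)
    (fun _ => S.isMultilinear_D), map_add]

lemma brace_D_slot_smul (X₁ X₃ : List (ℤ × (List A → A))) (d : ℤ) (r : K) (x : List A → A) :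
    brace (susp 𝒜) S.α S.D (X₁ ++ (d, r • x) :: X₃) =
      r • brace (susp 𝒜) S.α S.D (X₁ ++ (d, x) :: X₃) := by
  simp only [brace_eq_act S.susp_α, ← actSlot_apply S.susp_α (F := fun _ => S.D)
    (fun _ => S.isMultilinear_D), map_smul]

lemma isMultilinear_of_mem_Z {p : ℤ} (x : S.Z p) : IsMultilinear K (x : List A → A) :=
  (S.mem_Z_iff.1 x.2).1.2.1

/-- The class of the product of two cocycles. -/
def cupClass (p q : ℤ) : S.Z p →ₗ[K] S.Z q →ₗ[K] GradedSum S.H :=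
  LinearMap.mk₂ K (fun x y => S.classMap (-1 + -(p - 1) + -(q - 1)) (S.cup p q x y))
    (fun x x' y => by
      have := S.brace_D_slot_add [] [(-(q - 1), (y : List A → A))] (-(p - 1)) x x'
      simp only [List.nil_append] at this
      simp only [cup, Submodule.coe_add, this, smul_add, map_add])
    (fun r x y => by
      have := S.brace_D_slot_smul [] [(-(q - 1), (y : List A → A))] (-(p - 1)) r x
      simp only [List.nil_append] at this
      simp only [cup, Submodule.coe_smul, this]
      rw [smul_comm, map_smul])
    (fun x y y' => by
      have := S.brace_D_slot_add [(-(p - 1), (x : List A → A))] [] (-(q - 1)) y y'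
      simp only [List.cons_append, List.nil_append] at this
      simp only [cup, Submodule.coe_add, this, smul_add, map_add])
    (fun r x y => by
      have := S.brace_D_slot_smul [(-(p - 1), (x : List A → A))] [] (-(q - 1)) r y
      simp only [List.cons_append, List.nil_append] at this
      simp only [cup, Submodule.coe_smul, this]
      rw [smul_comm, map_smul])

/-- The class of the bracket of two cocycles. -/
def bracketClass (p q : ℤ) : S.Z p →ₗ[K] S.Z q →ₗ[K] GradedSum S.H :=
  LinearMap.mk₂ K (fun x y => S.classMap (-(p - 1) + -(q - 1)) (S.cochainBracket p q x y))
    (fun x x' y => by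
      simp only [cochainBracket, bracket, Submodule.coe_add, brace_add_left,
        brace_add_right _ _ (S.isMultilinear_of_mem_Z y), smul_add, map_add, map_sub]
      abel)
    (fun r x y => by
      simp only [cochainBracket, bracket, Submodule.coe_smul, brace_smul_left,
        brace_smul_right _ _ (S.isMultilinear_of_mem_Z y)]
      rw [smul_comm, ← smul_sub, map_smul])
    (fun x y y' => by
      simp only [cochainBracket, bracket, Submodule.coe_add, brace_add_left,
        brace_add_right _ _ (S.isMultilinear_of_mem_Z x), smul_add, map_add, map_sub]
      abel)
    (fun r x y => by
      simp only [cochainBracket, bracket, Submodule.coe_smul, brace_smul_left,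
        brace_smul_right _ _ (S.isMultilinear_of_mem_Z x)]
      rw [smul_comm, ← smul_sub, map_smul])

lemma exists_boundary {p : ℤ} {x : List A → A} (hx : x ∈ S.B p) :
    ∃ d, ∃ u ∈ Coder (susp 𝒜) S.α d, -(p - 1) = -1 + d ∧
      bracket (susp 𝒜) S.α (-1) S.D d u = x := by
  obtain ⟨u, hu, h⟩ := S.mem_B_iff.1 hx
  exact ⟨_, u, hu, by ring, h⟩

/-- The product on cohomology. -/
def cohomologyMul : GradedSum S.H →ₗ[K] GradedSum S.H →ₗ[K] GradedSum S.H :=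
  S.inducedOp S.cupClass
    (fun p q x hx y => by
      obtain ⟨d, u, hu, hd, hux⟩ := S.exists_boundary hx
      simp only [cupClass, LinearMap.mk₂_apply, cup]
      rw [LinearMap.map_smul_of_tower, ← hux, hd, class_brace_boundary_left S.susp_α S.D_mem
        S.brace_D_D S.classMap_boundary hu (S.mem_Z_iff.1 y.2), smul_zero])
    (fun p q x y hy => by
      obtain ⟨d, u, hu, hd, huy⟩ := S.exists_boundary hy
      simp only [cupClass, LinearMap.mk₂_apply, cup]
      rw [LinearMap.map_smul_of_tower, ← huy, hd, class_brace_boundary_right S.susp_α S.D_mem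
        S.brace_D_D S.classMap_boundary (S.mem_Z_iff.1 x.2) hu, smul_zero])

/-- The bracket on cohomology. -/
def cohomologyBracket : GradedSum S.H →ₗ[K] GradedSum S.H →ₗ[K] GradedSum S.H :=
  S.inducedOp S.bracketClass
    (fun p q x hx y => by
      obtain ⟨d, u, hu, hd, hux⟩ := S.exists_boundary hx
      simp only [bracketClass, LinearMap.mk₂_apply, cochainBracket]
      rw [← hux, hd, class_bracket_boundary_left S.susp_α S.D_mem S.classMap_boundary hu
        (S.mem_Z_iff.1 y.2)])
    (fun p q x y hy => by
      obtain ⟨d, u, hu, hd, huy⟩ := S.exists_boundary hy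
      simp only [bracketClass, LinearMap.mk₂_apply, cochainBracket]
      rw [← huy, hd, class_bracket_boundary_right S.susp_α S.D_mem S.classMap_boundary
        (S.mem_Z_iff.1 x.2) hu])

lemma cohomologyMul_cls {p q : ℤ} (x : S.Z p) (y : S.Z q) :
    S.cohomologyMul (S.cls p x) (S.cls q y) =
      S.classMap (-1 + -(p - 1) + -(q - 1)) (S.cup p q x y) :=
  S.inducedOp_cls _ _ _ p q x y

lemma cohomologyBracket_cls {p q : ℤ} (x : S.Z p) (y : S.Z q) :
    S.cohomologyBracket (S.cls p x) (S.cls q y) =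
      S.classMap (-(p - 1) + -(q - 1)) (S.cochainBracket p q x y) :=
  S.inducedOp_cls _ _ _ p q x y

lemma mem_Z_of_isCocycle {d : ℤ} {x : List A → A} (hx : IsCocycle (susp 𝒜) S.α S.D d x) :
    x ∈ S.Z (1 - d) := by
  rwa [mem_Z_iff, show -(1 - d - 1) = d by ring]

lemma classMap_isCocycle {d : ℤ} {x : List A → A} (hx : IsCocycle (susp 𝒜) S.α S.D d x) :
    S.classMap d x = S.cls (1 - d) ⟨x, S.mem_Z_of_isCocycle hx⟩ :=
  S.classMap_eq (sub_sub_cancel _ _).symm _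

/-- The Gerstenhaber algebra structure on Hochschild cohomology. -/
def cohomologyGerstenhaber : GerstenhaberAlgebra K S.H :=
  gerstenhaberOfClasses (H := S.H) S.susp_α S.D_mem S.brace_D_D S.classMap S.classMap_boundary
    (fun d x hx => by
      rw [S.classMap_isCocycle hx]
      exact LinearMap.mem_range_self _ _)
    (fun p a => by
      obtain ⟨x, rfl⟩ := Submodule.Quotient.mk_surjective _ a
      have hx := S.mem_Z_iff.1 x.2
      rw [show -(p - 1) = 1 - p by ring] at hx
      exact ⟨x, hx, (S.classMap_eq rfl x.2).symm⟩)
    S.cohomologyMul S.cohomologyBracket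
    (fun d e x y hx hy => by
      rw [S.classMap_isCocycle hx, S.classMap_isCocycle hy]
      refine (S.cohomologyMul_cls _ _).trans ?_
      have hd : ∀ d : ℤ, -(1 - d - 1) = d := fun d => by ring
      -- The cup product carries the sign `(-1)^{p+1}`; with `p = 1 - d` this is `(-1)^d`.
      rw [cup, LinearMap.map_smul_of_tower, hd, hd, show 1 - d + 1 = -d + 2 * 1 by ring,
        Int.negOnePow_add, Int.negOnePow_two_mul, mul_one, Int.negOnePow_neg])
    (fun d e x y hx hy => by
      rw [S.classMap_isCocycle hx, S.classMap_isCocycle hy]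
      refine (S.cohomologyBracket_cls _ _).trans ?_
      have hd : ∀ d : ℤ, -(1 - d - 1) = d := fun d => by ring
      rw [cochainBracket, hd, hd])

lemma cup_mem_Z {p q : ℤ} (x : S.Z p) (y : S.Z q) : S.cup p q x y ∈ S.Z (p + q) := by
  refine Submodule.smul_of_tower_mem _ _ (S.mem_Z_iff.2 ?_)
  have := isCocycle_brace S.susp_α S.D_mem S.brace_D_D (S.mem_Z_iff.1 x.2) (S.mem_Z_iff.1 y.2)
  rwa [show -1 + -(p - 1) + -(q - 1) = -(p + q - 1) by ring] at this

lemma cochainBracket_mem_Z {p q : ℤ} (x : S.Z p) (y : S.Z q) :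
    S.cochainBracket p q x y ∈ S.Z (p + q - 1) := by
  refine S.mem_Z_iff.2 ?_
  have := isCocycle_bracket S.susp_α S.D_mem (S.mem_Z_iff.1 x.2) (S.mem_Z_iff.1 y.2)
  rwa [show -(p - 1) + -(q - 1) = -(p + q - 1 - 1) by ring] at this

end HAInfAlgebra

end Operations

end HomAInf

open HomAInf in
theorem mainTheorem8 {K : Type*} [Field K] [CharZero K] {A : Type*} [AddCommGroup A] [Module K A]
    (𝒜 : ℤ → Submodule K A) [DirectSum.Decomposition 𝒜] (S : HAInfAlgebra K A 𝒜) :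
    -- `D` is a square-zero coderivation of degree `-1` of `TV`
    (∃ hD : S.D ∈ Coder (susp 𝒜) S.α (-1),
      coderLift (susp 𝒜) S.α (-1) ⟨S.D, hD⟩ ∘ₗ coderLift (susp 𝒜) S.α (-1) ⟨S.D, hD⟩ = 0) ∧
    -- the bracket of cochains is the graded commutator of coderivations
    (∀ (p q : ℤ) (x : S.C p) (y : S.C q),
      ∃ h : S.cochainBracket p q x y ∈ S.C (p + q - 1),
        coderLift (susp 𝒜) S.α (-(p + q - 1 - 1)) ⟨S.cochainBracket p q x y, h⟩ =
          coderLift (susp 𝒜) S.α (-(p - 1)) x ∘ₗ coderLift (susp 𝒜) S.α (-(q - 1)) y -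
            ((p - 1) * (q - 1)).negOnePow •
              (coderLift (susp 𝒜) S.α (-(q - 1)) y ∘ₗ coderLift (susp 𝒜) S.α (-(p - 1)) x)) ∧
    -- `(C^•, δ)` is a cochain complex
    (∀ (p : ℤ) (x : S.C p), ∃ h : S.δ p x ∈ S.C (p + 1), S.δ (p + 1) ⟨S.δ p x, h⟩ = 0) ∧
    -- the braces make the cochains into an `A_∞`-algebra
    (∃ Ψ : HAInfAlgebra K (⨁ p, S.C p) S.cochainGrading, Ψ.α = LinearMap.id ∧
      ∀ (k : ℕ), 1 ≤ k → ∀ (p : Fin k → ℤ) (x : (j : Fin k) → S.C (p j)),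
        ∃ h : S.ψ k p x ∈ S.C (∑ j, p j + 2 - k),
          Ψ.μ k (fun j => DirectSum.lof K ℤ (fun p => S.C p) (p j) (x j)) =
            (∑ j : Fin k, ((k : ℤ) - 1 - (j : ℕ)) * (p j - 1)).negOnePow •
              DirectSum.lof K ℤ (fun p => S.C p) (∑ j, p j + 2 - k) ⟨S.ψ k p x, h⟩) ∧
    -- the cohomology is a Gerstenhaber algebra with the induced product and bracket
    ∃ G : GerstenhaberAlgebra K S.H, ∀ (p q : ℤ) (x : S.Z p) (y : S.Z q),
      (∃ h : S.cup p q x y ∈ S.Z (p + q),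
        G.mul (S.cls p x) (S.cls q y) = S.cls (p + q) ⟨S.cup p q x y, h⟩) ∧
      (∃ h : S.cochainBracket p q x y ∈ S.Z (p + q - 1),
        G.bracket (S.cls p x) (S.cls q y) =
          S.cls (p + q - 1) ⟨S.cochainBracket p q x y, h⟩) := by
  refine ⟨⟨S.D_mem, S.coderLift_D_comp⟩, fun p q x y => ?_, fun p x => ⟨S.δ_mem x, S.δ_δ x⟩,
    ⟨S.cochainAlgebra, rfl, fun k hk p x => S.cochainAlgebra_μ hk p x⟩,
    S.cohomologyGerstenhaber, fun p q x y => ⟨⟨S.cup_mem_Z x y, ?_⟩,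
      S.cochainBracket_mem_Z x y, ?_⟩⟩
  · have h := S.cochainBracket_mem x.2 y.2
    exact ⟨h, S.coderLift_cochainBracket x y h⟩
  · exact (S.cohomologyMul_cls x y).trans (S.classMap_eq (by ring) _)
  · exact (S.cohomologyBracket_cls x y).trans (S.classMap_eq (by ring) _)
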